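/- **Notation.** Let $k\ge 2$. A domain is a non-empty connected open subset of $\mathbb C^k$. For a domain $D$, a smooth defining function near $q\in bD$ is a real $C^\infty$ function $\rho$ on a neighbourhood $V$ of $q$ with $D\cap V=\{\rho<0\}$ and $d\rho\ne0$ on $\{\rho=0\}$. Where it exists, $N(q)=-\nabla\rho/\|\nabla\rho\|$ is the inward unit normal, $T^{\mathbb C}_q bD=\{u:\langle N(q),u\rangle=0\}$, and the Levi form at $q$ is $u\mapsto\sum \frac{\partial^2\rho}{\partial z_j\partial\bar z_k}(q)u_j\bar u_k/\|\nabla\rho(q)\|$ on $T^{\mathbb C}_q bD$; $\mathcal{SPC}(bD)$ is the set of points where it is positive definite. Put $\Lambda_q(z)=\mathrm{Re}\langle N(q),z-q\rangle$, let $B_\varepsilon(q)$ be the open ball of centre $q+\varepsilon N(q)$ and radius $\varepsilon$, and $B^+_\varepsilon(q)=B_\varepsilon(q)\cap\{\Lambda_q\ge\varepsilon\}$. For $X\subset\mathcal{SPC}(bD)$ and $x,y\in X$, $d^{CR}_X(x,y)\in[0,\infty]$ is the infimum of the Euclidean lengths of the piecewise $C^1$ paths in $X$ from $x$ to $y$ whose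 velocity at each point $\gamma(t)$ lies in $T^{\mathbb C}_{\gamma(t)}bD$; $B^{CR}_X(x,r)$ is the corresponding open ball. $B(y,\eta)$ is the open Euclidean ball. Let $\Omega,\tilde\Omega$ be domains, $U$ open in $b\Omega$ and relatively compact in $\mathcal{SPC}(b\Omega)$, and $W\subset\mathcal{SPC}(b\tilde\Omega)$ open in $b\tilde\Omega$ with $\Lambda_x\ge0$ on $\tilde\Omega$ for all $x\in W$. Let $\kappa_1$ be a lower bound for the eigenvalues of the Levi form on $U$ and $\kappa_2$ an upper bound for those on $W$. Let $B^{CR}(p,\tau):=B^{CR}_U(p,\tau)$. Call $(p,\tau,\varepsilon)$ admissible for $(\Omega,U)$ if $p\in U$, $\tau,\varepsilon>0$, $B^{CR}(p,\tau)\Subset U$ and $B_\varepsilon(q)\subset\Omega$ for all $q\in B^{CR}(p,\tau)$. Put $A_\varepsilon(p,\tau)=\bigcup_{q\in B^{CR}(p,\tau)}B^+_\varepsilon(q)$. A holomorphic map $F:\Omega\to\tilde\Omega$ is proper relative to $U$ if $F\in C^\infty(\Omega\cup U)$ and $F(U)\subset b\tilde\Omega$. For $a\in W$, $\mathcal F_{p,a}$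 is the set of such $F$ with $F(p)=a$. **(I) Covering lemma.** If $(p,\tau,\varepsilon)$ is admissible, $F:\Omega\to\tilde\Omega$ is holomorphic and proper relative to $U$, $F(p)\in W$, and $M=\inf\{|\Lambda_x(z)|: x\in W,\ z\in F(A_\varepsilon(p,\tau))\}$, then $$F(B^{CR}(p,\tau))\supset B^{CR}_W\Big(F(p),\Big[\tfrac{\kappa_1}{8\kappa_2}\tfrac{M}{\varepsilon}\Big]^{1/2}\tau\Big).$$ From now on $W$ is moreover relatively compact in $\mathcal{SPC}(b\tilde\Omega)$. For a constant $c>0$ and admissible $(p,\tau,\varepsilon_0)$, $a\in W$, consider the properties: 1. (for a compact set $K$) for all $F\in\mathcal F_{p,a}$: $F(A_{\varepsilon_0}(p,\tau))\subset K\Rightarrow F(B^{CR}(p,\tau))\supset B^{CR}_W(a,c\tau)$; 2. (for $\eta>0$) for all $\lambda>\eta$, $0<\varepsilon\le\varepsilon_0$, $F\in\mathcal F_{p,a}$: $F(A_\varepsilon(p,\tau))\subset\{\Lambda_a\ge\lambda\}\Rightarrow F(B^{CR}(p,\tau))\supset B^{CR}_{W\cap\{\Lambda_a\le\lambda-\eta\}}(a,c\tau/\sqrt\varepsilon)$;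 3. (for $0<\eta<\eta'$) for all $y\in\mathbb C^k$ with $|a-y|\ge\eta'$, $0<\varepsilon\le\varepsilon_0$, $F\in\mathcal F_{p,a}$: $F(A_\varepsilon(p,\tau))\subset B(y,\eta)\Rightarrow F(B^{CR}(p,\tau))\supset B^{CR}_{W\setminus B(y,\eta')}(a,c\tau/\sqrt\varepsilon)$. **(II) Dependence of the constants.** There is a function $C:\mathbb R^3\to\mathbb R$, positive on $(0,\infty)^3$ and depending on nothing but $k$, such that, for all data as above with $\kappa_1,\kappa_2>0$ and all $m>0$, the properties hold with $c=C(\kappa_1,\kappa_2,m)$: property 1 for every compact $K\subset\tilde\Omega$ with $\Lambda_x(z)\ge m$ for all $x\in W$, $z\in K$; property 2 (resp. 3) for every $\eta$ (resp. $\eta<\eta'$) such that $\Lambda_x(z)\ge m$ for all $x\in W$, $z\in\tilde\Omega$ with $|z-x|\ge\eta$ (resp. $|z-x|\ge\eta'-\eta$). **(III) Existence and stability.** Fix $(\tilde\Omega,W)$ and $\kappa_1>0$. For every compact $K\subset\tilde\Omega$ there is $c(K)>0$ for which property 1 holds for all $(\Omega,U)$ whose Levi eigenvalues on $U$ are $\ge\kappa_1$,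 all admissible $(p,\tau,\varepsilon_0)$ and all $a\in W$. Suppose further that $W$ is relatively compact in a relatively open $W_1\subset\mathcal{SPC}(b\tilde\Omega)$ such that $\Lambda_x>0$ on $\overline{\tilde\Omega}\setminus\{x\}$ for all $x\in W_1$. Then for every $\eta>0$ (resp. all $0<\eta<\eta'$) there is a constant $c>0$ with which property 2 (resp. 3) holds in the same generality. In all three cases the property remains true with $c/2$ under small perturbations: if $\Omega_n\to\Omega$ and $\tilde\Omega_n\to\tilde\Omega$ for the Hausdorff distance, and $U_n\to U$ (Levi eigenvalues on $U$ at least $\kappa_1$) and $W_n\to W$ in the $C^2$ sense (for the Hausdorff distance and, near each point of the closure of the limit, through defining functions converging uniformly together with their first and second derivatives), where $(\Omega_n,U_n)$ and $(\tilde\Omega_n,W_n)$ satisfy the same standing assumptions ($U_n$, $W_n$ relatively open and relatively compact in the strictly pseudoconvex boundary points, $\Lambda_x\ge0$ on $\tilde\Omega_n$ for $x\in W_n$), then for all large $n$ the property holds with $c/2$ for $(\Omega_n,U_n)$, $(\tilde\Omega_n,W_n)$, all admissible $(p,\tau,\varepsilon_0)$ for $(\Omega_n,U_n)$ and all $a\in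 W_n$. -/

import Mathlib

open Set Filter Topology
open scoped ContDiff ENNReal

noncomputable section

namespace CRMaps

/-! ### Defining functions, normals, supporting functions -/

/-- `ρ` is a smooth defining function of `Ω` on the open set `V`: on `V` one has `Ω = {ρ < 0}`,
and the differential of `ρ` does not vanish on `{ρ = 0}`, the part of the boundary in `V`. -/
structure IsDefiningFunctionOn {E : Type*} [NormedAddCommGroup E] [InnerProductSpace ℂ E]
    (Ω : Set E) (ρ : E → ℝ) (V : Set E) : Prop where
  isOpen : IsOpen V
  contDiffOn : ContDiffOn ℝ ∞ ρ V
  mem_iff : ∀ z ∈ V, z ∈ Ω ↔ ρ z < 0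
  regular : ∀ z ∈ V, ρ z = 0 → fderiv ℝ ρ z ≠ 0

/-- `ρ` is a smooth defining function of `Ω` near the boundary point `q`. -/
def IsDefiningFunctionAt {E : Type*} [NormedAddCommGroup E] [InnerProductSpace ℂ E]
    (Ω : Set E) (ρ : E → ℝ) (q : E) : Prop :=
  ρ q = 0 ∧ ∃ V : Set E, q ∈ V ∧ IsDefiningFunctionOn Ω ρ V

/-- `n` is the inward unit normal `-∇ρ(q) / ‖∇ρ(q)‖` of `Ω` at `q`, where `ρ` is a smooth
defining function of `Ω` near `q`; the norm of the differential is that of the gradient, and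
`Re ⟪n, v⟫` is the Euclidean scalar product. -/
def IsInwardNormal {E : Type*} [NormedAddCommGroup E] [InnerProductSpace ℂ E]
    (Ω : Set E) (q n : E) : Prop :=
  ‖n‖ = 1 ∧ ∃ ρ : E → ℝ, IsDefiningFunctionAt Ω ρ q ∧
    ∀ v : E, fderiv ℝ ρ q v = -(‖fderiv ℝ ρ q‖ * (inner ℂ n v).re)

theorem IsDefiningFunctionAt.tendsto_slope {E : Type*} [NormedAddCommGroup E]
    [InnerProductSpace ℂ E] {Ω : Set E} {ρ : E → ℝ} {q : E} (h : IsDefiningFunctionAt Ω ρ q)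
    (v : E) : Tendsto (fun t : ℝ => t⁻¹ * ρ (q + t • v)) (𝓝[>] 0) (𝓝 (fderiv ℝ ρ q v)) := by
  obtain ⟨h0, V, hqV, hV⟩ := h
  have hd : DifferentiableAt ℝ ρ q :=
    (hV.contDiffOn.contDiffAt (hV.isOpen.mem_nhds hqV)).differentiableAt (by simp)
  have h1 : HasDerivAt (fun t : ℝ => q + t • v) v 0 := by
    simpa using ((hasDerivAt_id (0 : ℝ)).smul_const v).const_add q
  have h2 : HasDerivAt (fun t : ℝ => ρ (q + t • v)) (fderiv ℝ ρ q v) 0 := by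
    have h3 : HasFDerivAt ρ (fderiv ℝ ρ q) (q + (0 : ℝ) • v) := by
      simpa using hd.hasFDerivAt
    exact h3.comp_hasDerivAt (0 : ℝ) h1
  have h4 := (hasDerivAt_iff_tendsto_slope_zero.1 h2).mono_left
    (nhdsWithin_mono (0 : ℝ) (show Ioi (0 : ℝ) ⊆ {0}ᶜ from fun t ht => (ne_of_gt ht : t ≠ 0)))
  simpa [h0] using h4

theorem IsDefiningFunctionAt.eventually_mem_nhds {E : Type*} [NormedAddCommGroup E]
    [InnerProductSpace ℂ E] {Ω : Set E} {ρ : E → ℝ} {q : E} (h : IsDefiningFunctionAt Ω ρ q)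
    (v : E) : ∀ᶠ t : ℝ in 𝓝[>] 0, (q + t • v ∈ Ω ↔ ρ (q + t • v) < 0) := by
  obtain ⟨-, V, hqV, hV⟩ := h
  have h1 : Tendsto (fun t : ℝ => q + t • v) (𝓝[>] 0) (𝓝 q) := by
    have : Continuous (fun t : ℝ => q + t • v) := by fun_prop
    have h2 := this.tendsto 0
    simp only [zero_smul, add_zero] at h2
    exact h2.mono_left nhdsWithin_le_nhds
  filter_upwards [h1 (hV.isOpen.mem_nhds hqV)] with t ht
  exact hV.mem_iff _ ht

/-- The inward unit normal does not depend on the defining function. -/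
theorem IsInwardNormal.unique {E : Type*} [NormedAddCommGroup E] [InnerProductSpace ℂ E]
    {Ω : Set E} {q n n' : E} (h : IsInwardNormal Ω q n) (h' : IsInwardNormal Ω q n') :
    n = n' := by
  obtain ⟨h1, ρ, hρ, hn⟩ := h
  obtain ⟨h1', ρ', hρ', hn'⟩ := h'
  by_contra hne
  have hpos : 0 < ‖n - n'‖ ^ 2 := by
    have : 0 < ‖n - n'‖ := norm_pos_iff.2 (sub_ne_zero.2 hne)
    positivity
  have hexp : ‖n - n'‖ ^ 2 = 2 - 2 * (inner ℂ n n').re := by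
    have := @norm_sub_sq ℂ E _ _ _ n n'
    simp only [h1, h1'] at this
    rw [this]
    simp only [RCLike.re_eq_complex_re]
    ring
  have hlt : (inner ℂ n n').re < 1 := by linarith
  have hsymm : (inner ℂ n' n).re = (inner ℂ n n').re := inner_re_symm (𝕜 := ℂ) n' n
  have hself : (inner ℂ n n).re = 1 := by
    simp [h1]
  have hself' : (inner ℂ n' n').re = 1 := by
    simp [h1']
  have hreg : ∀ {σ : E → ℝ}, IsDefiningFunctionAt Ω σ q → 0 < ‖fderiv ℝ σ q‖ := by
    rintro σ ⟨h0, V, hqV, hV⟩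
    exact norm_pos_iff.2 (hV.regular q hqV h0)
  have d1 : 0 < fderiv ℝ ρ q (n' - n) := by
    rw [hn, inner_sub_right, Complex.sub_re, hself]
    nlinarith [hreg hρ]
  have d2 : fderiv ℝ ρ' q (n' - n) < 0 := by
    rw [hn', inner_sub_right, Complex.sub_re, hself', hsymm]
    nlinarith [hreg hρ']
  have e1 := (hρ.tendsto_slope (n' - n)).eventually (lt_mem_nhds d1)
  have e2 := (hρ'.tendsto_slope (n' - n)).eventually (gt_mem_nhds d2)
  obtain ⟨t, ht1, ht2, ht3, ht4, ht0⟩ := (e1.and (e2.and ((hρ.eventually_mem_nhds (n' - n)).and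
    ((hρ'.eventually_mem_nhds (n' - n)).and self_mem_nhdsWithin)))).exists
  have ht0' : 0 < t⁻¹ := inv_pos.2 ht0
  have a1 : 0 < ρ (q + t • (n' - n)) := by
    by_contra hc
    exact absurd ht1 (not_lt.2 (mul_nonpos_of_nonneg_of_nonpos ht0'.le (not_lt.1 hc)))
  have a2 : ρ' (q + t • (n' - n)) < 0 := by
    by_contra hc
    exact absurd ht2 (not_lt.2 (mul_nonneg ht0'.le (not_lt.1 hc)))
  exact absurd (ht3.1 (ht4.2 a2)) (not_lt.2 a1.le)

/-- The inward unit normal exists at every boundary point with a defining function. -/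
theorem IsDefiningFunctionAt.exists_isInwardNormal {E : Type*} [NormedAddCommGroup E]
    [InnerProductSpace ℂ E] [CompleteSpace E] {Ω : Set E} {ρ : E → ℝ} {q : E}
    (h : IsDefiningFunctionAt Ω ρ q) : ∃ n, IsInwardNormal Ω q n := by
  have hpos : 0 < ‖fderiv ℝ ρ q‖ := by
    obtain ⟨h0, V, hqV, hV⟩ := h
    exact norm_pos_iff.2 (hV.regular q hqV h0)
  let _ : InnerProductSpace ℝ E := InnerProductSpace.complexToReal
  set f : StrongDual ℝ E := fderiv ℝ ρ q with hf
  set g : E := (InnerProductSpace.toDual ℝ E).symm f with hg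
  have hgn : ‖g‖ = ‖f‖ := by simp [hg]
  have hgv : ∀ v : E, f v = (inner ℂ g v).re := by
    intro v
    have h1 : inner ℝ g v = f v := by simp [hg]
    rw [← h1]
    rfl
  refine ⟨(-‖f‖⁻¹ : ℝ) • g, ?_, ρ, h, fun v => ?_⟩
  · rw [norm_smul, hgn, norm_neg, norm_inv, norm_norm, inv_mul_cancel₀ hpos.ne']
  · rw [← Complex.coe_smul, inner_smul_left]
    have h2 : ((starRingEnd ℂ) ((-‖f‖⁻¹ : ℝ) : ℂ) * inner ℂ g v).re
        = -‖f‖⁻¹ * (inner ℂ g v).re := by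
      rw [Complex.conj_ofReal, Complex.re_ofReal_mul]
    rw [h2, ← hgv v]
    change f v = -(‖f‖ * (-‖f‖⁻¹ * f v))
    field_simp

open Classical in
/-- The inward unit normal of `Ω` at a smooth boundary point `q` (and `0` elsewhere). -/
def inwardNormal {E : Type*} [NormedAddCommGroup E] [InnerProductSpace ℂ E]
    (Ω : Set E) (q : E) : E :=
  if h : ∃ n, IsInwardNormal Ω q n then h.choose else 0

theorem IsInwardNormal.inwardNormal_eq {E : Type*} [NormedAddCommGroup E]
    [InnerProductSpace ℂ E] {Ω : Set E} {q n : E} (h : IsInwardNormal Ω q n) :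
    inwardNormal Ω q = n := by
  have hex : ∃ n, IsInwardNormal Ω q n := ⟨n, h⟩
  rw [inwardNormal, dif_pos hex]
  exact hex.choose_spec.unique h

/-- `Λ_q(z) = Re ⟪N(q), z - q⟫`, the height of `z` over the real tangent plane of the boundary
of `Ω` at `q`. -/
def height {E : Type*} [NormedAddCommGroup E] [InnerProductSpace ℂ E]
    (Ω : Set E) (q z : E) : ℝ :=
  (inner ℂ (inwardNormal Ω q) (z - q)).re

/-- The open ball `B_ε(q)` with centre `q + ε N(q)` and radius `ε`, tangent to the boundary of
`Ω` at `q`. -/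
def tangentBall {E : Type*} [NormedAddCommGroup E] [InnerProductSpace ℂ E]
    (Ω : Set E) (q : E) (ε : ℝ) : Set E :=
  Metric.ball (q + ε • inwardNormal Ω q) ε

/-- The half-ball `B_ε⁺(q) = B_ε(q) ∩ {Λ_q ≥ ε}`. -/
def halfBall {E : Type*} [NormedAddCommGroup E] [InnerProductSpace ℂ E]
    (Ω : Set E) (q : E) (ε : ℝ) : Set E :=
  tangentBall Ω q ε ∩ {z | ε ≤ height Ω q z}

/-! ### Complex tangent vectors, Levi form, strict pseudoconvexity -/

/-- `u` lies in the complex tangent space of the boundary of `Ω` at `q`: the orthogonal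
complement of the normal for the Hermitian product. -/
def IsComplexTangent {E : Type*} [NormedAddCommGroup E] [InnerProductSpace ℂ E]
    (Ω : Set E) (q u : E) : Prop :=
  inner ℂ (inwardNormal Ω q) u = 0

/-- The Levi form `∑ ∂²ρ/∂z_j∂z̄_k (q) u_j ū_k`, written through the real second differential. -/
def leviForm {E : Type*} [NormedAddCommGroup E] [InnerProductSpace ℂ E]
    (ρ : E → ℝ) (q u : E) : ℝ :=
  (fderiv ℝ (fderiv ℝ ρ) q u u
    + fderiv ℝ (fderiv ℝ ρ) q (Complex.I • u) (Complex.I • u)) / 4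

/-- The strictly pseudoconvex points of the boundary of `Ω`. -/
def spc {E : Type*} [NormedAddCommGroup E] [InnerProductSpace ℂ E] (Ω : Set E) : Set E :=
  {q | ∃ ρ : E → ℝ, IsDefiningFunctionAt Ω ρ q ∧
    ∀ u : E, u ≠ 0 → IsComplexTangent Ω q u → 0 < leviForm ρ q u}

/-- The values on unit complex tangent vectors, at points of `X`, of the Levi form of the boundary
of `Ω`, normalized by a unit gradient. The extreme values at a point are the extreme eigenvalues
of the Levi form there. -/
def leviValues {E : Type*} [NormedAddCommGroup E] [InnerProductSpace ℂ E]
    (Ω X : Set E) : Set ℝ :=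
  {t | ∃ q ∈ X, ∃ ρ : E → ℝ, IsDefiningFunctionAt Ω ρ q ∧ ∃ u : E, ‖u‖ = 1 ∧
    IsComplexTangent Ω q u ∧ t = leviForm ρ q u / ‖fderiv ℝ ρ q‖}

/-! ### The CR distance -/

/-- `γ : [0, l] → X` is a complex path from `x` to `y` in the subset `X` of the boundary of `Ω`:
continuous, piecewise `C¹`, with complex tangent velocity. -/
structure IsComplexPath {E : Type*} [NormedAddCommGroup E] [InnerProductSpace ℂ E]
    (Ω X : Set E) (γ : ℝ → E) (l : ℝ) (x y : E) : Prop where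
  length_nonneg : 0 ≤ l
  source : γ 0 = x
  target : γ l = y
  mapsTo : MapsTo γ (Icc 0 l) X
  continuousOn : ContinuousOn γ (Icc 0 l)
  piecewise : ∃ (m : ℕ) (t : ℕ → ℝ), Monotone t ∧ t 0 = 0 ∧ t m = l ∧ ∀ i < m,
    ContDiffOn ℝ 1 γ (Icc (t i) (t (i + 1))) ∧
      ∀ s ∈ Ioo (t i) (t (i + 1)), IsComplexTangent Ω (γ s) (deriv γ s)

/-- The CR distance in `X` (infinite if there is no complex path): the infimum of the Euclidean
lengths of the complex paths in `X` between the two points. -/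
def crDist {E : Type*} [NormedAddCommGroup E] [InnerProductSpace ℂ E]
    (Ω X : Set E) (x y : E) : ℝ≥0∞ :=
  ⨅ (γ : ℝ → E) (l : ℝ) (_ : IsComplexPath Ω X γ l x y),
    ENNReal.ofReal (∫ s in (0 : ℝ)..l, ‖deriv γ s‖)

/-- The CR ball of `X` with centre `x` and radius `r`. -/
def crBall {E : Type*} [NormedAddCommGroup E] [InnerProductSpace ℂ E]
    (Ω X : Set E) (x : E) (r : ℝ) : Set E :=
  {y ∈ X | crDist Ω X x y < ENNReal.ofReal r}

/-! ### Domains with a marked piece of the boundary -/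

/-- A set `dom` of `E` with a marked part `part` of its boundary. -/
structure MarkedDomain (E : Type*) where
  dom : Set E
  part : Set E

/-- `A` is relatively compact in `B`. -/
def RelCompactIn {E : Type*} [TopologicalSpace E] (A B : Set E) : Prop :=
  IsCompact (closure A) ∧ closure A ⊆ B

/-- `S.dom` is a domain, and `S.part` is a relatively open part of its boundary which consists of
strictly pseudoconvex points. -/
structure MarkedDomain.IsPseudoconvexPiece {E : Type*} [NormedAddCommGroup E]
    [InnerProductSpace ℂ E] (S : MarkedDomain E) : Prop where
  isOpen : IsOpen S.dom
  isConnected : IsConnected S.dom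
  open_part : ∃ O : Set E, IsOpen O ∧ S.part = frontier S.dom ∩ O
  part_subset : S.part ⊆ spc S.dom

/-- The part is relatively compact in the set of strictly pseudoconvex boundary points. -/
structure MarkedDomain.IsSource {E : Type*} [NormedAddCommGroup E] [InnerProductSpace ℂ E]
    (S : MarkedDomain E) : Prop extends S.IsPseudoconvexPiece where
  relCompact : RelCompactIn S.part (spc S.dom)

/-- The domain lies on the inner side of its real tangent planes at the points of the part. -/
def MarkedDomain.IsSupported {E : Type*} [NormedAddCommGroup E] [InnerProductSpace ℂ E]
    (T : MarkedDomain E) : Prop :=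
  ∀ x ∈ T.part, ∀ z ∈ T.dom, 0 ≤ height T.dom x z

/-- Strict support up to the edge of the part: the part is relatively compact in a larger
relatively open set `W₁` of strictly pseudoconvex boundary points, at each of which the real
tangent plane meets the closure of the domain at this point only. -/
def MarkedDomain.IsStrictlySupported {E : Type*} [NormedAddCommGroup E] [InnerProductSpace ℂ E]
    (T : MarkedDomain E) : Prop :=
  ∃ W₁ : Set E, MarkedDomain.IsPseudoconvexPiece ⟨T.dom, W₁⟩ ∧ RelCompactIn T.part W₁ ∧
    ∀ x ∈ W₁, ∀ z ∈ closure T.dom, z ≠ x → 0 < height T.dom x z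

/-- A target: the part is relatively compact in the set of strictly pseudoconvex boundary points,
and `Λ_x ≥ 0` on the domain for every `x` in the part. -/
structure MarkedDomain.IsTarget {E : Type*} [NormedAddCommGroup E] [InnerProductSpace ℂ E]
    (T : MarkedDomain E) : Prop extends T.IsSource where
  isSupported : T.IsSupported

/-- `B^CR(p, τ)` is relatively compact in the part, and all the balls `B_ε(q)` tangent to the
boundary at points `q ∈ B^CR(p, τ)` lie in the domain. -/
structure MarkedDomain.IsAdmissible {E : Type*} [NormedAddCommGroup E] [InnerProductSpace ℂ E]
    (S : MarkedDomain E) (p : E) (τ ε : ℝ) : Prop where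
  mem : p ∈ S.part
  radius_pos : 0 < τ
  size_pos : 0 < ε
  relCompact : RelCompactIn (crBall S.dom S.part p τ) S.part
  ball_subset : ∀ q ∈ crBall S.dom S.part p τ, tangentBall S.dom q ε ⊆ S.dom

/-- `A_ε(p, τ)`, the union of the half-balls `B_ε⁺(q)` for `q ∈ B^CR(p, τ)`. -/
def MarkedDomain.halfBalls {E : Type*} [NormedAddCommGroup E] [InnerProductSpace ℂ E]
    (S : MarkedDomain E) (p : E) (τ ε : ℝ) : Set E :=
  ⋃ q ∈ crBall S.dom S.part p τ, halfBall S.dom q ε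

/-- `F : Ω → Ω'` is holomorphic and proper relative to `U ⊆ bΩ`: it is `C^∞` on `Ω ∪ U` and maps
`U` into `bΩ'`. -/
structure IsProperRelative {E : Type*} [NormedAddCommGroup E] [InnerProductSpace ℂ E]
    (S : MarkedDomain E) (Ω' : Set E) (F : E → E) : Prop where
  holomorphic : DifferentiableOn ℂ F S.dom
  mapsTo : MapsTo F S.dom Ω'
  smooth : ContDiffOn ℝ ∞ F (S.dom ∪ S.part)
  mapsTo_frontier : MapsTo F S.part (frontier Ω')

/-! ### The three situations -/

/-- If `F ∈ ℱ_{p,a}` maps `A_ε₀(p, τ)` into `K`, then the image of `B^CR(p, τ)` contains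
`B^CR_W(a, c τ)`. -/
def CoversFromCompact {E : Type*} [NormedAddCommGroup E] [InnerProductSpace ℂ E] (K : Set E)
    (S : MarkedDomain E) (p : E) (τ ε₀ : ℝ) (T : MarkedDomain E) (a : E) (c : ℝ) : Prop :=
  ∀ F : E → E, IsProperRelative S T.dom F → F p = a →
    F '' S.halfBalls p τ ε₀ ⊆ K →
      crBall T.dom T.part a (c * τ) ⊆ F '' crBall S.dom S.part p τ

/-- For `lam > η`, `ε ≤ ε₀` and `F ∈ ℱ_{p,a}`: if `F` maps `A_ε(p, τ)` into `{Λ_a ≥ lam}`, then the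
image of `B^CR(p, τ)` contains the CR ball with centre `a` and radius `c τ / √ε` of the region
`W ∩ {Λ_a ≤ lam - η}`. -/
def CoversBelowLevel {E : Type*} [NormedAddCommGroup E] [InnerProductSpace ℂ E] (η : ℝ)
    (S : MarkedDomain E) (p : E) (τ ε₀ : ℝ) (T : MarkedDomain E) (a : E) (c : ℝ) : Prop :=
  ∀ lam : ℝ, η < lam → ∀ ε : ℝ, 0 < ε → ε ≤ ε₀ →
    ∀ F : E → E, IsProperRelative S T.dom F → F p = a →
      F '' S.halfBalls p τ ε ⊆ {z | lam ≤ height T.dom a z} →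
        crBall T.dom (T.part ∩ {x | height T.dom a x ≤ lam - η}) a (c * τ / √ε)
          ⊆ F '' crBall S.dom S.part p τ

/-- For a point `y` with `|a - y| ≥ η'`, `ε ≤ ε₀` and `F ∈ ℱ_{p,a}`: if `F` maps `A_ε(p, τ)` into
`B(y, η)`, then the image of `B^CR(p, τ)` contains the CR ball with centre `a` and radius
`c τ / √ε` of the region `W \ B(y, η')`. -/
def CoversAwayFromBall {E : Type*} [NormedAddCommGroup E] [InnerProductSpace ℂ E] (η η' : ℝ)
    (S : MarkedDomain E) (p : E) (τ ε₀ : ℝ) (T : MarkedDomain E) (a : E) (c : ℝ) : Prop :=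
  ∀ y : E, η' ≤ dist a y → ∀ ε : ℝ, 0 < ε → ε ≤ ε₀ →
    ∀ F : E → E, IsProperRelative S T.dom F → F p = a →
      F '' S.halfBalls p τ ε ⊆ Metric.ball y η →
        crBall T.dom (T.part \ Metric.ball y η') a (c * τ / √ε)
          ⊆ F '' crBall S.dom S.part p τ

/-! ### Perturbations -/

/-- `S n → S`: the domains converge for the Hausdorff distance; the marked parts converge in the
`C²` sense, that is, for the Hausdorff distance and, on a neighbourhood of each point of the closure
of the limit part, through defining functions which converge uniformly with their differentials of
order one and two. -/
structure TendstoMarked {E : Type*} [NormedAddCommGroup E] [InnerProductSpace ℂ E]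
    (Sn : ℕ → MarkedDomain E) (S : MarkedDomain E) : Prop where
  hausdorff_dom :
    Tendsto (fun n => Metric.hausdorffEDist (Sn n).dom S.dom) atTop (𝓝 0)
  hausdorff_part :
    Tendsto (fun n => Metric.hausdorffEDist (Sn n).part S.part) atTop (𝓝 0)
  definingFunctions : ∀ q ∈ closure S.part, ∃ (V : Set E) (ρ : E → ℝ) (ρn : ℕ → E → ℝ),
    q ∈ V ∧ IsDefiningFunctionOn S.dom ρ V ∧
    (∀ᶠ n in atTop, IsDefiningFunctionOn (Sn n).dom (ρn n) V) ∧
    TendstoUniformlyOn ρn ρ atTop V ∧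
    TendstoUniformlyOn (fun n => fderiv ℝ (ρn n)) (fderiv ℝ ρ) atTop V ∧
    TendstoUniformlyOn (fun n => fderiv ℝ (fderiv ℝ (ρn n))) (fderiv ℝ (fderiv ℝ ρ)) atTop V

/-- Let `P S p τ ε₀ T a c` be one of the three covering properties above. For the fixed target `T`
and the lower bound `κ₁` for the Levi form on the source part, the constant `c` is good for all
source data, and `c / 2` is good for all small perturbations of the source and of the target. -/
def HoldsStably {E : Type*} [NormedAddCommGroup E] [InnerProductSpace ℂ E]
    (P : MarkedDomain E → E → ℝ → ℝ → MarkedDomain E → E → ℝ → Prop)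
    (T : MarkedDomain E) (κ₁ c : ℝ) : Prop :=
  ∀ S : MarkedDomain E, S.IsSource → κ₁ ∈ lowerBounds (leviValues S.dom S.part) →
    (∀ (p : E) (τ ε₀ : ℝ), S.IsAdmissible p τ ε₀ → ∀ a ∈ T.part, P S p τ ε₀ T a c) ∧
    ∀ Sn Tn : ℕ → MarkedDomain E, (∀ n, (Sn n).IsSource) → (∀ n, (Tn n).IsTarget) →
      TendstoMarked Sn S → TendstoMarked Tn T →
        ∀ᶠ n in atTop, ∀ (p : E) (τ ε₀ : ℝ), (Sn n).IsAdmissible p τ ε₀ →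
          ∀ a ∈ (Tn n).part, P (Sn n) p τ ε₀ (Tn n) a (c / 2)

end CRMaps

end

/-! Let `N`, `N'` be the inward normals of the two boundaries. At `q ∈ U` with `F q` in `W`, the
differential `dF` is complex linear and sends real tangent vectors to real tangent vectors, so it
multiplies the complex normal component by the real number `r(q) = Re⟪N'(F q), dF N(q)⟫`
(`IsProperRelative.inner_diff`). Comparing second derivatives along a boundary curve and along its
image shows that the Levi form of the target at `dF u` is `r(q)` times the Levi form of the source
at `u` (`IsProperRelative.leviForm_diff`). Hence `κ₁ r ‖u‖² ≤ κ₂ ‖dF u‖²`: a lower bound for `r`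
makes `F` expand complex tangent vectors (`IsProperRelative.levi_le`).

The bound for `r` is a quantitative Hopf lemma (`IsProperRelative.le_normalRate`). On the disc which
the complex normal line cuts out of the ball `B_ε(q)`, the height of `F` over the tangent plane at
`F q` is harmonic and nonnegative, and it vanishes at `q`. Harnack's inequality bounds its normal
derivative from below by the height at the centre divided by `2ε`, and the centre lies in `B_ε⁺(q)`.

So `F` is a local diffeomorphism between the boundaries, at the points of the closed CR ball mapped
to the region considered, and it expands complex directions by a factor `K`. A complex path in that
region of length less than `K τ` from `F p` is lifted step by step: every partial lift is shorter
than `τ`, so it stays in the CR ball, whose closure is compact in `U`, and there the local inverses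
have a uniform size (`image_crBall_of_hasLocalInverse`, `crBall_subset_image`).

The three covering properties follow once the heights are at least some `m > 0` over the tangent
planes in the region considered. For a compact `K` this is compactness, together with the bound `ε ≤
1/(2κ₁)`, which removes the size of the balls. For the other two, the domain may be unbounded, and
strict support gives linear growth of the heights (`MarkedDomain.IsTarget.exists_linear_growth`).
Stability holds because normals, Levi forms and growing heights at the perturbed parts are uniformly
close to those at the closure of the limit part. -/

namespace CRMaps

variable {E : Type*} [NormedAddCommGroup E] [InnerProductSpace ℂ E]

/-! ### The real scalar product and unit normals -/

/-- The real linear form `v ↦ Re ⟪n, v⟫`. -/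
noncomputable def reInner (n : E) : E →L[ℝ] ℝ :=
  Complex.reCLM ∘L (innerSL ℂ n).restrictScalars ℝ

@[simp]
theorem reInner_apply (n v : E) : reInner n v = (inner ℂ n v).re := rfl

theorem reInner_self {n : E} (hn : ‖n‖ = 1) : (inner ℂ n n).re = 1 := by simp [hn]

theorem re_inner_smul_real_right (n v : E) (t : ℝ) :
    (inner ℂ n (t • v)).re = t * (inner ℂ n v).re := by
  exact (reInner n).map_smul t v

theorem re_inner_smul_real_left (n v : E) (t : ℝ) :
    (inner ℂ (t • n) v).re = t * (inner ℂ n v).re := by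
  rw [← Complex.coe_smul, inner_smul_left, Complex.conj_ofReal, Complex.re_ofReal_mul]

theorem re_inner_I_smul (n v : E) : (inner ℂ n (Complex.I • v)).re = -(inner ℂ n v).im := by
  simp

theorem abs_re_inner_le (n v : E) : |(inner ℂ n v).re| ≤ ‖n‖ * ‖v‖ :=
  (Complex.abs_re_le_norm _).trans (norm_inner_le_norm n v)

theorem continuous_re_inner : Continuous fun p : E × E => (inner ℂ p.1 p.2).re :=
  Complex.continuous_re.comp (continuous_fst.inner continuous_snd)

/-- The unit vector opposite to the gradient vector of a real linear form. -/
noncomputable def normalOf [CompleteSpace E] (f : E →L[ℝ] ℝ) : E :=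
  letI : InnerProductSpace ℝ E := InnerProductSpace.complexToReal; -(‖f‖⁻¹ • (InnerProductSpace.toDual ℝ E).symm f)

theorem continuousAt_normalOf [CompleteSpace E] {f : E →L[ℝ] ℝ} (hf : f ≠ 0) :
    ContinuousAt (normalOf (E := E)) f := by
  let _ : InnerProductSpace ℝ E := InnerProductSpace.complexToReal
  have h1 : ContinuousAt (fun g : E →L[ℝ] ℝ => ‖g‖⁻¹) f :=
    continuous_norm.continuousAt.inv₀ (norm_ne_zero_iff.2 hf)
  have h2 : Continuous (fun g : E →L[ℝ] ℝ => (InnerProductSpace.toDual ℝ E).symm g) :=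
    (InnerProductSpace.toDual ℝ E).symm.continuous
  exact (h1.smul h2.continuousAt).neg

theorem norm_normalOf [CompleteSpace E] {f : E →L[ℝ] ℝ} (hf : f ≠ 0) : ‖normalOf f‖ = 1 := by
  let _ : InnerProductSpace ℝ E := InnerProductSpace.complexToReal
  have hpos : 0 < ‖f‖ := norm_pos_iff.2 hf
  have : ‖(InnerProductSpace.toDual ℝ E).symm f‖ = ‖f‖ := by simp
  change ‖-(‖f‖⁻¹ • (InnerProductSpace.toDual ℝ E).symm f)‖ = 1
  rw [norm_neg, norm_smul, this, norm_inv, norm_norm, inv_mul_cancel₀ hpos.ne']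

theorem apply_eq_normalOf [CompleteSpace E] {f : E →L[ℝ] ℝ} (hf : f ≠ 0) (v : E) :
    f v = -(‖f‖ * (inner ℂ (normalOf f) v).re) := by
  let _ : InnerProductSpace ℝ E := InnerProductSpace.complexToReal
  have hpos : 0 < ‖f‖ := norm_pos_iff.2 hf
  have h1 : inner ℝ ((InnerProductSpace.toDual ℝ E).symm f) v = f v := by simp
  have h2 : (inner ℂ (normalOf f) v).re = -(‖f‖⁻¹ * f v) := by
    change (inner ℂ (-(‖f‖⁻¹ • (InnerProductSpace.toDual ℝ E).symm f)) v).re = _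
    rw [inner_neg_left, Complex.neg_re, re_inner_smul_real_left, ← h1]
    rfl
  rw [h2]
  field_simp

/-! ### Defining functions -/

theorem IsDefiningFunctionOn.isDefiningFunctionAt {Ω V : Set E} {ρ : E → ℝ} {q : E}
    (h : IsDefiningFunctionOn Ω ρ V) (hq : q ∈ V) (h0 : ρ q = 0) : IsDefiningFunctionAt Ω ρ q :=
  ⟨h0, V, hq, h⟩

theorem IsDefiningFunctionAt.fderiv_ne_zero {Ω : Set E} {ρ : E → ℝ} {q : E}
    (h : IsDefiningFunctionAt Ω ρ q) : fderiv ℝ ρ q ≠ 0 := by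
  obtain ⟨h0, V, hqV, hV⟩ := h
  exact hV.regular q hqV h0

theorem IsDefiningFunctionAt.contDiffAt {Ω : Set E} {ρ : E → ℝ} {q : E}
    (h : IsDefiningFunctionAt Ω ρ q) : ContDiffAt ℝ ∞ ρ q := by
  obtain ⟨h0, V, hqV, hV⟩ := h
  exact hV.contDiffOn.contDiffAt (hV.isOpen.mem_nhds hqV)

/-- Moving in a direction where `dρ < 0` enters `Ω`, while `ρ q = 0` excludes `q` itself. -/
theorem IsDefiningFunctionAt.mem_frontier {Ω : Set E} {ρ : E → ℝ} {q : E}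
    (h : IsDefiningFunctionAt Ω ρ q) : q ∈ frontier Ω := by
  have hne := h.fderiv_ne_zero
  have hsl := h.tendsto_slope
  have hev := h.eventually_mem_nhds
  obtain ⟨h0, V, hqV, hV⟩ := h
  refine ⟨?_, fun hi => ?_⟩
  · obtain ⟨v, hv⟩ : ∃ v, fderiv ℝ ρ q v < 0 := by
      obtain ⟨v, hv⟩ : ∃ v, fderiv ℝ ρ q v ≠ 0 := by
        by_contra! hc
        exact hne (ContinuousLinearMap.ext hc)
      rcases lt_or_gt_of_ne hv with hv | hv
      · exact ⟨v, hv⟩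
      · exact ⟨-v, by simpa using hv⟩
    have h1 : Tendsto (fun t : ℝ => q + t • v) (𝓝[>] 0) (𝓝 q) := by
      have : Continuous (fun t : ℝ => q + t • v) := by fun_prop
      have h2 := this.tendsto 0
      simp only [zero_smul, add_zero] at h2
      exact h2.mono_left nhdsWithin_le_nhds
    refine mem_closure_of_tendsto h1 ?_
    filter_upwards [(hsl v).eventually (gt_mem_nhds hv), hev v, self_mem_nhdsWithin]
      with t ht1 ht2 ht3
    refine ht2.2 ?_
    by_contra hc
    exact absurd ht1 (not_lt.2 (mul_nonneg (inv_pos.2 ht3).le (not_lt.1 hc)))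
  · exact absurd ((hV.mem_iff q hqV).1 (interior_subset hi)) (by simp [h0])

theorem IsDefiningFunctionOn.mem_frontier_iff {Ω V : Set E} {ρ : E → ℝ} {q : E}
    (h : IsDefiningFunctionOn Ω ρ V) (hq : q ∈ V) : q ∈ frontier Ω ↔ ρ q = 0 := by
  refine ⟨fun hf => ?_, fun h0 => (h.isDefiningFunctionAt hq h0).mem_frontier⟩
  have hc : ContinuousAt ρ q := (h.contDiffOn.contDiffAt (h.isOpen.mem_nhds hq)).continuousAt
  have hV := h.isOpen.mem_nhds hq
  rcases lt_trichotomy (ρ q) 0 with hlt | heq | hgt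
  · refine absurd (mem_interior_iff_mem_nhds.2 ?_) hf.2
    filter_upwards [hV, hc.eventually (gt_mem_nhds hlt)] with z hz hz'
    exact (h.mem_iff z hz).2 hz'
  · exact heq
  · have : ∃ᶠ z in 𝓝 q, z ∈ Ω := mem_closure_iff_frequently.1 hf.1
    refine absurd this (not_frequently.2 ?_)
    filter_upwards [hV, hc.eventually (lt_mem_nhds hgt)] with z hz hz'
    exact fun hm => absurd ((h.mem_iff z hz).1 hm) (not_lt.2 hz'.le)

theorem IsDefiningFunctionAt.eventually_at {Ω : Set E} {ρ : E → ℝ} {q : E}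
    (h : IsDefiningFunctionAt Ω ρ q) :
    ∀ᶠ z in 𝓝 q, (z ∈ Ω ↔ ρ z < 0) ∧ (z ∈ frontier Ω ↔ ρ z = 0) ∧
      (ρ z = 0 → IsDefiningFunctionAt Ω ρ z) := by
  obtain ⟨h0, V, hqV, hV⟩ := h
  filter_upwards [hV.isOpen.mem_nhds hqV] with z hz
  exact ⟨hV.mem_iff z hz, hV.mem_frontier_iff hz, hV.isDefiningFunctionAt hz⟩

theorem mem_frontier_of_mem_spc {Ω : Set E} {q : E} (h : q ∈ spc Ω) : q ∈ frontier Ω := by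
  obtain ⟨ρ, hρ, -⟩ := h
  exact hρ.mem_frontier

section Complete

variable [CompleteSpace E]

theorem IsDefiningFunctionAt.inwardNormal_eq {Ω : Set E} {ρ : E → ℝ} {q : E}
    (h : IsDefiningFunctionAt Ω ρ q) : inwardNormal Ω q = normalOf (fderiv ℝ ρ q) :=
  IsInwardNormal.inwardNormal_eq
    ⟨norm_normalOf h.fderiv_ne_zero, ρ, h, apply_eq_normalOf h.fderiv_ne_zero⟩

theorem IsDefiningFunctionAt.norm_inwardNormal {Ω : Set E} {ρ : E → ℝ} {q : E}
    (h : IsDefiningFunctionAt Ω ρ q) : ‖inwardNormal Ω q‖ = 1 := by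
  rw [h.inwardNormal_eq, norm_normalOf h.fderiv_ne_zero]

theorem IsDefiningFunctionAt.fderiv_apply {Ω : Set E} {ρ : E → ℝ} {q : E}
    (h : IsDefiningFunctionAt Ω ρ q) (v : E) :
    fderiv ℝ ρ q v = -(‖fderiv ℝ ρ q‖ * (inner ℂ (inwardNormal Ω q) v).re) := by
  rw [h.inwardNormal_eq]
  exact apply_eq_normalOf h.fderiv_ne_zero v

theorem norm_inwardNormal_of_mem_spc {Ω : Set E} {q : E} (h : q ∈ spc Ω) :
    ‖inwardNormal Ω q‖ = 1 := by
  obtain ⟨ρ, hρ, -⟩ := h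
  exact hρ.norm_inwardNormal

/-- Near `q` the normals at all boundary points come from the same `ρ`, so continuity of `dρ`
suffices. -/
theorem IsDefiningFunctionAt.continuousWithinAt_inwardNormal {Ω : Set E} {ρ : E → ℝ} {q : E}
    (h : IsDefiningFunctionAt Ω ρ q) : ContinuousWithinAt (inwardNormal Ω) (frontier Ω) q := by
  have h1 : ContinuousAt (fderiv ℝ ρ) q :=
    (h.contDiffAt.fderiv_right (m := 0) (by simp)).continuousAt
  have h2 : ContinuousAt (fun z => normalOf (fderiv ℝ ρ z)) q :=
    ContinuousAt.comp (g := normalOf) (continuousAt_normalOf h.fderiv_ne_zero) h1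
  refine h2.continuousWithinAt.congr_of_eventuallyEq ?_ h.inwardNormal_eq
  filter_upwards [nhdsWithin_le_nhds h.eventually_at, self_mem_nhdsWithin] with z hz hzf
  exact (hz.2.2 (hz.2.1.1 hzf)).inwardNormal_eq

theorem continuousWithinAt_inwardNormal_of_mem_spc {Ω : Set E} {q : E} (h : q ∈ spc Ω) :
    ContinuousWithinAt (inwardNormal Ω) (frontier Ω) q := by
  obtain ⟨ρ, hρ, -⟩ := h
  exact hρ.continuousWithinAt_inwardNormal

end Complete

/-! ### Straightening the boundary -/

/-- The real orthogonal projection along the unit vector `n`. -/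
noncomputable def realProj (n : E) : E →L[ℝ] E :=
  ContinuousLinearMap.id ℝ E - (reInner n).smulRight n

theorem realProj_apply (n v : E) : realProj n v = v - (inner ℂ n v).re • n := rfl

theorem re_inner_realProj {n : E} (hn : ‖n‖ = 1) (v : E) : (inner ℂ n (realProj n v)).re = 0 := by
  rw [realProj_apply, inner_sub_right, Complex.sub_re, re_inner_smul_real_right, reInner_self hn]
  ring

theorem realProj_eq_self {n v : E} (h : (inner ℂ n v).re = 0) : realProj n v = v := by
  rw [realProj_apply, h, zero_smul, sub_zero]

/-- Smooth coordinates near a boundary point, with differential the identity there, in which the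
boundary is a real hyperplane. -/
theorem IsDefiningFunctionAt.exists_straightening [CompleteSpace E] {Ω : Set E} {ρ : E → ℝ}
    {q : E} (h : IsDefiningFunctionAt Ω ρ q) :
    ∃ Φ : OpenPartialHomeomorph E E, q ∈ Φ.source ∧ Φ q = 0 ∧ ContDiffAt ℝ ∞ Φ q ∧
      ContDiffAt ℝ ∞ Φ.symm 0 ∧ HasFDerivAt Φ (ContinuousLinearMap.id ℝ E) q ∧
      HasFDerivAt Φ.symm (ContinuousLinearMap.id ℝ E) 0 ∧
      ∀ᶠ z in 𝓝 q, (z ∈ frontier Ω ↔ (inner ℂ (inwardNormal Ω q) (Φ z)).re = 0) := by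
  set n := inwardNormal Ω q with hn
  have hn1 : ‖n‖ = 1 := h.norm_inwardNormal
  have hpos : 0 < ‖fderiv ℝ ρ q‖ := norm_pos_iff.2 h.fderiv_ne_zero
  set a : ℝ := ‖fderiv ℝ ρ q‖ with ha
  have hρ := h.contDiffAt
  -- The normal coordinate of `z - q` is replaced by `-a⁻¹ * ρ z`, so the boundary is where it
  -- vanishes. The differential at `q` is the identity because `dρ = -a Re⟪n, ·⟫` there.
  let φ : E → E := fun z => (z - q) - (reInner n (z - q) + a⁻¹ * ρ z) • n
  have hφ : ContDiffAt ℝ ∞ φ q := by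
    have h1 : ContDiffAt ℝ ∞ (fun z : E => z - q) q := contDiffAt_id.sub contDiffAt_const
    exact h1.sub ((((reInner n).contDiff.contDiffAt.comp q h1).add
      (contDiffAt_const.mul hρ)).smul contDiffAt_const)
  have hφ' : HasFDerivAt φ ((ContinuousLinearEquiv.refl ℝ E : E ≃L[ℝ] E) : E →L[ℝ] E) q := by
    have h1 : HasFDerivAt (fun z : E => z - q) (ContinuousLinearMap.id ℝ E) q :=
      (hasFDerivAt_id q).sub_const q
    have h2 : HasFDerivAt ρ (fderiv ℝ ρ q) q := (hρ.differentiableAt (by simp)).hasFDerivAt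
    have h3 := h1.sub (((((reInner n).hasFDerivAt).comp q h1).add (h2.const_mul a⁻¹)).smul_const n)
    refine h3.congr_fderiv ?_
    ext v
    have : (inner ℂ n v).re + a⁻¹ * fderiv ℝ ρ q v = 0 := by
      rw [h.fderiv_apply v, ← hn, ← ha]
      field_simp
      ring
    simp [this]
  have h0 : φ q = 0 := by simp [φ, h.1]
  have hne : (∞ : WithTop ℕ∞) ≠ 0 := by simp
  have hs := hφ.mem_toOpenPartialHomeomorph_source hφ' hne
  have ht := hφ.image_mem_toOpenPartialHomeomorph_target hφ' hne
  have hsymm0 : (hφ.toOpenPartialHomeomorph φ hφ' hne).symm 0 = q := by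
    rw [← h0]
    exact (hφ.toOpenPartialHomeomorph φ hφ' hne).left_inv hs
  rw [h0] at ht
  refine ⟨hφ.toOpenPartialHomeomorph φ hφ' hne, hs, h0, hφ, ?_, hφ', ?_, ?_⟩
  · refine OpenPartialHomeomorph.contDiffAt_symm (f₀' := ContinuousLinearEquiv.refl ℝ E)
      _ ht ?_ ?_
    · rw [hsymm0]; exact hφ'
    · rw [hsymm0]; exact hφ
  · refine OpenPartialHomeomorph.hasFDerivAt_symm (f' := ContinuousLinearEquiv.refl ℝ E)
      _ ht ?_
    rw [hsymm0]; exact hφ'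
  · filter_upwards [h.eventually_at] with z hz
    rw [hz.2.1]
    have : (inner ℂ n (φ z)).re = -(a⁻¹ * ρ z) := by
      simp only [φ, reInner_apply]
      rw [inner_sub_right, Complex.sub_re, re_inner_smul_real_right, reInner_self hn1]
      ring
    change _ ↔ (inner ℂ n (φ z)).re = 0
    rw [this, neg_eq_zero, mul_eq_zero]
    simp [hpos.ne']

/-- A smooth parametrization `c` of the boundary near `q`, constant along the normal direction,
and local coordinates `b` which invert it. -/
theorem IsDefiningFunctionAt.exists_boundaryParam [CompleteSpace E] {Ω : Set E} {ρ : E → ℝ}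
    {q : E} (h : IsDefiningFunctionAt Ω ρ q) :
    ∃ c b : E → E, c 0 = q ∧ ContDiffAt ℝ ∞ c 0 ∧
      HasFDerivAt c (realProj (inwardNormal Ω q)) 0 ∧ (∀ᶠ w in 𝓝 0, c w ∈ frontier Ω) ∧
      b q = 0 ∧ ContinuousAt b q ∧
      ∀ᶠ z in 𝓝 q, z ∈ frontier Ω → c (b z) = z ∧ (inner ℂ (inwardNormal Ω q) (b z)).re = 0 := by
  obtain ⟨Φ, hs, h0, hΦ, hΨ, -, hΨ', hfr⟩ := h.exists_straightening
  set n := inwardNormal Ω q with hn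
  have hn1 : ‖n‖ = 1 := h.norm_inwardNormal
  have hsymm : Φ.symm 0 = q := by rw [← h0]; exact Φ.left_inv hs
  have ht : (0 : E) ∈ Φ.target := by rw [← h0]; exact Φ.map_source hs
  have hp0 : realProj n 0 = 0 := map_zero _
  have hΨ0 : ContDiffAt ℝ ∞ Φ.symm (realProj n 0) := by rwa [hp0]
  have hΨ'0 : HasFDerivAt Φ.symm (ContinuousLinearMap.id ℝ E) (realProj n 0) := by rwa [hp0]
  have hcd : ContDiffAt ℝ ∞ (fun w => Φ.symm (realProj n w)) 0 :=
    hΨ0.comp 0 (realProj n).contDiff.contDiffAt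
  have htend : Tendsto (realProj n) (𝓝 0) (𝓝 0) := by
    simpa using (realProj n).continuous.tendsto 0
  have htend' : Tendsto (fun w => Φ.symm (realProj n w)) (𝓝 0) (𝓝 q) := by
    have := hcd.continuousAt.tendsto
    simpa [hsymm] using this
  refine ⟨fun w => Φ.symm (realProj n w), Φ, ?_, hcd, ?_, ?_, h0, hΦ.continuousAt, ?_⟩
  · simp [hsymm]
  · have h1 := hΨ'0.comp (0 : E) (realProj n).hasFDerivAt
    rwa [ContinuousLinearMap.id_comp] at h1
  · filter_upwards [htend'.eventually hfr, htend (Φ.open_target.mem_nhds ht)] with w hw hwt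
    rw [hw, Φ.right_inv hwt, re_inner_realProj hn1]
  · filter_upwards [hfr, Φ.open_source.mem_nhds hs] with z hz hzs hzf
    have := hz.1 hzf
    exact ⟨by rw [realProj_eq_self this, Φ.left_inv hzs], this⟩

/-! ### Differentials on the domain with a part of its boundary -/

/-- The tangent cone contains the open half-space `dρ < 0`, which spans. This makes differentials
within the domain and the marked part unique up to the boundary. -/
theorem IsDefiningFunctionAt.uniqueDiffWithinAt {Ω : Set E} {ρ : E → ℝ} {q : E}
    (h : IsDefiningFunctionAt Ω ρ q) : UniqueDiffWithinAt ℝ Ω q := by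
  refine ⟨?_, h.mem_frontier.1⟩
  have hcone : ∀ v, fderiv ℝ ρ q v < 0 → v ∈ tangentConeAt ℝ Ω q := by
    intro v hv
    refine mem_tangentConeAt_of_seq (𝓝[>] (0 : ℝ)) (fun t => t⁻¹) (fun t => t • v) ?_ ?_ ?_
    · have : Continuous (fun t : ℝ => t • v) := by fun_prop
      have h2 := this.tendsto 0
      simp only [zero_smul] at h2
      exact h2.mono_left nhdsWithin_le_nhds
    · filter_upwards [(h.tendsto_slope v).eventually (gt_mem_nhds hv), h.eventually_mem_nhds v,
        self_mem_nhdsWithin] with t ht1 ht2 ht3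
      refine ht2.2 ?_
      by_contra hc
      exact absurd ht1 (not_lt.2 (mul_nonneg (inv_pos.2 ht3).le (not_lt.1 hc)))
    · refine tendsto_const_nhds.congr' ?_
      filter_upwards [self_mem_nhdsWithin] with t ht
      rw [smul_smul, inv_mul_cancel₀ (ne_of_gt ht), one_smul]
  obtain ⟨v, hv⟩ : ∃ v, fderiv ℝ ρ q v < 0 := by
    obtain ⟨v, hv⟩ : ∃ v, fderiv ℝ ρ q v ≠ 0 := by
      by_contra! hc
      exact h.fderiv_ne_zero (ContinuousLinearMap.ext hc)
    rcases lt_or_gt_of_ne hv with hv | hv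
    · exact ⟨v, hv⟩
    · exact ⟨-v, by simpa using hv⟩
  have htop : Submodule.span ℝ (tangentConeAt ℝ Ω q) = ⊤ := by
    refine Submodule.eq_top_iff'.2 fun u => ?_
    -- With this `s` the differential takes the value `-1` on `u + s • v`, so `u` is a combination
    -- of two vectors of the half-space.
    obtain ⟨s, hs⟩ : ∃ s : ℝ, fderiv ℝ ρ q (u + s • v) < 0 := by
      refine ⟨(-1 - fderiv ℝ ρ q u) / fderiv ℝ ρ q v, ?_⟩
      rw [map_add, map_smul, smul_eq_mul, div_mul_cancel₀ _ hv.ne]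
      linarith
    have h1 := Submodule.subset_span (R := ℝ) (hcone _ hs)
    have h2 := Submodule.smul_mem _ s (Submodule.subset_span (R := ℝ) (hcone _ hv))
    simpa using Submodule.sub_mem _ h1 h2
  rw [htop]
  exact dense_univ

namespace MarkedDomain

theorem IsPseudoconvexPiece.uniqueDiffOn {S : MarkedDomain E} (hS : S.IsPseudoconvexPiece) :
    UniqueDiffOn ℝ (S.dom ∪ S.part) := by
  rintro q (hq | hq)
  · exact (hS.isOpen.uniqueDiffWithinAt hq).mono subset_union_left
  · obtain ⟨ρ, hρ, -⟩ := hS.part_subset hq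
    exact hρ.uniqueDiffWithinAt.mono subset_union_left

theorem IsPseudoconvexPiece.part_subset_frontier {S : MarkedDomain E}
    (hS : S.IsPseudoconvexPiece) : S.part ⊆ frontier S.dom :=
  fun _ hq => mem_frontier_of_mem_spc (hS.part_subset hq)

theorem IsPseudoconvexPiece.eventually_mem_part {S : MarkedDomain E}
    (hS : S.IsPseudoconvexPiece) {q : E} (hq : q ∈ S.part) :
    ∀ᶠ z in 𝓝 q, z ∈ frontier S.dom → z ∈ S.part := by
  obtain ⟨O, hO, h⟩ := hS.open_part
  rw [h] at hq ⊢
  filter_upwards [hO.mem_nhds hq.2] with z hz hzf using ⟨hzf, hz⟩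

theorem IsPseudoconvexPiece.mem_closure_dom {S : MarkedDomain E} (hS : S.IsPseudoconvexPiece)
    {q : E} (hq : q ∈ S.dom ∪ S.part) : q ∈ closure S.dom := by
  rcases hq with hq | hq
  · exact subset_closure hq
  · exact (hS.part_subset_frontier hq).1

end MarkedDomain

/-- The differential of `F` on the domain of `S` together with the marked part. -/
noncomputable abbrev MarkedDomain.diff (S : MarkedDomain E) (F : E → E) : E → E →L[ℝ] E :=
  fderivWithin ℝ F (S.dom ∪ S.part)

/-- The second differential of `F` on the domain of `S` together with the marked part. -/
noncomputable abbrev MarkedDomain.diff₂ (S : MarkedDomain E) (F : E → E) :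
    E → E →L[ℝ] E →L[ℝ] E :=
  fderivWithin ℝ (S.diff F) (S.dom ∪ S.part)

section Proper

variable {S : MarkedDomain E} {Ω' : Set E} {F : E → E}

theorem IsProperRelative.hasFDerivWithinAt (hF : IsProperRelative S Ω' F) {q : E}
    (hq : q ∈ S.dom ∪ S.part) : HasFDerivWithinAt F (S.diff F q) (S.dom ∪ S.part) q :=
  (hF.smooth.differentiableOn (by simp) q hq).hasFDerivWithinAt

theorem IsProperRelative.contDiffOn_diff (hF : IsProperRelative S Ω' F)
    (hS : S.IsPseudoconvexPiece) : ContDiffOn ℝ ∞ (S.diff F) (S.dom ∪ S.part) :=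
  hF.smooth.fderivWithin hS.uniqueDiffOn (by simp)

theorem IsProperRelative.continuousOn_diff (hF : IsProperRelative S Ω' F)
    (hS : S.IsPseudoconvexPiece) : ContinuousOn (S.diff F) (S.dom ∪ S.part) :=
  (hF.contDiffOn_diff hS).continuousOn

theorem IsProperRelative.hasFDerivWithinAt_diff (hF : IsProperRelative S Ω' F)
    (hS : S.IsPseudoconvexPiece) {q : E} (hq : q ∈ S.dom ∪ S.part) :
    HasFDerivWithinAt (S.diff F) (S.diff₂ F q) (S.dom ∪ S.part) q :=
  ((hF.contDiffOn_diff hS).differentiableOn (by simp) q hq).hasFDerivWithinAt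

theorem IsProperRelative.diff_eq_of_mem_dom (hF : IsProperRelative S Ω' F)
    (hS : S.IsPseudoconvexPiece) {q : E} (hq : q ∈ S.dom) :
    S.diff F q = (fderiv ℂ F q).restrictScalars ℝ := by
  have h1 : HasFDerivAt F (fderiv ℂ F q) q :=
    ((hF.holomorphic q hq).differentiableAt (hS.isOpen.mem_nhds hq)).hasFDerivAt
  exact (h1.restrictScalars ℝ).hasFDerivWithinAt.fderivWithin
    (hS.uniqueDiffOn q (Or.inl hq))

/-- True in the domain by holomorphy, and on the marked part by continuity of the differential. -/
theorem IsProperRelative.diff_I_smul (hF : IsProperRelative S Ω' F)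
    (hS : S.IsPseudoconvexPiece) {q : E} (hq : q ∈ S.dom ∪ S.part) (v : E) :
    S.diff F q (Complex.I • v) = Complex.I • S.diff F q v := by
  have hd : ∀ z ∈ S.dom, S.diff F z (Complex.I • v) = Complex.I • S.diff F z v := by
    intro z hz
    rw [hF.diff_eq_of_mem_dom hS hz]
    simp
  have hc := (hF.continuousOn_diff hS q hq).mono (subset_union_left (t := S.part))
  have h1 : Tendsto (fun z => S.diff F z (Complex.I • v)) (𝓝[S.dom] q)
      (𝓝 (S.diff F q (Complex.I • v))) := (hc.clm_apply continuousWithinAt_const).tendsto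
  have h2 : Tendsto (fun z => Complex.I • S.diff F z v) (𝓝[S.dom] q)
      (𝓝 (Complex.I • S.diff F q v)) :=
    ((hc.clm_apply continuousWithinAt_const).const_smul _).tendsto
  have : (𝓝[S.dom] q).NeBot := mem_closure_iff_nhdsWithin_neBot.1 (hS.mem_closure_dom hq)
  refine tendsto_nhds_unique_of_eventuallyEq h1 h2 ?_
  filter_upwards [self_mem_nhdsWithin] with z hz using hd z hz

/-- Differentiate the complex linearity of the first differential in the direction `v`. -/
theorem IsProperRelative.diff₂_I_smul (hF : IsProperRelative S Ω' F)
    (hS : S.IsPseudoconvexPiece) {q : E} (hq : q ∈ S.dom ∪ S.part) (v w : E) :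
    S.diff₂ F q v (Complex.I • w) = Complex.I • S.diff₂ F q v w := by
  have h1 := hF.hasFDerivWithinAt_diff hS hq
  have h2 : HasFDerivWithinAt (fun z => S.diff F z (Complex.I • w))
      ((S.diff₂ F q).flip (Complex.I • w)) (S.dom ∪ S.part) q := by
    simpa using h1.clm_apply (hasFDerivWithinAt_const (Complex.I • w) q _)
  have h3 : HasFDerivWithinAt (fun z => S.diff F z w) ((S.diff₂ F q).flip w)
      (S.dom ∪ S.part) q := by
    simpa using h1.clm_apply (hasFDerivWithinAt_const w q _)
  have h4 := h3.const_smul Complex.I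
  have h5 : HasFDerivWithinAt (fun z => S.diff F z (Complex.I • w))
      (Complex.I • (S.diff₂ F q).flip w) (S.dom ∪ S.part) q :=
    h4.congr (fun z hz => hF.diff_I_smul hS hz w) (hF.diff_I_smul hS hq w)
  have h6 := (hS.uniqueDiffOn q hq).eq h2 h5
  simpa using congrArg (fun L : E →L[ℝ] E => L v) h6

/-- The second differential is symmetric and complex linear in one argument, hence complex bilinear.
This is why it drops out of the Levi form, which adds the values at `v` and at `I • v`. -/
theorem IsProperRelative.diff₂_I_smul_I_smul (hF : IsProperRelative S Ω' F)
    (hS : S.IsPseudoconvexPiece) {q : E} (hq : q ∈ S.dom ∪ S.part) (v : E) :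
    S.diff₂ F q (Complex.I • v) (Complex.I • v) = -S.diff₂ F q v v := by
  have hsymm : IsSymmSndFDerivWithinAt ℝ F (S.dom ∪ S.part) q := by
    refine (hF.smooth q hq).isSymmSndFDerivWithinAt
      (by simpa using WithTop.coe_le_coe.2 (le_top (a := (2 : ℕ∞)))) hS.uniqueDiffOn ?_ hq
    exact closure_mono (interior_maximal subset_union_left hS.isOpen) (hS.mem_closure_dom hq)
  rw [hF.diff₂_I_smul hS hq, hsymm (Complex.I • v) v]
  change Complex.I • S.diff₂ F q v (Complex.I • v) = _
  rw [hF.diff₂_I_smul hS hq, smul_smul, Complex.I_mul_I, neg_one_smul]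

end Proper

/-! ### Second derivatives along curves -/

theorem two_le_infty : (2 : WithTop ℕ∞) ≤ ((⊤ : ℕ∞) : WithTop ℕ∞) :=
  WithTop.coe_le_coe.2 (le_top (a := (2 : ℕ∞)))

section SecondDerivative

variable {V W : Type*} [NormedAddCommGroup V] [NormedSpace ℝ V] [NormedAddCommGroup W]
  [NormedSpace ℝ W]

theorem eventually_hasDerivAt_comp_curve {f : V → W} {f' : V → V →L[ℝ] W} {s : Set V}
    {σ : ℝ → V} (hf : ∀ z ∈ s, HasFDerivWithinAt f (f' z) s z)
    (hσ : ContDiffAt ℝ 2 σ 0) (hs : ∀ᶠ t in 𝓝 0, σ t ∈ s) :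
    ∀ᶠ t in 𝓝 (0 : ℝ), HasDerivAt (f ∘ σ) (f' (σ t) (deriv σ t)) t := by
  have h1 : ∀ᶠ t in 𝓝 (0 : ℝ), ContDiffAt ℝ 2 σ t := hσ.eventually (by simp)
  filter_upwards [h1, hs.eventually_nhds] with t ht hst
  exact (hf _ hst.self_of_nhds).comp_hasDerivAt_of_eq t
    (ht.differentiableAt (by simp)).hasDerivAt hst rfl

/-- Derivatives of `f` within `s` are enough because the curve stays in `s`; so the formula applies
to `F` along curves in the boundary, where `F` is given on one side only. -/
theorem hasDerivAt_deriv_comp_curve {f : V → W} {f' : V → V →L[ℝ] W} {f'' : V →L[ℝ] V →L[ℝ] W}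
    {s : Set V} {σ : ℝ → V} (hf : ∀ z ∈ s, HasFDerivWithinAt f (f' z) s z)
    (hf' : HasFDerivWithinAt f' f'' s (σ 0)) (hσ : ContDiffAt ℝ 2 σ 0)
    (hs : ∀ᶠ t in 𝓝 0, σ t ∈ s) :
    HasDerivAt (deriv (f ∘ σ))
      (f'' (deriv σ 0) (deriv σ 0) + f' (σ 0) (deriv (deriv σ) 0)) 0 := by
  have hσ1 : HasDerivAt σ (deriv σ 0) 0 := (hσ.differentiableAt (by simp)).hasDerivAt
  have hσ2 : HasDerivAt (deriv σ) (deriv (deriv σ) 0) 0 :=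
    ((hσ.derivWithin (m := 1) (by norm_num)).differentiableAt (by simp)).hasDerivAt
  have h1 : HasDerivAt (fun t => f' (σ t)) (f'' (deriv σ 0)) 0 :=
    hf'.comp_hasDerivAt_of_eq 0 hσ1 hs rfl
  refine (h1.clm_apply hσ2).congr_of_eventuallyEq ?_
  filter_upwards [eventually_hasDerivAt_comp_curve hf hσ hs] with t ht using ht.deriv

end SecondDerivative

theorem IsDefiningFunctionAt.exists_open {Ω : Set E} {ρ : E → ℝ} {q : E}
    (h : IsDefiningFunctionAt Ω ρ q) : ∃ V : Set E, q ∈ V ∧ IsOpen V ∧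
      (∀ z ∈ V, HasFDerivWithinAt ρ (fderiv ℝ ρ z) V z) ∧
      HasFDerivWithinAt (fderiv ℝ ρ) (fderiv ℝ (fderiv ℝ ρ) q) V q := by
  have hc := h.contDiffAt
  obtain ⟨-, V, hqV, hV⟩ := h
  refine ⟨V, hqV, hV.isOpen, fun z hz => ?_, ?_⟩
  · exact ((hV.contDiffOn.contDiffAt (hV.isOpen.mem_nhds hz)).differentiableAt
      (by simp)).hasFDerivAt.hasFDerivWithinAt
  · exact (((hc.of_le two_le_infty).fderiv_right (m := 1) (by norm_num)).differentiableAt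
      (by simp)).hasFDerivAt.hasFDerivWithinAt

theorem IsDefiningFunctionAt.second_derivative_curve {Ω : Set E} {ρ : E → ℝ} {σ : ℝ → E}
    (h : IsDefiningFunctionAt Ω ρ (σ 0)) (hσ : ContDiffAt ℝ 2 σ 0) :
    (∀ᶠ t in 𝓝 (0 : ℝ), HasDerivAt (ρ ∘ σ) (fderiv ℝ ρ (σ t) (deriv σ t)) t) ∧
    HasDerivAt (deriv (ρ ∘ σ)) (fderiv ℝ (fderiv ℝ ρ) (σ 0) (deriv σ 0) (deriv σ 0)
      + fderiv ℝ ρ (σ 0) (deriv (deriv σ) 0)) 0 := by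
  obtain ⟨V, hqV, hVo, h1, h2⟩ := h.exists_open
  have hs : ∀ᶠ t in 𝓝 0, σ t ∈ V := hσ.continuousAt (hVo.mem_nhds hqV)
  exact ⟨eventually_hasDerivAt_comp_curve h1 hσ hs, hasDerivAt_deriv_comp_curve h1 h2 hσ hs⟩

/-- The second order relation along a curve in the boundary. -/
theorem IsDefiningFunctionAt.second_order_of_mem_frontier {Ω : Set E} {ρ : E → ℝ} {σ : ℝ → E}
    (h : IsDefiningFunctionAt Ω ρ (σ 0)) (hσ : ContDiffAt ℝ 2 σ 0)
    (hfr : ∀ᶠ t in 𝓝 0, σ t ∈ frontier Ω) :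
    fderiv ℝ (fderiv ℝ ρ) (σ 0) (deriv σ 0) (deriv σ 0)
      + fderiv ℝ ρ (σ 0) (deriv (deriv σ) 0) = 0 := by
  have h1 := (h.second_derivative_curve hσ).2
  have h0 : ρ ∘ σ =ᶠ[𝓝 0] fun _ => 0 := by
    filter_upwards [hfr, hσ.continuousAt.eventually h.eventually_at] with t ht ht'
    exact ht'.2.1.1 ht
  have h2 : deriv (ρ ∘ σ) =ᶠ[𝓝 0] fun _ => 0 := by
    simpa using h0.deriv
  rw [← h1.deriv, h2.deriv_eq]
  simp

/-- Every real tangent vector is the velocity of a smooth curve in the boundary. -/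
theorem IsDefiningFunctionAt.exists_curve [CompleteSpace E] {Ω : Set E} {ρ : E → ℝ} {q : E}
    (h : IsDefiningFunctionAt Ω ρ q) {v : E} (hv : (inner ℂ (inwardNormal Ω q) v).re = 0) :
    ∃ σ : ℝ → E, σ 0 = q ∧ ContDiffAt ℝ 2 σ 0 ∧ deriv σ 0 = v ∧
      ∀ᶠ t in 𝓝 0, σ t ∈ frontier Ω := by
  obtain ⟨c, b, hc0, hc, hc', hcf, -⟩ := h.exists_boundaryParam
  have hl : ContDiffAt ℝ ∞ (fun t : ℝ => t • v) 0 := contDiffAt_id.smul contDiffAt_const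
  have hσ : ContDiffAt ℝ ∞ (fun t : ℝ => c (t • v)) 0 := by
    refine ContDiffAt.comp (g := c) 0 ?_ hl
    simpa using hc
  have hd : HasDerivAt (fun t : ℝ => c (t • v)) v 0 := by
    have h1 : HasDerivAt (fun t : ℝ => t • v) v 0 := by
      simpa using (hasDerivAt_id (0 : ℝ)).smul_const v
    have h2 := hc'.comp_hasDerivAt_of_eq 0 h1 (by simp)
    rwa [realProj_eq_self hv] at h2
  have hlt : Tendsto (fun t : ℝ => t • v) (𝓝 0) (𝓝 0) := by
    simpa using hl.continuousAt.tendsto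
  exact ⟨fun t => c (t • v), by simp [hc0], hσ.of_le two_le_infty, hd.deriv, hlt.eventually hcf⟩

/-- The normalized second derivative in tangent directions does not depend on the defining
function. -/
theorem IsDefiningFunctionAt.second_derivative_unique [CompleteSpace E] {Ω : Set E}
    {ρ ρ' : E → ℝ} {q : E} (h : IsDefiningFunctionAt Ω ρ q) (h' : IsDefiningFunctionAt Ω ρ' q)
    {v : E} (hv : (inner ℂ (inwardNormal Ω q) v).re = 0) :
    fderiv ℝ (fderiv ℝ ρ) q v v / ‖fderiv ℝ ρ q‖
      = fderiv ℝ (fderiv ℝ ρ') q v v / ‖fderiv ℝ ρ' q‖ := by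
  obtain ⟨σ, h0, hσ, hσ', hfr⟩ := h.exists_curve hv
  have hp : 0 < ‖fderiv ℝ ρ q‖ := norm_pos_iff.2 h.fderiv_ne_zero
  have hp' : 0 < ‖fderiv ℝ ρ' q‖ := norm_pos_iff.2 h'.fderiv_ne_zero
  subst h0
  have h1 := h.second_order_of_mem_frontier hσ hfr
  have h2 := h'.second_order_of_mem_frontier hσ hfr
  rw [hσ', h.fderiv_apply] at h1
  rw [hσ', h'.fderiv_apply] at h2
  rw [div_eq_div_iff hp.ne' hp'.ne']
  linear_combination ‖fderiv ℝ ρ' (σ 0)‖ * h1 - ‖fderiv ℝ ρ (σ 0)‖ * h2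

/-- The normalized Levi form does not depend on the defining function. -/
theorem IsDefiningFunctionAt.leviForm_unique [CompleteSpace E] {Ω : Set E}
    {ρ ρ' : E → ℝ} {q : E} (h : IsDefiningFunctionAt Ω ρ q) (h' : IsDefiningFunctionAt Ω ρ' q)
    {u : E} (hu : IsComplexTangent Ω q u) :
    leviForm ρ q u / ‖fderiv ℝ ρ q‖ = leviForm ρ' q u / ‖fderiv ℝ ρ' q‖ := by
  have hu0 : inner ℂ (inwardNormal Ω q) u = 0 := hu
  have h1 := h.second_derivative_unique h' (v := u) (by rw [hu0]; rfl)
  have h2 := h.second_derivative_unique h' (v := Complex.I • u)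
    (by rw [re_inner_I_smul, hu0]; simp)
  simp only [leviForm, add_div]
  linear_combination h1 / 4 + h2 / 4

/-! ### Normal and Levi form under proper maps -/

/-- The rate `Re ⟪N'(F q), dF_q N(q)⟫` at which `F` moves off the boundary. -/
noncomputable def MarkedDomain.normalRate (S : MarkedDomain E) (Ω' : Set E) (F : E → E)
    (q : E) : ℝ :=
  (inner ℂ (inwardNormal Ω' (F q)) (S.diff F q (inwardNormal S.dom q))).re

theorem leviForm_smul (ρ : E → ℝ) (q u : E) (t : ℝ) :
    leviForm ρ q (t • u) = t ^ 2 * leviForm ρ q u := by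
  unfold leviForm
  rw [smul_comm Complex.I t u]
  simp only [map_smul, smul_apply, smul_eq_mul]
  ring

theorem le_leviForm_of_lowerBounds {Ω X : Set E} {κ : ℝ} (hκ : κ ∈ lowerBounds (leviValues Ω X))
    {q : E} (hq : q ∈ X) {ρ : E → ℝ} (hρ : IsDefiningFunctionAt Ω ρ q) {u : E}
    (hu : IsComplexTangent Ω q u) : κ * ‖u‖ ^ 2 ≤ leviForm ρ q u / ‖fderiv ℝ ρ q‖ := by
  rcases eq_or_ne u 0 with rfl | hne
  · simp [leviForm]
  have hp : 0 < ‖u‖ := norm_pos_iff.2 hne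
  have hu1 : IsComplexTangent Ω q (‖u‖⁻¹ • u) := by
    unfold IsComplexTangent at hu ⊢
    rw [← Complex.coe_smul, inner_smul_right, hu, mul_zero]
  have h1 := hκ ⟨q, hq, ρ, hρ, ‖u‖⁻¹ • u, by rw [norm_smul, norm_inv, norm_norm,
    inv_mul_cancel₀ hp.ne'], hu1, rfl⟩
  rw [leviForm_smul] at h1
  have h2 := mul_le_mul_of_nonneg_right h1 (sq_nonneg ‖u‖)
  refine h2.trans (le_of_eq ?_)
  field_simp

theorem leviForm_le_of_upperBounds {Ω X : Set E} {κ : ℝ} (hκ : κ ∈ upperBounds (leviValues Ω X))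
    {q : E} (hq : q ∈ X) {ρ : E → ℝ} (hρ : IsDefiningFunctionAt Ω ρ q) {u : E}
    (hu : IsComplexTangent Ω q u) : leviForm ρ q u / ‖fderiv ℝ ρ q‖ ≤ κ * ‖u‖ ^ 2 := by
  rcases eq_or_ne u 0 with rfl | hne
  · simp [leviForm]
  have hp : 0 < ‖u‖ := norm_pos_iff.2 hne
  have hu1 : IsComplexTangent Ω q (‖u‖⁻¹ • u) := by
    unfold IsComplexTangent at hu ⊢
    rw [← Complex.coe_smul, inner_smul_right, hu, mul_zero]
  have h1 := hκ ⟨q, hq, ρ, hρ, ‖u‖⁻¹ • u, by rw [norm_smul, norm_inv, norm_norm,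
    inv_mul_cancel₀ hp.ne'], hu1, rfl⟩
  rw [leviForm_smul] at h1
  have h2 := mul_le_mul_of_nonneg_right h1 (sq_nonneg ‖u‖)
  refine (le_of_eq ?_).trans h2
  field_simp

section Proper

variable [CompleteSpace E] {S : MarkedDomain E} {Ω' : Set E} {F : E → E}

/-- Reduces first and second differentials in tangential directions to functions of one real
variable, for which both boundaries give second order relations. -/
theorem IsProperRelative.curve (hF : IsProperRelative S Ω' F) (hS : S.IsPseudoconvexPiece)
    {q : E} (hq : q ∈ S.part) {v : E} (hv : (inner ℂ (inwardNormal S.dom q) v).re = 0) :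
    ∃ σ : ℝ → E, σ 0 = q ∧ ContDiffAt ℝ 2 σ 0 ∧ deriv σ 0 = v ∧
      (∀ᶠ t in 𝓝 0, σ t ∈ S.part) ∧ ContDiffAt ℝ 2 (F ∘ σ) 0 ∧
      deriv (F ∘ σ) 0 = S.diff F q v ∧
      deriv (deriv (F ∘ σ)) 0 = S.diff₂ F q v v + S.diff F q (deriv (deriv σ) 0) := by
  obtain ⟨ρ, hρ, -⟩ := hS.part_subset hq
  obtain ⟨σ, h0, hσ, hσ', hfr⟩ := hρ.exists_curve hv
  have hpart : ∀ᶠ t in 𝓝 (0 : ℝ), σ t ∈ S.part := by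
    have h1 : Tendsto σ (𝓝 0) (𝓝 q) := by simpa [h0] using hσ.continuousAt.tendsto
    filter_upwards [hfr, h1.eventually (hS.eventually_mem_part hq)] with t h1 h2 using h2 h1
  have hmem : ∀ᶠ t in 𝓝 (0 : ℝ), σ t ∈ S.dom ∪ S.part := hpart.mono fun t ht => Or.inr ht
  have hdif : ∀ z ∈ S.dom ∪ S.part, HasFDerivWithinAt F (S.diff F z) (S.dom ∪ S.part) z :=
    fun z hz => hF.hasFDerivWithinAt hz
  have hdif2 : HasFDerivWithinAt (S.diff F) (S.diff₂ F q) (S.dom ∪ S.part) (σ 0) := by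
    rw [h0]
    exact hF.hasFDerivWithinAt_diff hS (Or.inr hq)
  refine ⟨σ, h0, hσ, hσ', hpart, ?_, ?_, ?_⟩
  · have h1 : ContDiffWithinAt ℝ 2 F (S.dom ∪ S.part) (σ 0) := by
      rw [h0]
      exact (hF.smooth q (Or.inr hq)).of_le two_le_infty
    exact (h1.comp (s := σ ⁻¹' (S.dom ∪ S.part)) 0 hσ.contDiffWithinAt
      (mapsTo_preimage _ _)).contDiffAt hmem
  · rw [(eventually_hasDerivAt_comp_curve hdif hσ hmem).self_of_nhds.deriv, hσ', h0]
  · rw [(hasDerivAt_deriv_comp_curve hdif hdif2 hσ hmem).deriv, hσ', h0]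

/-- Real tangent vectors are mapped to real tangent vectors. -/
theorem IsProperRelative.re_inner_diff_eq_zero (hF : IsProperRelative S Ω' F)
    (hS : S.IsPseudoconvexPiece) {q : E} (hq : q ∈ S.part) {ρ' : E → ℝ}
    (hρ' : IsDefiningFunctionAt Ω' ρ' (F q)) {v : E}
    (hv : (inner ℂ (inwardNormal S.dom q) v).re = 0) :
    (inner ℂ (inwardNormal Ω' (F q)) (S.diff F q v)).re = 0 := by
  obtain ⟨σ, h0, hσ, -, hpart, hFσ, hFσ', -⟩ := hF.curve hS hq hv
  have hat : IsDefiningFunctionAt Ω' ρ' ((F ∘ σ) 0) := by simpa [h0] using hρ'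
  have h1 := (hat.second_derivative_curve hFσ).1.self_of_nhds
  have h2 : ρ' ∘ (F ∘ σ) =ᶠ[𝓝 0] fun _ => 0 := by
    filter_upwards [hpart, hFσ.continuousAt.eventually hat.eventually_at] with t ht ht'
    exact ht'.2.1.1 (hF.mapsTo_frontier ht)
  have h3 := h1.unique ((hasDerivAt_const (0 : ℝ) (0 : ℝ)).congr_of_eventuallyEq h2)
  rw [hFσ'] at h3
  simp only [Function.comp_apply, h0] at h3
  rw [hρ'.fderiv_apply, neg_eq_zero, mul_eq_zero] at h3
  exact h3.resolve_left (norm_ne_zero_iff.2 hρ'.fderiv_ne_zero)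

/-- The real form `Re⟪N', dF ·⟫` vanishes on the kernel of `Re⟪N, ·⟫`, hence is a multiple of it,
with the factor read off at `N`. Complex linearity then yields the imaginary parts. -/
theorem IsProperRelative.inner_diff (hF : IsProperRelative S Ω' F)
    (hS : S.IsPseudoconvexPiece) {q : E} (hq : q ∈ S.part) {ρ' : E → ℝ}
    (hρ' : IsDefiningFunctionAt Ω' ρ' (F q)) (v : E) :
    inner ℂ (inwardNormal Ω' (F q)) (S.diff F q v)
      = (S.normalRate Ω' F q : ℂ) * inner ℂ (inwardNormal S.dom q) v := by
  have hn := norm_inwardNormal_of_mem_spc (hS.part_subset hq)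
  have hre : ∀ w, (inner ℂ (inwardNormal Ω' (F q)) (S.diff F q w)).re
      = S.normalRate Ω' F q * (inner ℂ (inwardNormal S.dom q) w).re := by
    intro w
    have h1 := hF.re_inner_diff_eq_zero hS hq hρ' (re_inner_realProj hn w)
    rw [realProj_apply, map_sub, map_smul, inner_sub_right, Complex.sub_re,
      re_inner_smul_real_right, sub_eq_zero] at h1
    rw [h1, MarkedDomain.normalRate, mul_comm]
  apply Complex.ext
  · rw [hre, Complex.re_ofReal_mul]
  · have h1 := hre (Complex.I • v)
    rw [hF.diff_I_smul hS (Or.inr hq), re_inner_I_smul, re_inner_I_smul] at h1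
    rw [Complex.im_ofReal_mul]
    linarith

/-- Compare the second order relations along `σ` and along `F ∘ σ`. The acceleration of `σ` enters
both only through its normal component, which `inner_diff` matches, so it cancels. -/
theorem IsProperRelative.second_order (hF : IsProperRelative S Ω' F)
    (hS : S.IsPseudoconvexPiece) {q : E} (hq : q ∈ S.part) {ρ ρ' : E → ℝ}
    (hρ : IsDefiningFunctionAt S.dom ρ q) (hρ' : IsDefiningFunctionAt Ω' ρ' (F q)) {v : E}
    (hv : (inner ℂ (inwardNormal S.dom q) v).re = 0) :
    ‖fderiv ℝ ρ q‖ * (fderiv ℝ (fderiv ℝ ρ') (F q) (S.diff F q v) (S.diff F q v)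
        + fderiv ℝ ρ' (F q) (S.diff₂ F q v v))
      = ‖fderiv ℝ ρ' (F q)‖ * S.normalRate Ω' F q * fderiv ℝ (fderiv ℝ ρ) q v v := by
  obtain ⟨σ, h0, hσ, hσ', hpart, hFσ, hFσ', hFσ''⟩ := hF.curve hS hq hv
  have h1 := IsDefiningFunctionAt.second_order_of_mem_frontier (σ := σ) (by rwa [h0]) hσ
    (by filter_upwards [hpart] with t ht using hS.part_subset_frontier ht)
  have h2 := IsDefiningFunctionAt.second_order_of_mem_frontier (σ := F ∘ σ) (ρ := ρ')
    (by simpa [h0] using hρ') hFσ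
    (by filter_upwards [hpart] with t ht using hF.mapsTo_frontier ht)
  rw [h0, hσ', hρ.fderiv_apply] at h1
  rw [hFσ', hFσ'', map_add] at h2
  simp only [Function.comp_apply, h0] at h2
  rw [hρ'.fderiv_apply (S.diff F q (deriv (deriv σ) 0)), hF.inner_diff hS hq hρ',
    Complex.re_ofReal_mul] at h2
  linear_combination ‖fderiv ℝ ρ q‖ * h2
    - ‖fderiv ℝ ρ' (F q)‖ * S.normalRate Ω' F q * h1

/-- Add the second order identities for `u` and `I • u`: the second differential of `F` cancels. -/
theorem IsProperRelative.leviForm_diff (hF : IsProperRelative S Ω' F)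
    (hS : S.IsPseudoconvexPiece) {q : E} (hq : q ∈ S.part) {ρ ρ' : E → ℝ}
    (hρ : IsDefiningFunctionAt S.dom ρ q) (hρ' : IsDefiningFunctionAt Ω' ρ' (F q)) {u : E}
    (hu : IsComplexTangent S.dom q u) :
    leviForm ρ' (F q) (S.diff F q u) / ‖fderiv ℝ ρ' (F q)‖
      = S.normalRate Ω' F q * (leviForm ρ q u / ‖fderiv ℝ ρ q‖) := by
  have hp : 0 < ‖fderiv ℝ ρ q‖ := norm_pos_iff.2 hρ.fderiv_ne_zero
  have hp' : 0 < ‖fderiv ℝ ρ' (F q)‖ := norm_pos_iff.2 hρ'.fderiv_ne_zero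
  have hu0 : inner ℂ (inwardNormal S.dom q) u = 0 := hu
  have h1 := hF.second_order hS hq hρ hρ' (v := u) (by rw [hu0]; rfl)
  have h2 := hF.second_order hS hq hρ hρ' (v := Complex.I • u)
    (by rw [re_inner_I_smul, hu0]; simp)
  rw [hF.diff₂_I_smul_I_smul hS (Or.inr hq), map_neg, hF.diff_I_smul hS (Or.inr hq)] at h2
  have h3 : ‖fderiv ℝ ρ q‖ * leviForm ρ' (F q) (S.diff F q u)
      = ‖fderiv ℝ ρ' (F q)‖ * S.normalRate Ω' F q * leviForm ρ q u := by
    unfold leviForm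
    linear_combination h1 / 4 + h2 / 4
  field_simp
  linarith

/-- The differential expands complex tangent vectors, in terms of the normal rate and the bounds
for the Levi forms. -/
theorem IsProperRelative.levi_le (hF : IsProperRelative S Ω' F)
    (hS : S.IsPseudoconvexPiece) {W : Set E} (hW : W ⊆ spc Ω') {κ₁ κ₂ : ℝ}
    (hκ₁ : κ₁ ∈ lowerBounds (leviValues S.dom S.part))
    (hκ₂ : κ₂ ∈ upperBounds (leviValues Ω' W)) {q : E} (hq : q ∈ S.part) (hFq : F q ∈ W)
    (hr : 0 ≤ S.normalRate Ω' F q) {u : E} (hu : IsComplexTangent S.dom q u) :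
    κ₁ * S.normalRate Ω' F q * ‖u‖ ^ 2 ≤ κ₂ * ‖S.diff F q u‖ ^ 2 := by
  obtain ⟨ρ, hρ, -⟩ := hS.part_subset hq
  obtain ⟨ρ', hρ', -⟩ := hW hFq
  have hu' : IsComplexTangent Ω' (F q) (S.diff F q u) := by
    have hu0 : inner ℂ (inwardNormal S.dom q) u = 0 := hu
    unfold IsComplexTangent
    rw [hF.inner_diff hS hq hρ', hu0, mul_zero]
  have h1 := le_leviForm_of_lowerBounds hκ₁ hq hρ hu
  have h2 := leviForm_le_of_upperBounds hκ₂ hFq hρ' hu'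
  rw [hF.leviForm_diff hS hq hρ hρ' hu] at h2
  have h3 := mul_le_mul_of_nonneg_left h1 hr
  linarith

end Proper

/-! ### The Hopf lemma along the normal -/

/-- Harnack's inequality for the real part of a holomorphic function on a disc. -/
theorem harnack_re_le {g : ℂ → ℂ} {c z : ℂ} {R : ℝ} (hR : 0 < R)
    (hg : DifferentiableOn ℂ g (Metric.ball c R))
    (hpos : ∀ w ∈ Metric.ball c R, 0 ≤ (g w).re) (hz : z ∈ Metric.ball c R) :
    (R - dist z c) / (R + dist z c) * (g c).re ≤ (g z).re := by
  have hc : c ∈ Metric.ball c R := Metric.mem_ball_self hR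
  have hd0 : 0 ≤ dist z c := dist_nonneg
  have hdR : dist z c < R := hz
  rcases (hpos c hc).eq_or_lt with h0 | h0
  · rw [← h0, mul_zero]
    exact hpos z hz
  set a : ℝ := (g c).re with ha
  -- The Cayley transform of the right half-plane which takes `g c` to `0`; the Schwarz lemma
  -- applies to it.
  let φ : ℂ → ℂ := fun w => (g w - g c) / (g w + (starRingEnd ℂ) (g c))
  have hden : ∀ w ∈ Metric.ball c R, g w + (starRingEnd ℂ) (g c) ≠ 0 := by
    intro w hw h
    have := congrArg Complex.re h
    simp only [Complex.add_re, Complex.conj_re, Complex.zero_re] at this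
    linarith [hpos w hw]
  have hφ : DifferentiableOn ℂ φ (Metric.ball c R) :=
    (hg.sub_const _).div (hg.add_const _) hden
  have hnum : ∀ w, ‖g w - g c‖ ^ 2 = ((g w).re - a) ^ 2 + ((g w).im - (g c).im) ^ 2 := by
    intro w
    rw [Complex.sq_norm, Complex.normSq_apply]
    simp only [Complex.sub_re, Complex.sub_im]
    ring
  have hdn : ∀ w, ‖g w + (starRingEnd ℂ) (g c)‖ ^ 2
      = ((g w).re + a) ^ 2 + ((g w).im - (g c).im) ^ 2 := by
    intro w
    rw [Complex.sq_norm, Complex.normSq_apply]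
    simp only [Complex.add_re, Complex.add_im, Complex.conj_re, Complex.conj_im]
    ring
  have hφc : φ c = 0 := by simp [φ]
  have hmaps : MapsTo φ (Metric.ball c R) (Metric.closedBall (φ c) 1) := by
    intro w hw
    rw [hφc, mem_closedBall_zero_iff, norm_div]
    refine div_le_one_of_le₀ ?_ (norm_nonneg _)
    refine le_of_sq_le_sq ?_ (norm_nonneg _)
    rw [hnum, hdn]
    nlinarith [mul_nonneg (hpos w hw) h0.le]
  have h1 := Complex.dist_le_div_mul_dist_of_mapsTo_ball hφ hmaps hz
  rw [hφc, dist_zero_right, norm_div] at h1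
  set r : ℝ := dist z c / R with hr
  have hr0 : 0 ≤ r := by positivity
  have hr1 : r < 1 := (div_lt_one hR).2 hdR
  have h2 : ‖g z - g c‖ ≤ r * ‖g z + (starRingEnd ℂ) (g c)‖ := by
    have h3 : 0 < ‖g z + (starRingEnd ℂ) (g c)‖ := norm_pos_iff.2 (hden z hz)
    rw [div_le_iff₀ h3] at h1
    refine h1.trans (le_of_eq ?_)
    rw [hr]; ring
  have h4 : ‖g z - g c‖ ^ 2 ≤ r ^ 2 * ‖g z + (starRingEnd ℂ) (g c)‖ ^ 2 := by
    rw [← mul_pow]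
    exact pow_le_pow_left₀ (norm_nonneg _) h2 2
  rw [hnum, hdn] at h4
  have hx := hpos z hz
  have hr2 : r ^ 2 ≤ 1 := pow_le_one₀ hr0 hr1.le
  -- Since `r ^ 2 ≤ 1`, the imaginary parts can be dropped from the Schwarz estimate.
  have h5 : ((g z).re - a) ^ 2 ≤ (r * ((g z).re + a)) ^ 2 := by
    nlinarith [mul_nonneg (sub_nonneg.2 hr2) (sq_nonneg ((g z).im - (g c).im))]
  have h6 : a - (g z).re ≤ r * ((g z).re + a) := by
    have := abs_le_of_sq_le_sq' h5 (by positivity)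
    linarith [this.1]
  rw [div_mul_eq_mul_div, div_le_iff₀ (by positivity)]
  have h7 : r * R = dist z c := by rw [hr]; field_simp
  have h8 := mul_le_mul_of_nonneg_right h6 hR.le
  rw [← h7]
  nlinarith

theorem add_smul_normal_mem_tangentBall {Ω : Set E} {q : E} (hn : ‖inwardNormal Ω q‖ = 1)
    {ε : ℝ} {w : ℂ} (hw : w ∈ Metric.ball (ε : ℂ) ε) :
    q + w • inwardNormal Ω q ∈ tangentBall Ω q ε := by
  rw [tangentBall, Metric.mem_ball, dist_add_left, ← Complex.coe_smul, dist_eq_norm, ← sub_smul,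
    norm_smul, hn, mul_one]
  simpa [dist_eq_norm] using hw

section Proper

variable [CompleteSpace E] {S T : MarkedDomain E} {F : E → E}

/-- The Hopf lemma: the normal rate is bounded from below by the height of the image of the centre
of an inner tangent ball. -/
theorem IsProperRelative.le_normalRate (hF : IsProperRelative S T.dom F)
    (hS : S.IsPseudoconvexPiece) {q : E} (hq : q ∈ S.part)
    (hT : ∀ z ∈ T.dom, 0 ≤ height T.dom (F q) z) {ε : ℝ} (hε : 0 < ε)
    (hball : tangentBall S.dom q ε ⊆ S.dom) :
    height T.dom (F q) (F (q + ε • inwardNormal S.dom q)) / (2 * ε)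
      ≤ S.normalRate T.dom F q := by
  have hn := norm_inwardNormal_of_mem_spc (hS.part_subset hq)
  set n := inwardNormal S.dom q with hndef
  set n' := inwardNormal T.dom (F q) with hn'def
  -- Restriction to the complex normal line: `Re (g w)` is the height of the image of `q + w • n`
  -- over the tangent plane at `F q`.
  let g : ℂ → ℂ := fun w => inner ℂ n' (F (q + w • n) - F q)
  have hmem : ∀ w ∈ Metric.ball (ε : ℂ) ε, q + w • n ∈ S.dom :=
    fun w hw => hball (add_smul_normal_mem_tangentBall hn hw)
  have hg : DifferentiableOn ℂ g (Metric.ball (ε : ℂ) ε) := by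
    have h1 : DifferentiableOn ℂ (fun w : ℂ => F (q + w • n)) (Metric.ball (ε : ℂ) ε) := by
      refine hF.holomorphic.comp (t := S.dom) (f := fun w : ℂ => q + w • n) ?_ hmem
      fun_prop
    exact (innerSL ℂ n').differentiable.comp_differentiableOn (h1.sub_const (F q))
  have hpos : ∀ w ∈ Metric.ball (ε : ℂ) ε, 0 ≤ (g w).re :=
    fun w hw => hT _ (hF.mapsTo (hmem w hw))
  set h0 : ℝ := height T.dom (F q) (F (q + ε • n)) with hh0
  have hgε : (g ε).re = h0 := by
    simp only [g, hh0, height, Complex.coe_smul, ← hn'def]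
  have hh0' : 0 ≤ h0 := hgε ▸ hpos _ (Metric.mem_ball_self hε)
  -- Harnack's factor at `t` is `t / (2 * ε - t)`, at least `t / (2 * ε)`.
  have hlow : ∀ t ∈ Ioo (0 : ℝ) ε, t / (2 * ε) * h0 ≤ (g t).re := by
    intro t ht
    have hdist : dist (t : ℂ) (ε : ℂ) = ε - t := by
      rw [Complex.dist_eq, ← Complex.ofReal_sub, Complex.norm_real, Real.norm_eq_abs,
        abs_of_neg (by linarith [ht.2])]
      ring
    have htb : (t : ℂ) ∈ Metric.ball (ε : ℂ) ε := by
      rw [Metric.mem_ball, hdist]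
      linarith [ht.1]
    have h1 := harnack_re_le hε hg hpos htb
    rw [hdist, hgε] at h1
    refine le_trans (mul_le_mul_of_nonneg_right ?_ hh0') h1
    rw [div_le_div_iff₀ (by linarith) (by linarith [ht.2])]
    nlinarith [ht.1, ht.2]
  -- The one-sided derivative of `Re g` at `0` is the normal rate; the claim is the limit of the
  -- previous bound divided by `t`.
  have hder : HasDerivWithinAt (fun t : ℝ => (g t).re) (S.normalRate T.dom F q) (Ioo 0 ε) 0 := by
    have h1 : HasDerivWithinAt (fun t : ℝ => q + t • n) n (Ioo 0 ε) 0 := by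
      simpa using (((hasDerivAt_id (0 : ℝ)).smul_const n).const_add q).hasDerivWithinAt
    have hmaps : MapsTo (fun t : ℝ => q + t • n) (Ioo 0 ε) (S.dom ∪ S.part) := by
      intro t ht
      refine Or.inl ?_
      have := hmem (t : ℂ) (by
        rw [Metric.mem_ball, Complex.dist_eq, ← Complex.ofReal_sub, Complex.norm_real,
          Real.norm_eq_abs, abs_of_neg (by linarith [ht.2])]
        linarith [ht.1])
      simpa using this
    have h2 := (hF.hasFDerivWithinAt (Or.inr hq)).comp_hasDerivWithinAt_of_eq 0 h1 hmaps
      (by simp)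
    have h3 := ((reInner n').hasFDerivAt.comp_hasDerivWithinAt (0 : ℝ) (h2.sub_const (F q)))
    refine (h3.congr (f₁ := fun t : ℝ => (g t).re) (fun t _ => ?_) ?_).congr_deriv rfl <;>
      simp [g]
  rw [hasDerivWithinAt_iff_tendsto_slope] at hder
  have hset : Ioo (0 : ℝ) ε \ {0} = Ioo 0 ε :=
    sdiff_singleton_eq_self (by simp)
  rw [hset] at hder
  have : (𝓝[Ioo (0 : ℝ) ε] 0).NeBot := by
    rw [nhdsWithin_Ioo_eq_nhdsGT hε]; infer_instance
  refine ge_of_tendsto hder ?_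
  filter_upwards [self_mem_nhdsWithin] with t ht
  have hg0 : (g ((0 : ℝ) : ℂ)).re = 0 := by simp [g]
  rw [slope_def_field, hg0, sub_zero, sub_zero, le_div_iff₀ ht.1]
  refine le_trans (le_of_eq ?_) (hlow t ht)
  ring

end Proper

/-! ### Inner tangent balls at strictly pseudoconvex points -/

section Balls

variable [CompleteSpace E]

/-- If the second derivative were larger, some parabola through `q` would enter the tangent ball
although `ρ` has a local minimum with value `0` along it at `q`. -/
theorem IsDefiningFunctionAt.second_derivative_le_of_tangentBall {Ω : Set E} {ρ : E → ℝ} {q : E}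
    (h : IsDefiningFunctionAt Ω ρ q) {ε : ℝ} (hε : 0 < ε) (hball : tangentBall Ω q ε ⊆ Ω)
    {v : E} (hv : ‖v‖ = 1) (hnv : (inner ℂ (inwardNormal Ω q) v).re = 0) :
    fderiv ℝ (fderiv ℝ ρ) q v v ≤ ‖fderiv ℝ ρ q‖ / ε := by
  have hn : ‖inwardNormal Ω q‖ = 1 := h.norm_inwardNormal
  set n := inwardNormal Ω q with hndef
  have hp : 0 < ‖fderiv ℝ ρ q‖ := norm_pos_iff.2 h.fderiv_ne_zero
  set d := ‖fderiv ℝ ρ q‖ with hd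
  by_contra! hlt
  set b := fderiv ℝ (fderiv ℝ ρ) q v v with hb
  -- The bound `1 / (2 * ε) < s` bends the parabola into the ball near `q`; the bound `s < b / (2 *
  -- d)` keeps the second derivative `b - 2 * s * d` of `ρ ∘ σ` positive.
  obtain ⟨s, hs1, hs2⟩ : ∃ s : ℝ, 1 / (2 * ε) < s ∧ s < b / (2 * d) := by
    refine exists_between ?_
    rw [div_lt_iff₀ hε] at hlt
    rw [div_lt_div_iff₀ (by positivity) (by positivity)]
    linarith
  rw [div_lt_iff₀ (by positivity)] at hs1
  rw [lt_div_iff₀ (by positivity)] at hs2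
  have hs0 : 0 < s := by
    by_contra hc
    nlinarith
  let σ : ℝ → E := fun t => q + t • v + (t ^ 2 * s) • n
  have hσ0 : σ 0 = q := by simp [σ]
  have hσ : ContDiff ℝ 2 σ := by fun_prop
  have hσ' : ∀ t, HasDerivAt σ (v + (2 * t * s) • n) t := by
    intro t
    have h1 : HasDerivAt (fun t : ℝ => t • v) v t := by
      simpa using (hasDerivAt_id t).smul_const v
    have h2 : HasDerivAt (fun t : ℝ => (t ^ 2 * s) • n) ((2 * t * s) • n) t := by
      simpa using (((hasDerivAt_pow 2 t).mul_const s)).smul_const n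
    exact (h1.const_add q).add h2
  have hdσ : deriv σ = fun t => v + (2 * t * s) • n := funext fun t => (hσ' t).deriv
  have hσ'' : deriv (deriv σ) 0 = (2 * s) • n := by
    rw [hdσ]
    have h2 : HasDerivAt (fun t : ℝ => (2 * t * s) • n) ((2 * s) • n) 0 := by
      simpa using (((hasDerivAt_id (0 : ℝ)).const_mul 2).mul_const s).smul_const n
    exact (h2.const_add v).deriv
  have hat : IsDefiningFunctionAt Ω ρ (σ 0) := by rwa [hσ0]
  obtain ⟨h1, h2⟩ := hat.second_derivative_curve hσ.contDiffAt
  have hd0 : deriv σ 0 = v := by simp [hdσ]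
  have h3 : deriv (ρ ∘ σ) 0 = 0 := by
    rw [h1.self_of_nhds.deriv, hd0, hσ0, h.fderiv_apply, ← hndef, hnv]
    simp
  have h4 : 0 < deriv (deriv (ρ ∘ σ)) 0 := by
    rw [h2.deriv, hd0, hσ'', hσ0, h.fderiv_apply, ← hndef, re_inner_smul_real_right,
      reInner_self hn, ← hd, ← hb]
    nlinarith
  have h5 := isLocalMin_of_deriv_deriv_pos h4 h3 h1.self_of_nhds.continuousAt
  have h6 : ∀ᶠ t in 𝓝 (0 : ℝ), t ^ 2 * s ^ 2 < 2 * s * ε - 1 := by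
    have : Tendsto (fun t : ℝ => t ^ 2 * s ^ 2) (𝓝 0) (𝓝 0) := by
      have h : Continuous fun t : ℝ => t ^ 2 * s ^ 2 := by fun_prop
      simpa using h.tendsto 0
    exact this.eventually (gt_mem_nhds (by nlinarith))
  have h7 := hat.eventually_at
  have h8 := hσ.continuous.continuousAt.eventually h7
  obtain ⟨t, ⟨ht5, ht6, ht8⟩, ht0⟩ : ∃ t : ℝ, ((ρ ∘ σ) 0 ≤ (ρ ∘ σ) t ∧
      t ^ 2 * s ^ 2 < 2 * s * ε - 1 ∧ (σ t ∈ Ω ↔ ρ (σ t) < 0)) ∧ t ≠ 0 := by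
    have h9 : ∀ᶠ t in 𝓝[≠] (0 : ℝ), ((ρ ∘ σ) 0 ≤ (ρ ∘ σ) t ∧
      t ^ 2 * s ^ 2 < 2 * s * ε - 1 ∧ (σ t ∈ Ω ↔ ρ (σ t) < 0)) ∧ t ≠ 0 := by
      filter_upwards [nhdsWithin_le_nhds h5, nhdsWithin_le_nhds h6, nhdsWithin_le_nhds h8,
        self_mem_nhdsWithin] with t a b c d
      exact ⟨⟨a, b, c.1⟩, d⟩
    exact h9.exists
  have hin : σ t ∈ tangentBall Ω q ε := by
    rw [tangentBall, Metric.mem_ball, dist_eq_norm, ← hndef]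
    have e1 : σ t - (q + ε • n) = t • v + (t ^ 2 * s - ε) • n := by
      simp only [σ, sub_smul]; abel
    have e2 : ‖t • v + (t ^ 2 * s - ε) • n‖ ^ 2 = t ^ 2 + (t ^ 2 * s - ε) ^ 2 := by
      have e3 := @norm_add_sq ℂ E _ _ _ (t • v) ((t ^ 2 * s - ε) • n)
      have e4 : (inner ℂ (t • v) ((t ^ 2 * s - ε) • n)).re = 0 := by
        rw [re_inner_smul_real_left, re_inner_smul_real_right]
        have e5 : (inner ℂ v n).re = (inner ℂ n v).re := inner_re_symm (𝕜 := ℂ) v n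
        rw [e5, hnv]; ring
      rw [RCLike.re_eq_complex_re, e4] at e3
      rw [e3, norm_smul, norm_smul, hn, hv, mul_one, mul_one, Real.norm_eq_abs, Real.norm_eq_abs,
        sq_abs, sq_abs]
      ring
    rw [e1]
    refine lt_of_pow_lt_pow_left₀ 2 hε.le ?_
    rw [e2]
    have ht2 : 0 < t ^ 2 := by positivity
    nlinarith
  have h10 := ht8.1 (hball hin)
  simp only [Function.comp_apply, hσ0, h.1] at ht5
  linarith

/-- The radius of an inner tangent ball is at most half the inverse of the Levi form. -/
theorem IsDefiningFunctionAt.leviForm_le_of_tangentBall {Ω : Set E} {ρ : E → ℝ} {q : E}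
    (h : IsDefiningFunctionAt Ω ρ q) {ε : ℝ} (hε : 0 < ε) (hball : tangentBall Ω q ε ⊆ Ω)
    {u : E} (hu : ‖u‖ = 1) (hnu : IsComplexTangent Ω q u) :
    leviForm ρ q u / ‖fderiv ℝ ρ q‖ ≤ 1 / (2 * ε) := by
  have hp : 0 < ‖fderiv ℝ ρ q‖ := norm_pos_iff.2 h.fderiv_ne_zero
  have hu0 : inner ℂ (inwardNormal Ω q) u = 0 := hnu
  have h1 := h.second_derivative_le_of_tangentBall hε hball hu (by rw [hu0]; rfl)
  have h2 := h.second_derivative_le_of_tangentBall hε hball (v := Complex.I • u)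
    (by rw [norm_smul, Complex.norm_I, one_mul, hu])
    (by rw [re_inner_I_smul, hu0]; simp)
  rw [div_le_div_iff₀ hp (by positivity), leviForm]
  rw [le_div_iff₀ hε] at h1 h2
  linarith

end Balls

/-! ### Local inverses on the boundary -/

theorem IsProperRelative.continuousOn_part {S T : MarkedDomain E} {F : E → E}
    (hF : IsProperRelative S T.dom F) :
    ContinuousOn F S.part :=
  hF.smooth.continuousOn.mono subset_union_right

section LocalInverse

variable [CompleteSpace E] {S T : MarkedDomain E} {F : E → E}

theorem MarkedDomain.IsPseudoconvexPiece.continuousOn_inwardNormal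
    (hS : S.IsPseudoconvexPiece) : ContinuousOn (inwardNormal S.dom) S.part := fun _ hq =>
  (continuousWithinAt_inwardNormal_of_mem_spc (hS.part_subset hq)).mono hS.part_subset_frontier

theorem IsProperRelative.continuousWithinAt_normalRate (hF : IsProperRelative S T.dom F)
    (hS : S.IsPseudoconvexPiece) (hT : T.IsPseudoconvexPiece) {q : E} (hq : q ∈ S.part)
    (hFq : F q ∈ T.part) : ContinuousWithinAt (S.normalRate T.dom F) S.part q := by
  have h1 : ContinuousWithinAt (fun z => inwardNormal T.dom (F z)) S.part q :=
    ContinuousWithinAt.comp (t := frontier T.dom)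
      (continuousWithinAt_inwardNormal_of_mem_spc (hT.part_subset hFq))
      (hF.continuousOn_part q hq) hF.mapsTo_frontier
  have h2 : ContinuousWithinAt (fun z => S.diff F z (inwardNormal S.dom z)) S.part q :=
    ((hF.continuousOn_diff hS q (Or.inr hq)).mono subset_union_right).clm_apply
      (hS.continuousOn_inwardNormal q hq)
  exact continuous_re_inner.continuousAt.comp_continuousWithinAt (h1.prodMk h2)

/-- A kernel vector is complex tangent because the normal rate is nonzero, and then the Levi
inequality forces it to vanish. -/
theorem IsProperRelative.diff_injective (hF : IsProperRelative S T.dom F)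
    (hS : S.IsPseudoconvexPiece) (hT : T.IsPseudoconvexPiece) {κ₁ κ₂ : ℝ} (h1 : 0 < κ₁)
    (hκ₁ : κ₁ ∈ lowerBounds (leviValues S.dom S.part))
    (hκ₂ : κ₂ ∈ upperBounds (leviValues T.dom T.part)) {q : E} (hq : q ∈ S.part)
    (hFq : F q ∈ T.part) (hr : 0 < S.normalRate T.dom F q) :
    Function.Injective (S.diff F q) := by
  refine (injective_iff_map_eq_zero _).2 fun v hv => ?_
  obtain ⟨ρ', hρ', -⟩ := hT.part_subset hFq
  have hn := hF.inner_diff hS hq hρ' v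
  rw [hv, inner_zero_right, eq_comm, mul_eq_zero] at hn
  have hv' : IsComplexTangent S.dom q v := hn.resolve_left (by exact_mod_cast hr.ne')
  have h2 := hF.levi_le hS hT.part_subset hκ₁ hκ₂ hq hFq hr.le hv'
  rw [hv, norm_zero] at h2
  by_contra hne
  have : 0 < κ₁ * S.normalRate T.dom F q * ‖v‖ ^ 2 := by
    have := norm_pos_iff.2 hne
    positivity
  linarith

variable [FiniteDimensional ℂ E]

/-- Since `F` is given on one side only, the inverse function theorem is applied to its boundary
values, read through a parametrization of the source boundary and a straightening of the target
boundary; the missing normal direction is added by hand. -/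
theorem IsProperRelative.exists_local_inverse (hF : IsProperRelative S T.dom F)
    (hS : S.IsPseudoconvexPiece) (hT : T.IsPseudoconvexPiece) {p : E} (hp : p ∈ S.part)
    (hFp : F p ∈ T.part) (hinj : Function.Injective (S.diff F p)) :
    ∃ G : E → E, ContDiffAt ℝ 1 G (F p) ∧ (∀ᶠ q in 𝓝[S.part] p, G (F q) = q) ∧
      ∀ᶠ y in 𝓝 (F p), y ∈ frontier T.dom → G y ∈ S.part ∧ F (G y) = y := by
  obtain ⟨ρ, hρ, -⟩ := hS.part_subset hp
  obtain ⟨ρ', hρ', -⟩ := hT.part_subset hFp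
  obtain ⟨c, b, hc0, hc, hc', hcf, hb0, hb, hcb⟩ := hρ.exists_boundaryParam
  obtain ⟨Φ, hΦs, hΦ0, hΦ, -, hΦ', -, hΦf⟩ := hρ'.exists_straightening
  set n := inwardNormal S.dom p with hn
  set n' := inwardNormal T.dom (F p) with hn'
  have hn1 : ‖n‖ = 1 := hρ.norm_inwardNormal
  have hn1' : ‖n'‖ = 1 := hρ'.norm_inwardNormal
  have hcp : ∀ᶠ w in 𝓝 0, c w ∈ S.part := by
    have h1 : Tendsto c (𝓝 0) (𝓝 p) := by simpa [hc0] using hc.continuousAt.tendsto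
    filter_upwards [hcf, h1.eventually (hS.eventually_mem_part hp)] with w h2 h3 using h3 h2
  have hcu : ∀ᶠ w in 𝓝 0, c w ∈ S.dom ∪ S.part := hcp.mono fun w hw => Or.inr hw
  have hFc : ContDiffAt ℝ ∞ (F ∘ c) 0 := by
    have h1 : ContDiffWithinAt ℝ ∞ F (S.dom ∪ S.part) (c 0) := by
      rw [hc0]; exact hF.smooth p (Or.inr hp)
    exact (h1.comp (s := c ⁻¹' (S.dom ∪ S.part)) 0 hc.contDiffWithinAt
      (mapsTo_preimage _ _)).contDiffAt hcu
  have hFc' : HasFDerivAt (F ∘ c) ((S.diff F p).comp (realProj n)) 0 :=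
    (hF.hasFDerivWithinAt (Or.inr hp)).comp_hasFDerivAt_of_eq 0 hc' hcu hc0.symm
  -- The differential of `c` at `0` kills `n`; the added term carries the normal coordinate of `w`
  -- to the direction `n'`, which makes the differential of `f` injective.
  let f : E → E := fun w => Φ ((F ∘ c) w) + (reInner n).smulRight n' w
  have hf : ContDiffAt ℝ ∞ f 0 := by
    refine ContDiffAt.add ?_ ((reInner n).smulRight n').contDiff.contDiffAt
    refine ContDiffAt.comp (g := Φ) (f := F ∘ c) 0 ?_ hFc
    simpa [hc0] using hΦ
  let L : E →L[ℝ] E := (S.diff F p).comp (realProj n) + (reInner n).smulRight n'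
  have hf' : HasFDerivAt f L 0 := by
    have h1 : HasFDerivAt Φ (ContinuousLinearMap.id ℝ E) ((F ∘ c) 0) := by
      simpa [hc0] using hΦ'
    have h2 := h1.comp (0 : E) hFc'
    rw [ContinuousLinearMap.id_comp] at h2
    exact h2.add ((reInner n).smulRight n').hasFDerivAt
  have hre : ∀ w, (inner ℂ n' ((reInner n).smulRight n' w)).re = (inner ℂ n w).re := by
    intro w
    rw [ContinuousLinearMap.smulRight_apply, re_inner_smul_real_right, reInner_self hn1', mul_one,
      reInner_apply]
  have hL : Function.Injective L := by
    refine (injective_iff_map_eq_zero _).2 fun w hw => ?_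
    have h1 : L w = S.diff F p (realProj n w) + (reInner n).smulRight n' w := rfl
    have h2 := hF.re_inner_diff_eq_zero hS hp hρ' (re_inner_realProj hn1 w)
    have h3 : (inner ℂ n w).re = 0 := by
      have h4 := congrArg (fun v => (inner ℂ n' v).re) (h1.symm.trans hw)
      simp only [inner_add_right, Complex.add_re, hre, inner_zero_right, Complex.zero_re] at h4
      rw [h2, zero_add] at h4
      exact h4
    rw [realProj_eq_self h3, ContinuousLinearMap.smulRight_apply, reInner_apply, h3, zero_smul,
      add_zero, hw] at h1
    exact hinj (by rw [← h1, map_zero])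
  let Le : E ≃L[ℝ] E := (LinearEquiv.ofInjectiveEndo (L : E →ₗ[ℝ] E) hL).toContinuousLinearEquiv
  have hf'e : HasFDerivAt f (Le : E →L[ℝ] E) 0 := by
    refine hf'.congr_fderiv ?_
    ext w
    rfl
  have hf0 : f 0 = 0 := by simp [f, hc0, hΦ0]
  have hne : (∞ : WithTop ℕ∞) ≠ 0 := by simp
  have hs := hf.mem_toOpenPartialHomeomorph_source hf'e hne
  have ht := hf.image_mem_toOpenPartialHomeomorph_target hf'e hne
  set Ψ := hf.toOpenPartialHomeomorph f hf'e hne with hΨ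
  have hΨf : ∀ w, Ψ w = f w := fun w => rfl
  have hΨ0 : Ψ.symm 0 = 0 := by
    have := Ψ.left_inv hs
    rwa [hΨf, hf0] at this
  rw [hf0] at ht
  have hΨc : ContDiffAt ℝ ∞ Ψ.symm 0 := by
    refine OpenPartialHomeomorph.contDiffAt_symm (f₀' := Le) _ ht ?_ ?_
    · rw [hΨ0]; exact hf'e
    · rw [hΨ0]; exact hf
  have hΨΦ : ContDiffAt ℝ ∞ (fun y => Ψ.symm (Φ y)) (F p) := by
    refine ContDiffAt.comp (g := Ψ.symm) (F p) ?_ hΦ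
    rwa [hΦ0]
  have hw0 : Ψ.symm (Φ (F p)) = 0 := by rw [hΦ0, hΨ0]
  have htw : Tendsto (fun y => Ψ.symm (Φ y)) (𝓝 (F p)) (𝓝 0) := by
    simpa only [hw0] using hΨΦ.continuousAt.tendsto
  have htFc : Tendsto (F ∘ c) (𝓝 0) (𝓝 (F p)) := by
    simpa [hc0] using hFc.continuousAt.tendsto
  have htΦ : Tendsto Φ (𝓝 (F p)) (𝓝 0) := by
    simpa only [hΦ0] using hΦ.continuousAt.tendsto
  refine ⟨fun y => c (Ψ.symm (Φ y)), ?_, ?_, ?_⟩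
  · have : ContDiffAt ℝ ∞ (fun y => c (Ψ.symm (Φ y))) (F p) := by
      refine ContDiffAt.comp (g := c) (F p) ?_ hΨΦ
      rwa [hw0]
    exact this.of_le (by simp)
  · have htb : Tendsto b (𝓝 p) (𝓝 0) := by simpa [hb0] using hb.tendsto
    filter_upwards [nhdsWithin_le_nhds hcb,
      nhdsWithin_le_nhds (htb.eventually (Ψ.open_source.mem_nhds hs)),
      self_mem_nhdsWithin] with q h1 h2 h3
    obtain ⟨h4, h5⟩ := h1 (hS.part_subset_frontier h3)
    have h6 : Φ (F q) = Ψ (b q) := by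
      rw [hΨf]
      simp only [f, Function.comp_apply, h4, ContinuousLinearMap.smulRight_apply, reInner_apply,
        h5, zero_smul, add_zero]
    rw [h6, Ψ.left_inv h2, h4]
  · filter_upwards [htw.eventually hcp, htΦ.eventually (Ψ.open_target.mem_nhds ht),
      hΦf, htw.eventually (htFc.eventually hΦf), Φ.open_source.mem_nhds hΦs,
      htw.eventually (htFc.eventually (Φ.open_source.mem_nhds hΦs))] with y h1 h2 h3 h4 h5 h6 h7
    refine ⟨h1, ?_⟩
    set w := Ψ.symm (Φ y) with hw
    have h8 : f w = Φ y := by rw [← hΨf, hw, Ψ.right_inv h2]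
    have h9 : (inner ℂ n' (Φ (F (c w)))).re = 0 := h4.1 (hF.mapsTo_frontier h1)
    -- Both `Φ y` and `Φ (F (c w))` lie in the hyperplane, so the added normal term vanishes at `w`
    -- and `f w` is `Φ (F (c w))`.
    have h10 : (inner ℂ n w).re = 0 := by
      have h11 := h3.1 h7
      rw [← h8] at h11
      simp only [f, Function.comp_apply, inner_add_right, Complex.add_re, hre, h9, zero_add] at h11
      exact h11
    have h12 : f w = Φ (F (c w)) := by
      simp only [f, Function.comp_apply, ContinuousLinearMap.smulRight_apply, reInner_apply,
        h10, zero_smul, add_zero]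
    exact Φ.injOn h6 h5 (h12.symm.trans h8)

end LocalInverse

/-! ### Complex paths: lengths and extensions -/

/-- On the interval, `deriv` and the continuous `derivWithin` differ at most at the end points, a
null set. -/
theorem intervalIntegrable_norm_deriv {γ : ℝ → E} {a b : ℝ} (hab : a ≤ b)
    (hγ : ContDiffOn ℝ 1 γ (Icc a b)) :
    IntervalIntegrable (fun s => ‖deriv γ s‖) MeasureTheory.volume a b := by
  rcases hab.eq_or_lt with rfl | hlt
  · simp
  have h1 : ContinuousOn (fun s => ‖derivWithin γ (Icc a b) s‖) (Icc a b) :=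
    (hγ.continuousOn_derivWithin (uniqueDiffOn_Icc hlt) le_rfl).norm
  refine (h1.intervalIntegrable_of_Icc hab).congr_ae ?_
  rw [uIoc_of_le hab, ← MeasureTheory.restrict_Ioo_eq_restrict_Ioc]
  refine (MeasureTheory.ae_restrict_mem measurableSet_Ioo).mono fun s hs => ?_
  simp only [derivWithin_of_mem_nhds (Icc_mem_nhds hs.1 hs.2)]

theorem IsComplexPath.intervalIntegrable {Ω X : Set E} {γ : ℝ → E} {l : ℝ} {x y : E}
    (h : IsComplexPath Ω X γ l x y) :
    IntervalIntegrable (fun s => ‖deriv γ s‖) MeasureTheory.volume 0 l := by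
  obtain ⟨m, t, hmono, h0, hm, hp⟩ := h.piecewise
  rw [← h0, ← hm]
  exact IntervalIntegrable.trans_iterate fun i hi =>
    intervalIntegrable_norm_deriv (hmono (Nat.le_succ i)) (hp i hi).1

theorem isComplexPath_const {Ω X : Set E} {x : E} (hx : x ∈ X) :
    IsComplexPath Ω X (fun _ => x) 0 x x where
  length_nonneg := le_rfl
  source := rfl
  target := rfl
  mapsTo := fun _ _ => hx
  continuousOn := continuousOn_const
  piecewise := ⟨0, fun _ => 0, monotone_const, rfl, rfl, fun i hi => absurd hi (by simp)⟩

theorem IsComplexPath.mem_crBall {Ω X : Set E} {γ : ℝ → E} {l r : ℝ} {x y : E}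
    (h : IsComplexPath Ω X γ l x y) (hr : ∫ s in (0 : ℝ)..l, ‖deriv γ s‖ < r) :
    y ∈ crBall Ω X x r := by
  refine ⟨h.target ▸ h.mapsTo ⟨h.length_nonneg, le_rfl⟩, ?_⟩
  refine lt_of_le_of_lt (iInf_le_of_le γ (iInf_le_of_le l (iInf_le _ h))) ?_
  refine (ENNReal.ofReal_lt_ofReal_iff_of_nonneg ?_).2 hr
  exact intervalIntegral.integral_nonneg h.length_nonneg fun _ _ => norm_nonneg _

theorem exists_isComplexPath_of_mem_crBall {Ω X : Set E} {x y : E} {r : ℝ}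
    (h : y ∈ crBall Ω X x r) : ∃ (γ : ℝ → E) (l : ℝ), IsComplexPath Ω X γ l x y ∧
      ∫ s in (0 : ℝ)..l, ‖deriv γ s‖ < r := by
  have h2 := h.2
  simp only [crDist, iInf_lt_iff] at h2
  obtain ⟨γ, l, hγ, hlt⟩ := h2
  refine ⟨γ, l, hγ, ?_⟩
  refine (ENNReal.ofReal_lt_ofReal_iff_of_nonneg ?_).1 hlt
  exact intervalIntegral.integral_nonneg hγ.length_nonneg fun _ _ => norm_nonneg _

theorem mem_crBall_self {Ω X : Set E} {x : E} (hx : x ∈ X) {r : ℝ} (hr : 0 < r) :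
    x ∈ crBall Ω X x r :=
  (isComplexPath_const hx).mem_crBall (by simpa using hr)

theorem crBall_mono {Ω X : Set E} {x : E} {r r' : ℝ} (h : r ≤ r') :
    crBall Ω X x r ⊆ crBall Ω X x r' :=
  fun _ hy => ⟨hy.1, hy.2.trans_le (ENNReal.ofReal_le_ofReal h)⟩

theorem crBall_eq_empty {Ω X : Set E} {x : E} {r : ℝ} (h : r ≤ 0) : crBall Ω X x r = ∅ := by
  refine eq_empty_iff_forall_notMem.2 fun y hy => ?_
  have := hy.2
  rw [ENNReal.ofReal_of_nonpos h] at this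
  exact not_lt_bot this

/-- The second piece is already parametrized by `[l, l']`, so it is glued on without
reparametrization, and no condition on the velocity is needed at the joint. -/
theorem IsComplexPath.extend {Ω X : Set E} {γ δ : ℝ → E} {l l' : ℝ} {x : E}
    (h : IsComplexPath Ω X γ l x (δ l)) (hl : l ≤ l') (hδ : ContDiffOn ℝ 1 δ (Icc l l'))
    (hX : MapsTo δ (Icc l l') X)
    (htan : ∀ s ∈ Ioo l l', IsComplexTangent Ω (δ s) (deriv δ s)) :
    ∃ γ' : ℝ → E, IsComplexPath Ω X γ' l' x (δ l') ∧
      ∫ s in (0 : ℝ)..l', ‖deriv γ' s‖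
        = (∫ s in (0 : ℝ)..l, ‖deriv γ s‖) + ∫ s in l..l', ‖deriv δ s‖ := by
  let γ' : ℝ → E := fun s => if s ≤ l then γ s else δ s
  have hleft : ∀ s ≤ l, γ' s = γ s := fun s hs => if_pos hs
  have hright : ∀ s, l ≤ s → γ' s = δ s := by
    intro s hs
    rcases hs.eq_or_lt with rfl | hs
    · rw [hleft _ le_rfl, h.target]
    · exact if_neg (not_le.2 hs)
  have hdl : ∀ s < l, deriv γ' s = deriv γ s := by
    intro s hs
    refine Filter.EventuallyEq.deriv_eq ?_
    filter_upwards [Iio_mem_nhds hs] with r hr using hleft r (le_of_lt hr)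
  have hdr : ∀ s, l < s → deriv γ' s = deriv δ s := by
    intro s hs
    refine Filter.EventuallyEq.deriv_eq ?_
    filter_upwards [Ioi_mem_nhds hs] with r hr using hright r (le_of_lt hr)
  have hl0 := h.length_nonneg
  have hpath : IsComplexPath Ω X γ' l' x (δ l') := by
    refine ⟨hl0.trans hl, ?_, hright _ hl, ?_, ?_, ?_⟩
    · rw [hleft _ hl0, h.source]
    · intro s hs
      rcases le_total s l with hsl | hsl
      · rw [hleft s hsl]; exact h.mapsTo ⟨hs.1, hsl⟩
      · rw [hright s hsl]; exact hX ⟨hsl, hs.2⟩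
    · rw [← Icc_union_Icc_eq_Icc hl0 hl]
      refine ContinuousOn.union_of_isClosed ?_ ?_ isClosed_Icc isClosed_Icc
      · exact h.continuousOn.congr fun s hs => hleft s hs.2
      · exact hδ.continuousOn.congr fun s hs => hright s hs.1
    · obtain ⟨m, t, hmono, ht0, htm, hp⟩ := h.piecewise
      have htl : ∀ i ≤ m, t i ≤ l := fun i hi => htm ▸ hmono hi
      refine ⟨m + 1, fun i => if i ≤ m then t i else l', ?_, ?_, ?_, ?_⟩
      · refine monotone_nat_of_le_succ fun i => ?_
        by_cases h1 : i + 1 ≤ m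
        · rw [if_pos h1, if_pos (by omega)]; exact hmono (Nat.le_succ i)
        · rw [if_neg h1]
          split_ifs with h2
          · exact (htl i h2).trans hl
          · exact le_rfl
      · simpa using ht0
      · simp
      · intro i hi
        by_cases h1 : i < m
        · have e1 : (if i ≤ m then t i else l') = t i := if_pos h1.le
          have e2 : (if i + 1 ≤ m then t (i + 1) else l') = t (i + 1) := if_pos h1
          beta_reduce
          rw [e1, e2]
          have hle := htl (i + 1) h1
          refine ⟨(hp i h1).1.congr fun s hs => hleft s (hs.2.trans hle), fun s hs => ?_⟩
          rw [hdl s (hs.2.trans_le hle), hleft s (hs.2.le.trans hle)]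
          exact (hp i h1).2 s hs
        · obtain rfl : i = m := by omega
          have e1 : (if i ≤ i then t i else l') = l := by rw [if_pos le_rfl, htm]
          have e2 : (if i + 1 ≤ i then t (i + 1) else l') = l' := if_neg (by omega)
          beta_reduce
          rw [e1, e2]
          refine ⟨hδ.congr fun s hs => hright s hs.1, fun s hs => ?_⟩
          rw [hdr s hs.1, hright s hs.1.le]
          exact htan s hs
  refine ⟨γ', hpath, ?_⟩
  have hint := hpath.intervalIntegrable
  have hsub1 : IntervalIntegrable (fun s => ‖deriv γ' s‖) MeasureTheory.volume 0 l :=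
    hint.mono_set (by rw [uIcc_of_le hl0, uIcc_of_le (hl0.trans hl)]; exact Icc_subset_Icc_right hl)
  have hsub2 : IntervalIntegrable (fun s => ‖deriv γ' s‖) MeasureTheory.volume l l' :=
    hint.mono_set (by rw [uIcc_of_le hl, uIcc_of_le (hl0.trans hl)]; exact Icc_subset_Icc_left hl0)
  rw [← intervalIntegral.integral_add_adjacent_intervals hsub1 hsub2]
  congr 1
  · refine intervalIntegral.integral_congr_Ioo_of_le hl0 fun s hs => ?_
    simp only [hdl s hs.2]
  · refine intervalIntegral.integral_congr_Ioo_of_le hl fun s hs => ?_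
    simp only [hdr s hs.1]

/-! ### Lifting complex paths -/

/-- At `q`, the map `F` pulls complex tangent vectors back to complex tangent vectors, and expands
them by the factor `K`. -/
def ExpandsAt (S T : MarkedDomain E) (F : E → E) (K : ℝ) (q : E) : Prop :=
  ∀ v, IsComplexTangent T.dom (F q) (S.diff F q v) →
    IsComplexTangent S.dom q v ∧ K * ‖v‖ ≤ ‖S.diff F q v‖

/-- `F` has an inverse on the ball with centre `F q` and radius `δ`, which maps the marked parts to
each other and which contracts complex tangent vectors by the factor `K`. -/
def HasLocalInverse (S T : MarkedDomain E) (F : E → E) (K : ℝ) (q : E) (δ : ℝ) : Prop :=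
  ∃ G : E → E, ContDiffOn ℝ 1 G (Metric.ball (F q) δ) ∧ G (F q) = q ∧
    ∀ y ∈ Metric.ball (F q) δ, y ∈ T.part → G y ∈ S.part ∧ F (G y) = y ∧ ExpandsAt S T F K (G y)

theorem HasLocalInverse.anti {S T : MarkedDomain E} {F : E → E} {K : ℝ} {q : E} {δ δ' : ℝ}
    (h : HasLocalInverse S T F K q δ) (hd : δ' ≤ δ) : HasLocalInverse S T F K q δ' := by
  obtain ⟨G, h1, h2, h3⟩ := h
  have hb := Metric.ball_subset_ball (x := F q) hd
  exact ⟨G, h1.mono hb, h2, fun y hy => h3 y (hb hy)⟩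

/-- The path `β` on `[0, t]` is followed, up to its end point, by the image of a complex path whose
length is smaller by the factor `K`. -/
def HasLift (S : MarkedDomain E) (F : E → E) (K : ℝ) (p : E) (β : ℝ → E) (t : ℝ) : Prop :=
  ∃ γ : ℝ → E, IsComplexPath S.dom S.part γ t p (γ t) ∧ F (γ t) = β t ∧
    K * ∫ s in (0 : ℝ)..t, ‖deriv γ s‖ ≤ ∫ s in (0 : ℝ)..t, ‖deriv β s‖

section Lift

variable {S T : MarkedDomain E} {F : E → E}

/-- The lift is continued by `G ∘ β`. Differentiating `F ∘ (G ∘ β) = β` shows that `dF` sends its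
velocity to that of `β`, which is complex tangent; expansion then gives both tangency and the length
estimate. -/
theorem hasLift_step {Ω' : Set E} (hF : IsProperRelative S Ω' F) {K : ℝ} {p : E} {β : ℝ → E}
    {t t' δ : ℝ} (htt : t ≤ t')
    (hint : IntervalIntegrable (fun s => ‖deriv β s‖) MeasureTheory.volume 0 t)
    (hβ : ContDiffOn ℝ 1 β (Icc t t')) (hβT : MapsTo β (Icc t t') T.part)
    (htan : ∀ s ∈ Ioo t t', IsComplexTangent T.dom (β s) (deriv β s))
    (hball : MapsTo β (Icc t t') (Metric.ball (β t) δ)) {γ : ℝ → E}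
    (hγ : IsComplexPath S.dom S.part γ t p (γ t)) (hFγ : F (γ t) = β t)
    (hlen : K * ∫ s in (0 : ℝ)..t, ‖deriv γ s‖ ≤ ∫ s in (0 : ℝ)..t, ‖deriv β s‖)
    (hloc : HasLocalInverse S T F K (γ t) δ) : HasLift S F K p β t' := by
  obtain ⟨G, hG, hGq, hGy⟩ := hloc
  rw [hFγ] at hG hGq hGy
  have hα : ContDiffOn ℝ 1 (G ∘ β) (Icc t t') := hG.comp hβ hball
  have hmaps : MapsTo (G ∘ β) (Icc t t') S.part :=
    fun s hs => (hGy _ (hball hs) (hβT hs)).1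
  have hFα : ∀ s ∈ Icc t t', F ((G ∘ β) s) = β s :=
    fun s hs => (hGy _ (hball hs) (hβT hs)).2.1
  have hder : ∀ s ∈ Ioo t t', IsComplexTangent S.dom ((G ∘ β) s) (deriv (G ∘ β) s) ∧
      K * ‖deriv (G ∘ β) s‖ ≤ ‖deriv β s‖ := by
    intro s hs
    have hn : Icc t t' ∈ 𝓝 s := Icc_mem_nhds hs.1 hs.2
    have hs' : s ∈ Icc t t' := Ioo_subset_Icc_self hs
    have h1 : HasDerivAt (G ∘ β) (deriv (G ∘ β) s) s :=
      ((hα.contDiffAt hn).differentiableAt (by simp)).hasDerivAt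
    have h2 : HasDerivAt β (deriv β s) s :=
      ((hβ.contDiffAt hn).differentiableAt (by simp)).hasDerivAt
    have h3 := (hF.hasFDerivWithinAt (Or.inr (hmaps hs'))).comp_hasDerivAt s h1
      (by filter_upwards [hn] with r hr using Or.inr (hmaps hr))
    have h4 : F ∘ (G ∘ β) =ᶠ[𝓝 s] β := by
      filter_upwards [hn] with r hr using hFα r hr
    have h5 := h2.unique (h3.congr_of_eventuallyEq h4.symm)
    have h6 := (hGy _ (hball hs') (hβT hs')).2.2 (deriv (G ∘ β) s)
    have e : F (G (β s)) = β s := hFα s hs'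
    have h5' : S.diff F (G (β s)) (deriv (G ∘ β) s) = deriv β s := h5.symm
    rw [h5', e] at h6
    exact h6 (htan s hs)
  have hG0 : (G ∘ β) t = γ t := hGq
  obtain ⟨γ', hγ', hl'⟩ := IsComplexPath.extend (δ := G ∘ β) (hG0.symm ▸ hγ) htt hα hmaps
    fun s hs => (hder s hs).1
  have hend : γ' t' = (G ∘ β) t' := hγ'.target
  refine ⟨γ', hend.symm ▸ hγ', ?_, ?_⟩
  · rw [hend]; exact hFα _ ⟨htt, le_rfl⟩
  · have hi1 := intervalIntegrable_norm_deriv htt hα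
    have hi2 := intervalIntegrable_norm_deriv htt hβ
    rw [hl', ← intervalIntegral.integral_add_adjacent_intervals hint hi2, mul_add,
      ← intervalIntegral.integral_const_mul K (fun s => ‖deriv (G ∘ β) s‖)]
    refine add_le_add hlen ?_
    exact intervalIntegral.integral_mono_on_of_le_Ioo htt (hi1.const_mul K) hi2
      fun s hs => (hder s hs).2

/-- Steps of a fixed positive size lead from one end of an interval to the other. -/
theorem step_induction {P : ℝ → Prop} {a b σ : ℝ} (hσ : 0 < σ) (hab : a ≤ b) (ha : P a)
    (hstep : ∀ s s', a ≤ s → s ≤ s' → s' ≤ b → s' < s + σ → P s → P s') : P b := by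
  have hσ2 : 0 < σ / 2 := half_pos hσ
  have key : ∀ n : ℕ, P (min (a + n * (σ / 2)) b) := by
    intro n
    induction n with
    | zero => simpa [min_eq_left hab] using ha
    | succ n ih =>
      refine hstep _ _ (le_min (by simp; positivity) hab) ?_ (min_le_right _ _) ?_ ih
      · refine min_le_min_right _ ?_
        push_cast
        linarith
      · push_cast
        rcases le_total (a + n * (σ / 2)) b with h | h
        · rw [min_eq_left h]
          refine lt_of_le_of_lt (min_le_left _ _) ?_
          linarith
        · rw [min_eq_right h]
          exact lt_of_le_of_lt (min_le_right _ _) (by linarith)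
  obtain ⟨n, hn⟩ := exists_nat_ge ((b - a) / (σ / 2))
  rw [div_le_iff₀ hσ2] at hn
  have := key n
  rwa [min_eq_right (by linarith)] at this

/-- Complex paths of length less than `K τ` lift, if there are local inverses of a uniform size
over the CR ball of radius `τ`. -/
theorem image_crBall_of_hasLocalInverse {Ω' : Set E} (hF : IsProperRelative S Ω' F) {K τ : ℝ}
    (hK : 0 < K) {X : Set E} (hX : X ⊆ T.part) {p : E} (hp : p ∈ S.part)
    (hloc : ∀ Y : Set E, IsCompact Y → Y ⊆ X → ∃ δ > 0,
      ∀ q ∈ crBall S.dom S.part p τ, F q ∈ Y → HasLocalInverse S T F K q δ) :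
    crBall T.dom X (F p) (K * τ) ⊆ F '' crBall S.dom S.part p τ := by
  intro y hy
  obtain ⟨β, l, hβ, hlen⟩ := exists_isComplexPath_of_mem_crBall hy
  -- The compact set is the trace of `β`, so one size `δ` serves at the end points of all partial
  -- lifts.
  obtain ⟨δ, hδ, hinv⟩ := hloc (β '' Icc 0 l) (isCompact_Icc.image_of_continuousOn hβ.continuousOn)
    (image_subset_iff.2 hβ.mapsTo)
  obtain ⟨m, t, hmono, ht0, htm, hp'⟩ := hβ.piecewise
  have huc := isCompact_Icc.uniformContinuousOn_of_continuous hβ.continuousOn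
  obtain ⟨σ, hσ, huc⟩ := Metric.uniformContinuousOn_iff.1 huc δ hδ
  have hint := hβ.intervalIntegrable
  have hsubint : ∀ s ∈ Icc 0 l, IntervalIntegrable (fun s => ‖deriv β s‖)
      MeasureTheory.volume 0 s := by
    intro s hs
    refine hint.mono_set ?_
    rw [uIcc_of_le hs.1, uIcc_of_le hβ.length_nonneg]
    exact Icc_subset_Icc_right hs.2
  -- A partial lift is shorter than `τ`, so its end point is still in the CR ball, where a local
  -- inverse of size `δ` is available: the lifting never stops.
  have hmem : ∀ s ∈ Icc 0 l, ∀ γ : ℝ → E, IsComplexPath S.dom S.part γ s p (γ s) →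
      K * ∫ r in (0 : ℝ)..s, ‖deriv γ r‖ ≤ ∫ r in (0 : ℝ)..s, ‖deriv β r‖ →
      γ s ∈ crBall S.dom S.part p τ := by
    intro s hs γ hγ hle
    refine hγ.mem_crBall ?_
    have h1 : ∫ r in (0 : ℝ)..s, ‖deriv β r‖ ≤ ∫ r in (0 : ℝ)..l, ‖deriv β r‖ :=
      intervalIntegral.integral_mono_interval le_rfl hs.1 hs.2
        (Eventually.of_forall fun _ => norm_nonneg _) hint
    have h2 := (hle.trans h1).trans_lt hlen
    exact lt_of_mul_lt_mul_left h2 hK.le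
  have hti : ∀ i ≤ m, t i ∈ Icc 0 l := fun i hi =>
    ⟨ht0 ▸ hmono (Nat.zero_le i), htm ▸ hmono hi⟩
  have hlift : ∀ i ≤ m, HasLift S F K p β (t i) := by
    intro i
    induction i with
    | zero =>
      intro _
      rw [ht0]
      exact ⟨fun _ => p, isComplexPath_const hp, hβ.source.symm, by simp⟩
    | succ i ih =>
      intro hi
      have hti0 := hti i (by omega)
      have hti1 := hti (i + 1) hi
      refine step_induction hσ (hmono (Nat.le_succ i)) (ih (by omega)) ?_
      rintro s s' hs hss hs' hlt ⟨γ, hγ, hFγ, hle⟩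
      have hsub : Icc s s' ⊆ Icc (t i) (t (i + 1)) := Icc_subset_Icc hs hs'
      have hsub0 : Icc s s' ⊆ Icc 0 l := Icc_subset_Icc (hti0.1.trans hs) (hs'.trans hti1.2)
      have hs0 : s ∈ Icc 0 l := hsub0 ⟨le_rfl, hss⟩
      have hpi := hp' i (by omega)
      refine hasLift_step hF hss (hsubint s hs0) (hpi.1.mono hsub)
        (fun r hr => hX (hβ.mapsTo (hsub0 hr)))
        (fun r hr => hpi.2 r ⟨hs.trans_lt hr.1, hr.2.trans_le hs'⟩) ?_ hγ hFγ hle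
        (hinv _ (hmem s hs0 γ hγ hle) (hFγ ▸ mem_image_of_mem β hs0))
      intro r hr
      refine huc r (hsub0 hr) s hs0 ?_
      rw [Real.dist_eq, abs_of_nonneg (by linarith [hr.1])]
      linarith [hr.2]
  obtain ⟨γ, hγ, hFγ, hle⟩ := hlift m le_rfl
  rw [htm] at hγ hFγ hle
  exact ⟨γ l, hmem l ⟨hβ.length_nonneg, le_rfl⟩ γ hγ hle, by rw [hFγ, hβ.target]⟩

end Lift

/-! ### The covering theorem -/

theorem height_self (Ω : Set E) (q : E) : height Ω q q = 0 := by simp [height]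

theorem continuous_height (Ω : Set E) (q : E) : Continuous (height Ω q) := by
  unfold height
  exact Complex.continuous_re.comp (continuous_const.inner (continuous_id.sub continuous_const))

theorem center_mem_halfBall {Ω : Set E} {q : E} (hn : ‖inwardNormal Ω q‖ = 1) {ε : ℝ}
    (hε : 0 < ε) : q + ε • inwardNormal Ω q ∈ halfBall Ω q ε := by
  refine ⟨Metric.mem_ball_self hε, ?_⟩
  simp only [mem_ofPred_eq, height, add_sub_cancel_left]
  rw [re_inner_smul_real_right, reInner_self hn, mul_one]

/-- A positive size that works for neighbourhoods of all points of a compact set works for the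
compact set. -/
theorem exists_uniform_size {X : Type*} [TopologicalSpace X] {C : Set X} (hC : IsCompact C)
    {P : X → ℝ → Prop} (hanti : ∀ q δ δ', δ' ≤ δ → P q δ → P q δ')
    (h : ∀ q ∈ C, ∃ δ > 0, ∀ᶠ q' in 𝓝[C] q, P q' δ) : ∃ δ > 0, ∀ q ∈ C, P q δ := by
  refine hC.induction_on (p := fun s => ∃ δ > 0, ∀ q ∈ s, P q δ) ⟨1, one_pos, by simp⟩ ?_ ?_ ?_
  · rintro s t hst ⟨δ, hδ, ht⟩
    exact ⟨δ, hδ, fun q hq => ht q (hst hq)⟩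
  · rintro s t ⟨δ, hδ, hs⟩ ⟨δ', hδ', ht⟩
    refine ⟨min δ δ', lt_min hδ hδ', ?_⟩
    rintro q (hq | hq)
    · exact hanti _ _ _ (min_le_left _ _) (hs q hq)
    · exact hanti _ _ _ (min_le_right _ _) (ht q hq)
  · intro q hq
    obtain ⟨δ, hδ, he⟩ := h q hq
    exact ⟨_, he, δ, hδ, fun _ h => h⟩

section Covering

variable [CompleteSpace E] {S T : MarkedDomain E} {F : E → E}

/-- As the normal rate is nonzero, a vector with complex tangent image is complex tangent; the
factor is the square root of the one in the Levi inequality. -/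
theorem IsProperRelative.expandsAt (hF : IsProperRelative S T.dom F)
    (hS : S.IsPseudoconvexPiece) (hT : T.IsPseudoconvexPiece) {κ₁ κ₂ K r : ℝ} (h1 : 0 < κ₁)
    (h2 : 0 < κ₂) (hr : 0 < r) (hK : K ^ 2 = κ₁ / κ₂ * r)
    (hκ₁ : κ₁ ∈ lowerBounds (leviValues S.dom S.part))
    (hκ₂ : κ₂ ∈ upperBounds (leviValues T.dom T.part)) {q : E} (hq : q ∈ S.part)
    (hFq : F q ∈ T.part) (hrate : r ≤ S.normalRate T.dom F q) : ExpandsAt S T F K q := by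
  intro v hv
  obtain ⟨ρ', hρ', -⟩ := hT.part_subset hFq
  have hpos : 0 < S.normalRate T.dom F q := hr.trans_le hrate
  have hn := hF.inner_diff hS hq hρ' v
  have hv0 : inner ℂ (inwardNormal T.dom (F q)) (S.diff F q v) = 0 := hv
  rw [hv0, eq_comm, mul_eq_zero] at hn
  have hv' : IsComplexTangent S.dom q v := hn.resolve_left (by exact_mod_cast hpos.ne')
  refine ⟨hv', ?_⟩
  have h3 := hF.levi_le hS hT.part_subset hκ₁ hκ₂ hq hFq hpos.le hv'
  refine le_of_sq_le_sq ?_ (norm_nonneg _)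
  rw [mul_pow, hK, div_mul_eq_mul_div, div_mul_eq_mul_div, div_le_iff₀ h2, mul_comm _ κ₂]
  refine le_trans ?_ h3
  gcongr

/-- At points in the closure of the CR ball which are mapped to `X`, the normal rate is bounded
from below. -/
theorem IsProperRelative.le_normalRate_of_mem_closure (hF : IsProperRelative S T.dom F)
    (hS : S.IsPseudoconvexPiece) (hT : T.IsSupported) {p : E} {τ ε m : ℝ}
    (hadm : S.IsAdmissible p τ ε) {X : Set E} (hX : X ⊆ T.part)
    (hm : ∀ x ∈ X, ∀ z ∈ F '' S.halfBalls p τ ε, m ≤ height T.dom x z) {q : E}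
    (hq : q ∈ closure (crBall S.dom S.part p τ)) (hFq : F q ∈ X) :
    m / (2 * ε) ≤ S.normalRate T.dom F q := by
  have hε := hadm.size_pos
  have hqS : q ∈ S.part := hadm.relCompact.2 hq
  have hnb : (𝓝[crBall S.dom S.part p τ] q).NeBot := mem_closure_iff_nhdsWithin_neBot.1 hq
  have hsub : crBall S.dom S.part p τ ⊆ S.part := fun z hz => hz.1
  have hN : Tendsto (inwardNormal S.dom) (𝓝[crBall S.dom S.part p τ] q)
      (𝓝 (inwardNormal S.dom q)) := (hS.continuousOn_inwardNormal q hqS).mono hsub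
  have hid : Tendsto (fun z : E => z) (𝓝[crBall S.dom S.part p τ] q) (𝓝 q) :=
    nhdsWithin_le_nhds
  have hcen : Tendsto (fun z => z + ε • inwardNormal S.dom z) (𝓝[crBall S.dom S.part p τ] q)
      (𝓝 (q + ε • inwardNormal S.dom q)) := hid.add (hN.const_smul ε)
  -- The centres converge, so each point of the open ball at the limit point `q` lies in the ball at
  -- some nearby point of the CR ball.
  have hball : tangentBall S.dom q ε ⊆ S.dom := by
    intro z hz
    have h1 : Tendsto (fun w => dist z (w + ε • inwardNormal S.dom w))
        (𝓝[crBall S.dom S.part p τ] q) (𝓝 (dist z (q + ε • inwardNormal S.dom q))) :=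
      tendsto_const_nhds.dist hcen
    obtain ⟨w, hw1, hw2⟩ := ((h1.eventually (gt_mem_nhds hz)).and self_mem_nhdsWithin).exists
    exact hadm.ball_subset w hw2 hw1
  have hz0 : q + ε • inwardNormal S.dom q ∈ S.dom := hball (Metric.mem_ball_self hε)
  have hFc : ContinuousAt F (q + ε • inwardNormal S.dom q) :=
    ((hF.holomorphic _ hz0).differentiableAt (hS.isOpen.mem_nhds hz0)).continuousAt
  -- The centres of the balls lie in the half-balls, so the hypothesis applies to them at nearby
  -- `w`, with the base point `F q` fixed.
  have h2 : m ≤ height T.dom (F q) (F (q + ε • inwardNormal S.dom q)) := by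
    have h3 := ((continuous_height T.dom (F q)).continuousAt.tendsto.comp
      (hFc.tendsto.comp hcen))
    refine ge_of_tendsto h3 ?_
    filter_upwards [self_mem_nhdsWithin] with w hw
    refine hm _ hFq _ (mem_image_of_mem F ?_)
    exact mem_biUnion hw (center_mem_halfBall
      (norm_inwardNormal_of_mem_spc (hS.part_subset hw.1)) hε)
  refine le_trans ?_ (hF.le_normalRate hS hqS (hT _ (hX hFq)) hε hball)
  gcongr

variable [FiniteDimensional ℂ E]

/-- One inverse around `F q` serves all nearby `q'`, on balls of half its radius. The strict
inequality at `q` keeps the rate at least `r` at the nearby points `G y`, where expansion is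
required. -/
theorem IsProperRelative.exists_hasLocalInverse (hF : IsProperRelative S T.dom F)
    (hS : S.IsPseudoconvexPiece) (hT : T.IsPseudoconvexPiece) {κ₁ κ₂ K r : ℝ} (h1 : 0 < κ₁)
    (h2 : 0 < κ₂) (hr : 0 < r) (hK : K ^ 2 = κ₁ / κ₂ * r)
    (hκ₁ : κ₁ ∈ lowerBounds (leviValues S.dom S.part))
    (hκ₂ : κ₂ ∈ upperBounds (leviValues T.dom T.part)) {q : E} (hq : q ∈ S.part)
    (hFq : F q ∈ T.part) (hrate : r < S.normalRate T.dom F q) :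
    ∃ δ > 0, ∀ᶠ q' in 𝓝[S.part] q, HasLocalInverse S T F K q' δ := by
  obtain ⟨G, hG, hGF, hFG⟩ := hF.exists_local_inverse hS hT hq hFq
    (hF.diff_injective hS hT h1 hκ₁ hκ₂ hq hFq (hr.trans hrate))
  have hGq : G (F q) = q := hGF.self_of_nhdsWithin hq
  have hrate' := (hF.continuousWithinAt_normalRate hS hT hq hFq).eventually (lt_mem_nhds hrate)
  rw [eventually_nhdsWithin_iff] at hrate'
  have hGt : Tendsto G (𝓝 (F q)) (𝓝 q) := by simpa [hGq] using hG.continuousAt.tendsto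
  have hgood : ∀ᶠ y in 𝓝 (F q), ContDiffAt ℝ 1 G y ∧ (y ∈ T.part →
      G y ∈ S.part ∧ F (G y) = y ∧ ExpandsAt S T F K (G y)) := by
    filter_upwards [hG.eventually (by simp), hFG, hGt.eventually hrate'] with y hy1 hy2 hy3
    refine ⟨hy1, fun hyT => ?_⟩
    obtain ⟨hy4, hy5⟩ := hy2 (hT.part_subset_frontier hyT)
    exact ⟨hy4, hy5, hF.expandsAt hS hT h1 h2 hr hK hκ₁ hκ₂ hy4 (hy5.symm ▸ hyT) (hy3 hy4).le⟩
  obtain ⟨δ, hδ, hb⟩ := Metric.eventually_nhds_iff_ball.1 hgood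
  refine ⟨δ / 2, half_pos hδ, ?_⟩
  have hFt := (hF.continuousOn_part q hq).eventually (Metric.ball_mem_nhds _ (half_pos hδ))
  filter_upwards [hGF, hFt] with q' hq1 hq2
  have hsub : Metric.ball (F q') (δ / 2) ⊆ Metric.ball (F q) δ :=
    Metric.ball_subset_ball' (by linarith [Metric.mem_ball.1 hq2])
  exact ⟨G, fun y hy => (hb y (hsub hy)).1.contDiffWithinAt, hq1,
    fun y hy => (hb y (hsub hy)).2⟩

/-- The covering theorem, for paths in a subset `X` of the marked part of the target. -/
theorem crBall_subset_image (hF : IsProperRelative S T.dom F)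
    (hS : S.IsPseudoconvexPiece) (hT : T.IsPseudoconvexPiece) (hTs : T.IsSupported)
    {κ₁ κ₂ m τ ε : ℝ} {p : E} (h1 : 0 < κ₁) (h2 : 0 < κ₂) (hm0 : 0 < m)
    (hκ₁ : κ₁ ∈ lowerBounds (leviValues S.dom S.part))
    (hκ₂ : κ₂ ∈ upperBounds (leviValues T.dom T.part))
    (hadm : S.IsAdmissible p τ ε) {X : Set E} (hX : X ⊆ T.part)
    (hm : ∀ x ∈ X, ∀ z ∈ F '' S.halfBalls p τ ε, m ≤ height T.dom x z) :
    crBall T.dom X (F p) (√(κ₁ / (8 * κ₂) * (m / ε)) * τ) ⊆ F '' crBall S.dom S.part p τ := by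
  have hε := hadm.size_pos
  have hK : 0 < √(κ₁ / (8 * κ₂) * (m / ε)) := Real.sqrt_pos.2 (by positivity)
  refine image_crBall_of_hasLocalInverse hF hK hX hadm.mem fun Y hY hYX => ?_
  -- The Hopf lemma gives the rate `m / (2 * ε)`. The smaller target `m / (8 * ε)` leaves the strict
  -- margin needed for the local inverses and matches the constant `8` of the statement.
  have hr : 0 < m / (8 * ε) := by positivity
  have hK2 : √(κ₁ / (8 * κ₂) * (m / ε)) ^ 2 = κ₁ / κ₂ * (m / (8 * ε)) := by
    rw [Real.sq_sqrt (by positivity)]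
    field_simp
  set B := crBall S.dom S.part p τ with hB
  have hcl : closure B ⊆ S.part := hadm.relCompact.2
  -- The local inverses get a common size on the compact set of points of the closed CR ball which
  -- are mapped to `Y`.
  have hC : IsCompact (closure B ∩ F ⁻¹' Y) :=
    hadm.relCompact.1.of_isClosed_subset
      ((hF.continuousOn_part.mono hcl).preimage_isClosed_of_isClosed isClosed_closure hY.isClosed)
      inter_subset_left
  obtain ⟨δ, hδ, h⟩ := exists_uniform_size hC
    (P := HasLocalInverse S T F (√(κ₁ / (8 * κ₂) * (m / ε))))
    (fun q δ δ' hd h => h.anti hd) (fun q hq => by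
      have hrate := hF.le_normalRate_of_mem_closure hS hTs hadm hX hm hq.1 (hYX hq.2)
      obtain ⟨δ, hδ, he⟩ := hF.exists_hasLocalInverse hS hT h1 h2 hr hK2 hκ₁ hκ₂ (hcl hq.1)
        (hX (hYX hq.2)) (lt_of_lt_of_le (div_lt_div_of_pos_left hm0 (by positivity)
          (by linarith)) hrate)
      exact ⟨δ, hδ, nhdsWithin_mono q (inter_subset_left.trans hcl) he⟩)
  exact ⟨δ, hδ, fun q hq hFq => h q ⟨subset_closure hq, hFq⟩⟩

end Covering

/-! ### Complex tangent vectors and signs of the Levi form -/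

theorem exists_unit_inner_eq_zero [FiniteDimensional ℂ E] (hE : 1 < Module.finrank ℂ E) (n : E) :
    ∃ u : E, ‖u‖ = 1 ∧ inner ℂ n u = 0 := by
  have h1 := Submodule.finrank_add_finrank_orthogonal (ℂ ∙ n)
  have h2 : Module.finrank ℂ (ℂ ∙ n) ≤ 1 := (finrank_span_le_card ({n} : Set E)).trans (by simp)
  have h3 : 0 < Module.finrank ℂ (ℂ ∙ n)ᗮ := by omega
  have h4 : (ℂ ∙ n)ᗮ ≠ ⊥ := by
    intro h
    rw [h, finrank_bot] at h3
    exact lt_irrefl _ h3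
  obtain ⟨v, hv, hv0⟩ := Submodule.exists_mem_ne_zero_of_ne_bot h4
  refine ⟨((‖v‖⁻¹ : ℝ) : ℂ) • v, ?_, ?_⟩
  · rw [norm_smul, Complex.norm_real, norm_inv, norm_norm,
      inv_mul_cancel₀ (norm_ne_zero_iff.2 hv0)]
  · rw [inner_smul_right, Submodule.mem_orthogonal_singleton_iff_inner_right.1 hv, mul_zero]

/-- In dimension at least two there is a unit complex tangent vector, on which the Levi form is
positive. -/
theorem pos_of_upperBounds_leviValues [FiniteDimensional ℂ E] (hE : 1 < Module.finrank ℂ E)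
    {Ω X : Set E} (hX : X ⊆ spc Ω) {x : E} (hx : x ∈ X) {κ : ℝ}
    (hκ : κ ∈ upperBounds (leviValues Ω X)) : 0 < κ := by
  obtain ⟨ρ, hρ, hpos⟩ := hX hx
  obtain ⟨u, hu, hnu⟩ := exists_unit_inner_eq_zero hE (inwardNormal Ω x)
  have h1 := hpos u (by rintro rfl; simp at hu) hnu
  exact (div_pos h1 (norm_pos_iff.2 hρ.fderiv_ne_zero)).trans_le
    (hκ ⟨x, hx, ρ, hρ, u, hu, hnu, rfl⟩)

theorem MarkedDomain.IsAdmissible.halfBalls_subset {S : MarkedDomain E} {p : E} {τ ε : ℝ}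
    (h : S.IsAdmissible p τ ε) : S.halfBalls p τ ε ⊆ S.dom :=
  iUnion₂_subset fun q hq => inter_subset_left.trans (h.ball_subset q hq)

/-- The smaller ball is internally tangent to the larger one at the same boundary point. -/
theorem MarkedDomain.IsAdmissible.anti [CompleteSpace E] {S : MarkedDomain E}
    (hS : S.IsPseudoconvexPiece) {p : E} {τ ε ε' : ℝ}
    (h : S.IsAdmissible p τ ε') (h0 : 0 < ε) (hε : ε ≤ ε') : S.IsAdmissible p τ ε where
  mem := h.mem
  radius_pos := h.radius_pos
  size_pos := h0
  relCompact := h.relCompact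
  ball_subset := by
    intro q hq
    refine Subset.trans (Metric.ball_subset_ball' ?_) (h.ball_subset q hq)
    rw [dist_add_left, dist_eq_norm, ← sub_smul, norm_smul,
      norm_inwardNormal_of_mem_spc (hS.part_subset hq.1), mul_one, Real.norm_eq_abs,
      abs_of_nonpos (by linarith)]
    linarith

section Bounds

variable [CompleteSpace E] [FiniteDimensional ℂ E] {S T : MarkedDomain E} {F : E → E}

/-- The size of the tangent balls is bounded in terms of the Levi form. -/
theorem MarkedDomain.IsAdmissible.size_le (hE : 1 < Module.finrank ℂ E)
    (hS : S.IsPseudoconvexPiece) {p : E} {τ ε κ : ℝ} (h : S.IsAdmissible p τ ε)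
    (hκ : κ ∈ lowerBounds (leviValues S.dom S.part)) : κ ≤ 1 / (2 * ε) := by
  obtain ⟨ρ, hρ, -⟩ := hS.part_subset h.mem
  obtain ⟨u, hu, hnu⟩ := exists_unit_inner_eq_zero hE (inwardNormal S.dom p)
  exact (hκ ⟨p, h.mem, ρ, hρ, u, hu, hnu, rfl⟩).trans (hρ.leviForm_le_of_tangentBall h.size_pos
    (h.ball_subset p (mem_crBall_self h.mem h.radius_pos)) hu hnu)

/-- The covering lemma. -/
theorem covering_lemma (hE : 1 < Module.finrank ℂ E) {p : E} {τ ε κ₁ κ₂ : ℝ} (hS : S.IsSource)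
    (hT : T.IsPseudoconvexPiece) (hTs : T.IsSupported)
    (hκ₁ : κ₁ ∈ lowerBounds (leviValues S.dom S.part))
    (hκ₂ : κ₂ ∈ upperBounds (leviValues T.dom T.part)) (hadm : S.IsAdmissible p τ ε)
    (hF : IsProperRelative S T.dom F) (hFp : F p ∈ T.part) :
    crBall T.dom T.part (F p) (√(κ₁ / (8 * κ₂) *
      (sInf {t : ℝ | ∃ x ∈ T.part, ∃ z ∈ F '' S.halfBalls p τ ε, t = |height T.dom x z|} / ε)) * τ)
      ⊆ F '' crBall S.dom S.part p τ := by
  set A := {t : ℝ | ∃ x ∈ T.part, ∃ z ∈ F '' S.halfBalls p τ ε, t = |height T.dom x z|} with hA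
  have hA0 : ∀ t ∈ A, 0 ≤ t := by
    rintro t ⟨x, -, z, -, rfl⟩
    exact abs_nonneg _
  have hκ₂0 := pos_of_upperBounds_leviValues hE hT.part_subset hFp hκ₂
  have hε := hadm.size_pos
  have hM : 0 ≤ sInf A := Real.sInf_nonneg hA0
  -- If `κ₁ ≤ 0` or the infimum is `0`, the radius is `0`, as the square root of a nonpositive
  -- number is `0`, and the CR ball is empty.
  rcases le_or_gt κ₁ 0 with h | h
  · rw [Real.sqrt_eq_zero_of_nonpos (mul_nonpos_of_nonpos_of_nonneg
      (div_nonpos_of_nonpos_of_nonneg h (by positivity)) (by positivity)), zero_mul,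
      crBall_eq_empty le_rfl]
    exact empty_subset _
  rcases hM.eq_or_lt with h0 | h0
  · rw [← h0, zero_div, mul_zero, Real.sqrt_zero, zero_mul, crBall_eq_empty le_rfl]
    exact empty_subset _
  refine crBall_subset_image hF hS.toIsPseudoconvexPiece hT hTs h hκ₂0 h0 hκ₁ hκ₂ hadm
    Subset.rfl ?_
  rintro x hx z hz
  obtain ⟨w, hw, rfl⟩ := id hz
  rw [← abs_of_nonneg (hTs x hx _ (hF.mapsTo (hadm.halfBalls_subset hw)))]
  exact csInf_le ⟨0, hA0⟩ ⟨x, hx, _, hz, rfl⟩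

/-! ### The three situations -/

/-- The constant in the covering properties. -/
noncomputable def coverConst (κ₁ κ₂ m : ℝ) : ℝ := √(κ₁ / (8 * κ₂) * m) * min 1 √(2 * κ₁)

theorem coverConst_pos {κ₁ κ₂ m : ℝ} (h1 : 0 < κ₁) (h2 : 0 < κ₂) (hm : 0 < m) :
    0 < coverConst κ₁ κ₂ m :=
  mul_pos (Real.sqrt_pos.2 (by positivity)) (lt_min one_pos (Real.sqrt_pos.2 (by positivity)))

theorem coverConst_div_sqrt_le {κ₁ κ₂ m ε : ℝ} :
    coverConst κ₁ κ₂ m / √ε ≤ √(κ₁ / (8 * κ₂) * m) / √ε := by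
  refine div_le_div_of_nonneg_right ?_ (Real.sqrt_nonneg _)
  exact mul_le_of_le_one_right (Real.sqrt_nonneg _) (min_le_left _ _)

theorem sqrt_mul_div {a m ε : ℝ} (ha : 0 ≤ a * m) : √(a * (m / ε)) = √(a * m) / √ε := by
  rw [← mul_div_assoc, Real.sqrt_div ha]

/-- The core of the second and third covering properties. -/
theorem crBall_subset_image_of_far {κ₁ κ₂ m τ ε ε₀ d : ℝ} {p : E}
    (hF : IsProperRelative S T.dom F) (hS : S.IsPseudoconvexPiece) (hT : T.IsPseudoconvexPiece)
    (hTs : T.IsSupported) (h1 : 0 < κ₁) (h2 : 0 < κ₂) (hm0 : 0 < m)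
    (hκ₁ : κ₁ ∈ lowerBounds (leviValues S.dom S.part))
    (hκ₂ : κ₂ ∈ upperBounds (leviValues T.dom T.part)) (hadm : S.IsAdmissible p τ ε₀)
    (hε : 0 < ε) (hεε : ε ≤ ε₀) {X : Set E} (hX : X ⊆ T.part)
    (hd : ∀ x ∈ T.part, ∀ z ∈ T.dom, d ≤ dist z x → m ≤ height T.dom x z)
    (hfar : ∀ x ∈ X, ∀ z ∈ F '' S.halfBalls p τ ε, d ≤ dist z x) :
    crBall T.dom X (F p) (coverConst κ₁ κ₂ m * τ / √ε) ⊆ F '' crBall S.dom S.part p τ := by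
  have hadm' := hadm.anti hS hε hεε
  refine Subset.trans (crBall_mono ?_) (crBall_subset_image hF hS hT hTs h1 h2 hm0 hκ₁ hκ₂ hadm'
    hX fun x hx z hz => ?_)
  · rw [sqrt_mul_div (by positivity), mul_div_right_comm]
    exact mul_le_mul_of_nonneg_right coverConst_div_sqrt_le hadm.radius_pos.le
  · have hfz := hfar x hx z hz
    obtain ⟨w, hw, rfl⟩ := hz
    exact hd x (hX hx) _ (hF.mapsTo (hadm'.halfBalls_subset hw)) hfz

theorem coversFromCompact (hE : 1 < Module.finrank ℂ E) {κ₁ κ₂ m τ ε₀ : ℝ} {p a : E}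
    (hS : S.IsPseudoconvexPiece) (hT : T.IsPseudoconvexPiece) (hTs : T.IsSupported)
    (hadm : S.IsAdmissible p τ ε₀) (ha : a ∈ T.part) (h1 : 0 < κ₁) (h2 : 0 < κ₂) (hm0 : 0 < m)
    (hκ₁ : κ₁ ∈ lowerBounds (leviValues S.dom S.part))
    (hκ₂ : κ₂ ∈ upperBounds (leviValues T.dom T.part)) {K : Set E}
    (hK : ∀ x ∈ T.part, ∀ z ∈ K, m ≤ height T.dom x z) :
    CoversFromCompact K S p τ ε₀ T a (coverConst κ₁ κ₂ m) := by
  rintro F hF rfl hFK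
  have hε := hadm.size_pos
  refine Subset.trans (crBall_mono ?_) (crBall_subset_image hF hS hT hTs h1 h2 hm0 hκ₁ hκ₂ hadm
    Subset.rfl fun x hx z hz => hK x hx z (hFK hz))
  refine mul_le_mul_of_nonneg_right ?_ hadm.radius_pos.le
  rw [sqrt_mul_div (by positivity), div_eq_mul_inv, ← Real.sqrt_inv]
  -- Tangent balls have size at most `1 / (2 * κ₁)`, so `√(2 * κ₁) ≤ 1 / √ε₀`; this removes the size
  -- from the radius.
  refine mul_le_mul_of_nonneg_left ((min_le_right _ _).trans (Real.sqrt_le_sqrt ?_))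
    (Real.sqrt_nonneg _)
  have h3 := hadm.size_le hE hS hκ₁
  rw [le_div_iff₀ (by positivity)] at h3
  rw [← one_div, le_div_iff₀ hε]
  linarith

/-- The height over the tangent plane at `a` is 1-Lipschitz, so the points at level at least `lam`
are at distance at least `η` from the region at level at most `lam - η`. -/
theorem coversBelowLevel {κ₁ κ₂ m τ ε₀ η : ℝ} {p a : E}
    (hS : S.IsPseudoconvexPiece) (hT : T.IsPseudoconvexPiece) (hTs : T.IsSupported)
    (hadm : S.IsAdmissible p τ ε₀) (ha : a ∈ T.part) (h1 : 0 < κ₁) (h2 : 0 < κ₂) (hm0 : 0 < m)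
    (hκ₁ : κ₁ ∈ lowerBounds (leviValues S.dom S.part))
    (hκ₂ : κ₂ ∈ upperBounds (leviValues T.dom T.part))
    (hd : ∀ x ∈ T.part, ∀ z ∈ T.dom, η ≤ dist z x → m ≤ height T.dom x z) :
    CoversBelowLevel η S p τ ε₀ T a (coverConst κ₁ κ₂ m) := by
  rintro lam hlam ε hε hεε F hF rfl hFA
  refine crBall_subset_image_of_far hF hS hT hTs h1 h2 hm0 hκ₁ hκ₂ hadm hε hεε inter_subset_left
    hd fun x hx z hz => ?_
  have h3 : height T.dom (F p) x ≤ lam - η := hx.2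
  have h4 : lam ≤ height T.dom (F p) z := hFA hz
  have h5 : height T.dom (F p) z - height T.dom (F p) x
      = (inner ℂ (inwardNormal T.dom (F p)) (z - x)).re := by
    simp only [height]
    rw [← Complex.sub_re, ← inner_sub_right]
    congr 2
    abel
  have h6 := (le_abs_self _).trans (abs_re_inner_le (inwardNormal T.dom (F p)) (z - x))
  rw [norm_inwardNormal_of_mem_spc (hT.part_subset ha), one_mul, ← h5, ← dist_eq_norm] at h6
  linarith

theorem coversAwayFromBall {κ₁ κ₂ m τ ε₀ η η' : ℝ} {p a : E}
    (hS : S.IsPseudoconvexPiece) (hT : T.IsPseudoconvexPiece) (hTs : T.IsSupported)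
    (hadm : S.IsAdmissible p τ ε₀) (h1 : 0 < κ₁) (h2 : 0 < κ₂) (hm0 : 0 < m)
    (hκ₁ : κ₁ ∈ lowerBounds (leviValues S.dom S.part))
    (hκ₂ : κ₂ ∈ upperBounds (leviValues T.dom T.part))
    (hd : ∀ x ∈ T.part, ∀ z ∈ T.dom, η' - η ≤ dist z x → m ≤ height T.dom x z) :
    CoversAwayFromBall η η' S p τ ε₀ T a (coverConst κ₁ κ₂ m) := by
  rintro y hy ε hε hεε F hF rfl hFA
  refine crBall_subset_image_of_far hF hS hT hTs h1 h2 hm0 hκ₁ hκ₂ hadm hε hεε sdiff_subset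
    hd fun x hx z hz => ?_
  have h3 : dist z y < η := hFA hz
  have h4 : η' ≤ dist x y := not_lt.1 hx.2
  linarith [dist_triangle_left x y z]

end Bounds

/-! ### Convergence of normals and Levi forms -/

/-- Joint convergence in the index and the point is the form needed for data at moving boundary
points of moving domains. -/
theorem tendsto_prod_of_tendstoUniformlyOn {X Y : Type*} [TopologicalSpace X]
    [PseudoMetricSpace Y] {fn : ℕ → X → Y} {f : X → Y} {V : Set X} {q : X} (hV : V ∈ 𝓝 q)
    (h : TendstoUniformlyOn fn f atTop V) (hf : ContinuousAt f q) :
    Tendsto (fun p : ℕ × X => fn p.1 p.2) (atTop ×ˢ 𝓝 q) (𝓝 (f q)) := by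
  refine Metric.tendsto_nhds.2 fun e he => ?_
  have h1 := Metric.tendstoUniformlyOn_iff.1 h (e / 2) (half_pos he)
  have h2 := hf.eventually (Metric.ball_mem_nhds (f q) (half_pos he))
  filter_upwards [h1.prod_mk (inter_mem hV h2)] with p hp
  have h3 : dist (f p.2) (f q) < e / 2 := hp.2.2
  linarith [dist_triangle_left (fn p.1 p.2) (f q) (f p.2), hp.1 p.2 hp.2.1]

theorem eventually_forall_of_forall_eventually_prod {α Y : Type*} [TopologicalSpace Y]
    {l : Filter α} {K : Set Y} (hK : IsCompact K) {P : α → Y → Prop}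
    (h : ∀ y ∈ K, ∀ᶠ z in l ×ˢ 𝓝 y, P z.1 z.2) : ∀ᶠ a in l, ∀ y ∈ K, P a y := by
  have h1 : ∀ᶠ z in l ×ˢ 𝓝ˢ K, P z.1 z.2 := hK.mem_prod_nhdsSet_of_forall h
  exact h1.curry.mono fun _ h => h.self_of_nhdsSet

/-- `t` is the value of the normalized Levi form of `Ω` at `q` on the complex tangent vector
`u`. -/
def IsLeviValue (Ω : Set E) (q u : E) (t : ℝ) : Prop :=
  ∃ ρ : E → ℝ, IsDefiningFunctionAt Ω ρ q ∧ IsComplexTangent Ω q u ∧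
    t = leviForm ρ q u / ‖fderiv ℝ ρ q‖

theorem mem_leviValues_iff {Ω X : Set E} {t : ℝ} :
    t ∈ leviValues Ω X ↔ ∃ q ∈ X, ∃ u : E, ‖u‖ = 1 ∧ IsLeviValue Ω q u t := by
  constructor
  · rintro ⟨q, hq, ρ, hρ, u, hu, hnu, h⟩
    exact ⟨q, hq, u, hu, ρ, hρ, hnu, h⟩
  · rintro ⟨q, hq, u, hu, ρ, hρ, hnu, h⟩
    exact ⟨q, hq, ρ, hρ, u, hu, hnu, h⟩

theorem tendsto_leviForm {ι : Type*} {l : Filter ι} {f : ι → E →L[ℝ] ℝ}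
    {f₂ : ι → E →L[ℝ] E →L[ℝ] ℝ} {u : ι → E} {f₀ : E →L[ℝ] ℝ} {f₂₀ : E →L[ℝ] E →L[ℝ] ℝ} {u₀ : E}
    (hf0 : f₀ ≠ 0) (hf : Tendsto f l (𝓝 f₀)) (hf₂ : Tendsto f₂ l (𝓝 f₂₀))
    (hu : Tendsto u l (𝓝 u₀)) :
    Tendsto (fun i => ((f₂ i (u i) (u i) + f₂ i (Complex.I • u i) (Complex.I • u i)) / 4) / ‖f i‖) l
      (𝓝 (((f₂₀ u₀ u₀ + f₂₀ (Complex.I • u₀) (Complex.I • u₀)) / 4) / ‖f₀‖)) := by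
  have happ : ∀ {v : ι → E} {v₀ : E}, Tendsto v l (𝓝 v₀) →
      Tendsto (fun i => f₂ i (v i) (v i)) l (𝓝 (f₂₀ v₀ v₀)) := by
    intro v v₀ hv
    have hc : Continuous fun p : (E →L[ℝ] E →L[ℝ] ℝ) × E => p.1 p.2 p.2 := by fun_prop
    exact (hc.tendsto (f₂₀, v₀)).comp (hf₂.prodMk_nhds hv)
  exact (((happ hu).add (happ (hu.const_smul Complex.I))).div_const 4).div hf.norm
    (norm_ne_zero_iff.2 hf0)

/-- With the constant sequence, the perturbation estimates become continuity statements for a single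
domain. -/
theorem tendstoMarked_const {S : MarkedDomain E} (hS : closure S.part ⊆ spc S.dom) :
    TendstoMarked (fun _ => S) S where
  hausdorff_dom := by simp
  hausdorff_part := by simp
  definingFunctions := by
    intro q hq
    obtain ⟨ρ, ⟨-, V, hqV, hV⟩, -⟩ := hS hq
    refine ⟨V, ρ, fun _ => ρ, hqV, hV, Eventually.of_forall fun _ => hV, ?_, ?_, ?_⟩
    · exact fun v hv => Eventually.of_forall fun _ _ _ => refl_mem_uniformity hv
    · exact fun v hv => Eventually.of_forall fun _ _ _ => refl_mem_uniformity hv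
    · exact fun v hv => Eventually.of_forall fun _ _ _ => refl_mem_uniformity hv

section Limits

variable {Sn : ℕ → MarkedDomain E} {S : MarkedDomain E}

/-- Properties which hold near each point of the closure of the limit part hold on the parts. -/
theorem TendstoMarked.eventually_forall_part (h : TendstoMarked Sn S)
    (hS : IsCompact (closure S.part)) {P : ℕ → E → Prop}
    (hP : ∀ q ∈ closure S.part, ∀ᶠ z in atTop ×ˢ 𝓝 q, P z.1 z.2) :
    ∀ᶠ n in atTop, ∀ q ∈ (Sn n).part, P n q := by
  have h1 : ∀ᶠ z in atTop ×ˢ 𝓝ˢ (closure S.part), P z.1 z.2 := hS.mem_prod_nhdsSet_of_forall hP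
  obtain ⟨pa, ha, pb, hb, hab⟩ := eventually_prod_iff.1 h1
  obtain ⟨δ, hδ, hsub⟩ := (Metric.hasBasis_nhdsSet_thickening hS).mem_iff.1 hb
  have h2 : ∀ᶠ n in atTop, Metric.hausdorffEDist (Sn n).part S.part < ENNReal.ofReal δ :=
    h.hausdorff_part.eventually (gt_mem_nhds (ENNReal.ofReal_pos.2 hδ))
  filter_upwards [ha, h2] with n hn1 hn2 q hq
  obtain ⟨y, hy, hyd⟩ := Metric.exists_edist_lt_of_hausdorffEDist_lt hq hn2
  refine hab hn1 (hsub ?_)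
  rw [Metric.mem_thickening_iff]
  refine ⟨y, subset_closure hy, ?_⟩
  rwa [edist_dist, ENNReal.ofReal_lt_ofReal_iff hδ] at hyd

theorem TendstoMarked.exists_tendsto (h : TendstoMarked Sn S) {q : E} (hq : q ∈ closure S.part)
    (hqf : q ∈ frontier S.dom) : ∃ (ρ : E → ℝ) (ρn : ℕ → E → ℝ), IsDefiningFunctionAt S.dom ρ q ∧
      (∀ᶠ z in atTop ×ˢ 𝓝 q, z.2 ∈ frontier (Sn z.1).dom →
        IsDefiningFunctionAt (Sn z.1).dom (ρn z.1) z.2) ∧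
      Tendsto (fun z : ℕ × E => fderiv ℝ (ρn z.1) z.2) (atTop ×ˢ 𝓝 q) (𝓝 (fderiv ℝ ρ q)) ∧
      Tendsto (fun z : ℕ × E => fderiv ℝ (fderiv ℝ (ρn z.1)) z.2) (atTop ×ˢ 𝓝 q)
        (𝓝 (fderiv ℝ (fderiv ℝ ρ) q)) := by
  obtain ⟨V, ρ, ρn, hqV, hV, hVn, -, h1, h2⟩ := h.definingFunctions q hq
  have hVq : V ∈ 𝓝 q := hV.isOpen.mem_nhds hqV
  have hat := hV.isDefiningFunctionAt hqV ((hV.mem_frontier_iff hqV).1 hqf)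
  have hd1 : ContDiffAt ℝ 1 (fderiv ℝ ρ) q :=
    (hat.contDiffAt.of_le two_le_infty).fderiv_right (m := 1) (by norm_num)
  have hd2 : ContDiffAt ℝ 0 (fderiv ℝ (fderiv ℝ ρ)) q := hd1.fderiv_right (m := 0) (by norm_num)
  refine ⟨ρ, ρn, hat, ?_, tendsto_prod_of_tendstoUniformlyOn hVq h1 hd1.continuousAt,
    tendsto_prod_of_tendstoUniformlyOn hVq h2 hd2.continuousAt⟩
  filter_upwards [hVn.prod_mk hVq] with z hz hzf
  exact hz.1.isDefiningFunctionAt hz.2 ((hz.1.mem_frontier_iff hz.2).1 hzf)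

variable [CompleteSpace E]

theorem TendstoMarked.tendsto_inwardNormal (h : TendstoMarked Sn S) {q : E}
    (hq : q ∈ closure S.part) (hqf : q ∈ frontier S.dom) {e : ℝ} (he : 0 < e) :
    ∀ᶠ z in atTop ×ˢ 𝓝 q, z.2 ∈ frontier (Sn z.1).dom →
      dist (inwardNormal (Sn z.1).dom z.2) (inwardNormal S.dom q) < e := by
  obtain ⟨ρ, ρn, hρ, hρn, h1, -⟩ := h.exists_tendsto hq hqf
  have h3 := (continuousAt_normalOf hρ.fderiv_ne_zero).tendsto.comp h1
  rw [← hρ.inwardNormal_eq] at h3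
  filter_upwards [hρn, h3.eventually (Metric.ball_mem_nhds _ he)] with z hz1 hz2 hzf
  rw [(hz1 hzf).inwardNormal_eq]
  exact hz2

/-- The normals at points of the parts are close to the normals at nearby points of the closure of
the limit part. -/
theorem TendstoMarked.eventually_exists_normal (h : TendstoMarked Sn S) (hS : S.IsSource)
    (hSn : ∀ n, (Sn n).IsSource) {e : ℝ} (he : 0 < e) :
    ∀ᶠ n in atTop, ∀ x ∈ (Sn n).part, ∃ x₀ ∈ closure S.part, dist x x₀ < e ∧
      dist (inwardNormal (Sn n).dom x) (inwardNormal S.dom x₀) < e := by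
  have h1 := h.eventually_forall_part hS.relCompact.1
    (P := fun n x => x ∈ frontier (Sn n).dom → ∃ x₀ ∈ closure S.part, dist x x₀ < e ∧
      dist (inwardNormal (Sn n).dom x) (inwardNormal S.dom x₀) < e) (fun q hq => by
      have hqf := mem_frontier_of_mem_spc (hS.relCompact.2 hq)
      filter_upwards [h.tendsto_inwardNormal hq hqf he,
        tendsto_snd.eventually (Metric.ball_mem_nhds q he)] with z hz1 hz2 hzf
      exact ⟨q, hq, hz2, hz1 hzf⟩)
  filter_upwards [h1] with n hn x hx
  exact hn x hx ((hSn n).part_subset_frontier hx)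

/-- Levi values of nearby domains are close to Levi values of the limit. -/
theorem TendstoMarked.eventually_isLeviValue (h : TendstoMarked Sn S) {q : E}
    (hq : q ∈ closure S.part) (hqf : q ∈ frontier S.dom) (u : E) {e : ℝ} (he : 0 < e) :
    ∀ᶠ z in atTop ×ˢ 𝓝 (q, u), ∀ t, IsLeviValue (Sn z.1).dom z.2.1 z.2.2 t →
      ∃ t₀, IsLeviValue S.dom q u t₀ ∧ |t - t₀| < e := by
  obtain ⟨ρ, ρn, hρ, hρn, h1, h2⟩ := h.exists_tendsto hq hqf
  have hfst : Tendsto (fun z : ℕ × E × E => (z.1, z.2.1)) (atTop ×ˢ 𝓝 (q, u)) (atTop ×ˢ 𝓝 q) :=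
    tendsto_fst.prodMk ((continuous_fst.tendsto (q, u)).comp tendsto_snd)
  have hsnd : Tendsto (fun z : ℕ × E × E => z.2.2) (atTop ×ˢ 𝓝 (q, u)) (𝓝 u) :=
    (continuous_snd.tendsto (q, u)).comp tendsto_snd
  have hN := ((continuousAt_normalOf hρ.fderiv_ne_zero).tendsto.comp h1).comp hfst
  rw [← hρ.inwardNormal_eq] at hN
  by_cases hu : IsComplexTangent S.dom q u
  · have hl := tendsto_leviForm hρ.fderiv_ne_zero (h1.comp hfst) (h2.comp hfst) hsnd
    filter_upwards [hfst.eventually hρn, hl.eventually (Metric.ball_mem_nhds _ he)]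
      with z hz1 hz2 t ht
    obtain ⟨ρ', hρ', hu', rfl⟩ := ht
    refine ⟨_, ⟨ρ, hρ, hu, rfl⟩, ?_⟩
    rw [hρ'.leviForm_unique (hz1 hρ'.mem_frontier) hu']
    exact hz2
  -- A vector which is not complex tangent at `q` is not complex tangent for nearby data either, so
  -- there is no Levi value to compare.
  · have hu0 : inner ℂ (inwardNormal S.dom q) u ≠ 0 := hu
    have hi := (hN.inner (𝕜 := ℂ) hsnd).eventually_ne hu0
    filter_upwards [hfst.eventually hρn, hi] with z hz1 hz2 t ht
    obtain ⟨ρ', hρ', hu', -⟩ := ht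
    refine absurd ?_ hz2
    have : inner ℂ (inwardNormal (Sn z.1).dom z.2.1) z.2.2 = 0 := hu'
    rwa [(hz1 hρ'.mem_frontier).inwardNormal_eq] at this

theorem IsLeviValue.unique {Ω : Set E} {q u : E} {t t' : ℝ} (h : IsLeviValue Ω q u t)
    (h' : IsLeviValue Ω q u t') : t = t' := by
  obtain ⟨ρ, hρ, hu, rfl⟩ := h
  obtain ⟨ρ', hρ', -, rfl⟩ := h'
  exact hρ.leviForm_unique hρ' hu

/-- A complex tangent vector at a limit point is approximated by its projections to the complex
tangent spaces at nearby points of the part, and the bound passes to the limit. -/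
theorem mem_lowerBounds_leviValues_closure (hS : S.IsSource) {κ : ℝ}
    (hκ : κ ∈ lowerBounds (leviValues S.dom S.part)) :
    κ ∈ lowerBounds (leviValues S.dom (closure S.part)) := by
  rintro t ⟨q, hq, ρ, hρ, u, hu, hnu, rfl⟩
  have hnu0 : inner ℂ (inwardNormal S.dom q) u = 0 := hnu
  have hqf := hρ.mem_frontier
  have hnb : (𝓝[S.part] q).NeBot := mem_closure_iff_nhdsWithin_neBot.1 hq
  have hN : Tendsto (inwardNormal S.dom) (𝓝[S.part] q) (𝓝 (inwardNormal S.dom q)) :=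
    hρ.continuousWithinAt_inwardNormal.mono hS.part_subset_frontier
  let v : E → E := fun z => u - inner ℂ (inwardNormal S.dom z) u • inwardNormal S.dom z
  have hv : Tendsto v (𝓝[S.part] q) (𝓝 u) := by
    have h1 : Tendsto v (𝓝[S.part] q)
        (𝓝 (u - inner ℂ (inwardNormal S.dom q) u • inwardNormal S.dom q)) :=
      tendsto_const_nhds.sub ((hN.inner tendsto_const_nhds).smul hN)
    rwa [hnu0, zero_smul, sub_zero] at h1
  have hd1 : ContDiffAt ℝ 1 (fderiv ℝ ρ) q :=
    (hρ.contDiffAt.of_le two_le_infty).fderiv_right (m := 1) (by norm_num)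
  have hd2 : ContDiffAt ℝ 0 (fderiv ℝ (fderiv ℝ ρ)) q := hd1.fderiv_right (m := 0) (by norm_num)
  have hl := tendsto_leviForm hρ.fderiv_ne_zero (hd1.continuousAt.tendsto.mono_left
    (nhdsWithin_le_nhds (s := S.part))) (hd2.continuousAt.tendsto.mono_left nhdsWithin_le_nhds) hv
  have hr : Tendsto (fun z => κ * ‖v z‖ ^ 2) (𝓝[S.part] q) (𝓝 (κ * ‖u‖ ^ 2)) :=
    (hv.norm.pow 2).const_mul κ
  rw [hu, one_pow, mul_one] at hr
  refine le_of_tendsto_of_tendsto hr hl ?_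
  filter_upwards [nhdsWithin_le_nhds hρ.eventually_at, self_mem_nhdsWithin] with z hz1 hz2
  refine le_leviForm_of_lowerBounds hκ hz2
    (hz1.2.2 (hz1.2.1.1 (hS.part_subset_frontier hz2))) ?_
  have hn1 : inner ℂ (inwardNormal S.dom z) (inwardNormal S.dom z) = (1 : ℂ) := by
    rw [inner_self_eq_norm_sq_to_K, norm_inwardNormal_of_mem_spc (hS.part_subset hz2)]
    simp
  unfold IsComplexTangent
  rw [inner_sub_right, inner_smul_right, hn1, mul_one, sub_self]

variable [FiniteDimensional ℂ E]

/-- Closeness near each pair `(q, u)` becomes uniform by compactness of the closure of the part and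
of the unit sphere. -/
theorem TendstoMarked.eventually_leviValues (h : TendstoMarked Sn S) (hS : S.IsSource)
    {e : ℝ} (he : 0 < e) : ∀ᶠ n in atTop, ∀ t ∈ leviValues (Sn n).dom (Sn n).part,
      ∃ t₀ ∈ leviValues S.dom (closure S.part), |t - t₀| < e := by
  have : ProperSpace E := FiniteDimensional.proper ℂ E
  have h1 := h.eventually_forall_part hS.relCompact.1
    (P := fun n x => ∀ u ∈ Metric.sphere (0 : E) 1, ∀ t, IsLeviValue (Sn n).dom x u t →
      ∃ t₀ ∈ leviValues S.dom (closure S.part), |t - t₀| < e) (fun q hq => by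
      have hqf := mem_frontier_of_mem_spc (hS.relCompact.2 hq)
      refine eventually_forall_of_forall_eventually_prod (isCompact_sphere (0 : E) 1)
        (P := fun (z : ℕ × E) u => ∀ t, IsLeviValue (Sn z.1).dom z.2 u t →
          ∃ t₀ ∈ leviValues S.dom (closure S.part), |t - t₀| < e) fun u hu => ?_
      have h2 := h.eventually_isLeviValue hq hqf u he
      have h3 : Tendsto (fun z : (ℕ × E) × E => (z.1.1, (z.1.2, z.2))) ((atTop ×ˢ 𝓝 q) ×ˢ 𝓝 u)
          (atTop ×ˢ 𝓝 (q, u)) := by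
        rw [nhds_prod_eq]
        exact tendsto_prodAssoc
      filter_upwards [h3.eventually h2] with z hz t ht
      obtain ⟨t₀, ht₀, hlt⟩ := hz t ht
      exact ⟨t₀, mem_leviValues_iff.2 ⟨q, hq, u, by simpa using hu, ht₀⟩, hlt⟩)
  filter_upwards [h1] with n hn t ht
  obtain ⟨q, hq, u, hu, htv⟩ := mem_leviValues_iff.1 ht
  exact hn q hq u (by simpa using hu) t htv

theorem bddAbove_leviValues_closure (hS : S.IsSource) :
    BddAbove (leviValues S.dom (closure S.part)) := by
  have : ProperSpace E := FiniteDimensional.proper ℂ E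
  have hc : IsCompact (closure S.part ×ˢ Metric.sphere (0 : E) 1) :=
    hS.relCompact.1.prod (isCompact_sphere _ _)
  have key : ∃ B : ℝ, ∀ z ∈ closure S.part ×ˢ Metric.sphere (0 : E) 1, ∀ t,
      IsLeviValue S.dom z.1 z.2 t → t ≤ B := by
    refine hc.induction_on (p := fun s : Set (E × E) => ∃ B : ℝ, ∀ z ∈ s, ∀ t,
      IsLeviValue S.dom z.1 z.2 t → t ≤ B) ⟨0, by simp⟩ ?_ ?_ ?_
    · rintro s s' hs ⟨B, hB⟩
      exact ⟨B, fun z hz => hB z (hs hz)⟩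
    · rintro s s' ⟨B, hB⟩ ⟨B', hB'⟩
      refine ⟨max B B', ?_⟩
      rintro z (hz | hz) t ht
      · exact (hB z hz t ht).trans (le_max_left _ _)
      · exact (hB' z hz t ht).trans (le_max_right _ _)
    · rintro ⟨q, u⟩ ⟨hq, -⟩
      -- The constant sequence gives local boundedness: near `(q, u)`, Levi values exceed the one at
      -- `(q, u)` by less than `1`.
      have h1 := (tendstoMarked_const hS.relCompact.2).eventually_isLeviValue hq
        (mem_frontier_of_mem_spc (hS.relCompact.2 hq)) u one_pos
      obtain ⟨n, hn⟩ := h1.curry.exists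
      obtain ⟨B, hB⟩ : ∃ B : ℝ, ∀ t₀, IsLeviValue S.dom q u t₀ → t₀ ≤ B := by
        by_cases hex : ∃ t₀, IsLeviValue S.dom q u t₀
        · obtain ⟨t₀, ht₀⟩ := hex
          exact ⟨t₀, fun t ht => (ht.unique ht₀).le⟩
        · exact ⟨0, fun t ht => absurd ⟨t, ht⟩ hex⟩
      refine ⟨_, nhdsWithin_le_nhds hn, B + 1, fun z hz t ht => ?_⟩
      obtain ⟨t₀, ht₀, hlt⟩ := hz t ht
      linarith [hB t₀ ht₀, (abs_lt.1 hlt).2]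
  obtain ⟨B, hB⟩ := key
  refine ⟨B, fun t ht => ?_⟩
  obtain ⟨q, hq, u, hu, htv⟩ := mem_leviValues_iff.1 ht
  exact hB (q, u) ⟨hq, by simpa using hu⟩ t htv

theorem TendstoMarked.eventually_lowerBounds (h : TendstoMarked Sn S) (hS : S.IsSource)
    {κ : ℝ} (hκ0 : 0 < κ) (hκ : κ ∈ lowerBounds (leviValues S.dom S.part)) :
    ∀ᶠ n in atTop, κ / 2 ∈ lowerBounds (leviValues (Sn n).dom (Sn n).part) := by
  filter_upwards [h.eventually_leviValues hS (half_pos hκ0)] with n hn t ht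
  obtain ⟨t₀, ht₀, hlt⟩ := hn t ht
  linarith [mem_lowerBounds_leviValues_closure hS hκ ht₀, (abs_lt.1 hlt).1]

/-- One constant must serve the limit and all late perturbations; the summand `1` in it absorbs the
error. -/
theorem exists_upperBound_leviValues (hS : S.IsSource) :
    ∃ κ : ℝ, 0 < κ ∧ κ ∈ upperBounds (leviValues S.dom S.part) ∧
      ∀ Sn : ℕ → MarkedDomain E, TendstoMarked Sn S →
        ∀ᶠ n in atTop, κ ∈ upperBounds (leviValues (Sn n).dom (Sn n).part) := by
  obtain ⟨B, hB⟩ := bddAbove_leviValues_closure hS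
  refine ⟨max B 0 + 1, by positivity, ?_, fun Sn h => ?_⟩
  · rintro t ⟨q, hq, ht⟩
    linarith [hB ⟨q, subset_closure hq, ht⟩, le_max_left B 0]
  · filter_upwards [h.eventually_leviValues hS one_pos] with n hn t ht
    obtain ⟨t₀, ht₀, hlt⟩ := hn t ht
    linarith [hB ht₀, (abs_lt.1 hlt).2, le_max_left B 0]

end Limits

/-! ### Heights over the tangent planes -/

theorem height_sub_height (Ω : Set E) (q z w : E) :
    height Ω q z - height Ω q w = (inner ℂ (inwardNormal Ω q) (z - w)).re := by
  simp only [height]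
  rw [← Complex.sub_re, ← inner_sub_right]
  congr 2
  abel

theorem height_add_smul_sub (Ω : Set E) (q x z : E) (s : ℝ) :
    height Ω q (x + s • (z - x)) = (1 - s) * height Ω q x + s * height Ω q z := by
  have h1 := height_sub_height Ω q (x + s • (z - x)) x
  have h2 := height_sub_height Ω q z x
  rw [add_sub_cancel_left, re_inner_smul_real_right, ← h2] at h1
  linarith

theorem height_le_dist {Ω : Set E} {q : E} (hn : ‖inwardNormal Ω q‖ = 1) (z : E) :
    height Ω q z ≤ dist z q := by
  have h := (le_abs_self _).trans (abs_re_inner_le (inwardNormal Ω q) (z - q))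
  rwa [hn, one_mul, ← dist_eq_norm] at h

section Heights

variable [CompleteSpace E] {T : MarkedDomain E}

theorem continuousOn_height_closure (hT : closure T.part ⊆ spc T.dom) :
    ContinuousOn (fun p : E × E => height T.dom p.1 p.2) (closure T.part ×ˢ univ) := by
  rintro ⟨x, z⟩ ⟨hx, -⟩
  have h1 : ContinuousWithinAt (inwardNormal T.dom) (closure T.part) x :=
    (continuousWithinAt_inwardNormal_of_mem_spc (hT hx)).mono
      fun y hy => mem_frontier_of_mem_spc (hT hy)
  have h2 : ContinuousWithinAt (fun p : E × E => inwardNormal T.dom p.1)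
      (closure T.part ×ˢ univ) (x, z) :=
    ContinuousWithinAt.comp (g := inwardNormal T.dom) (f := Prod.fst) (t := closure T.part) h1
      continuousWithinAt_fst fun p hp => hp.1
  exact continuous_re_inner.continuousAt.comp_continuousWithinAt
    (h2.prodMk (continuous_snd.sub continuous_fst).continuousWithinAt)

/-- The heights over the tangent planes at the closure of the part are positive in the domain. -/
theorem MarkedDomain.IsTarget.height_pos (hT : T.IsTarget) {x z : E} (hx : x ∈ closure T.part)
    (hz : z ∈ T.dom) : 0 < height T.dom x z := by
  have hcl := hT.relCompact.2
  have hnonneg : ∀ w ∈ T.dom, 0 ≤ height T.dom x w := by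
    intro w hw
    have hnb : (𝓝[T.part] x).NeBot := mem_closure_iff_nhdsWithin_neBot.1 hx
    have h1 : ContinuousWithinAt (fun y => height T.dom y w) (closure T.part) x :=
      ContinuousWithinAt.comp (t := closure T.part ×ˢ (univ : Set E))
        (f := fun y => (y, w)) (g := fun p : E × E => height T.dom p.1 p.2)
        (continuousOn_height_closure hcl (x, w) ⟨hx, mem_univ w⟩)
        (by fun_prop) fun y hy => ⟨hy, mem_univ w⟩
    refine ge_of_tendsto (h1.mono subset_closure).tendsto ?_
    filter_upwards [self_mem_nhdsWithin] with y hy using hT.isSupported y hy w hw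
  have hn := norm_inwardNormal_of_mem_spc (hcl hx)
  -- Moving `z` slightly against the normal stays in the domain and lowers the height, which is
  -- nonnegative there too; so the height at `z` is strictly positive.
  have h2 : ∀ᶠ s in 𝓝 (0 : ℝ), z - s • inwardNormal T.dom x ∈ T.dom := by
    have hc : Continuous fun s : ℝ => z - s • inwardNormal T.dom x := by fun_prop
    exact hc.continuousAt.eventually (by simpa using hT.isOpen.mem_nhds hz)
  have h2' : ∀ᶠ s in 𝓝[>] (0 : ℝ), z - s • inwardNormal T.dom x ∈ T.dom := nhdsWithin_le_nhds h2
  obtain ⟨s, hs1, hs2⟩ := (h2'.and self_mem_nhdsWithin).exists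
  have h3 := height_sub_height T.dom x z (z - s • inwardNormal T.dom x)
  rw [sub_sub_cancel, re_inner_smul_real_right, reInner_self hn, mul_one] at h3
  have h4 := hnonneg _ hs1
  have h5 : 0 < s := hs2
  linarith

theorem MarkedDomain.IsTarget.exists_height_ge (hT : T.IsTarget) {K : Set E} (hK : IsCompact K)
    (hKT : K ⊆ T.dom) : ∃ m > 0, ∀ x ∈ closure T.part, ∀ z ∈ K, m ≤ height T.dom x z := by
  obtain ⟨m, hm, h⟩ := (hT.relCompact.1.prod hK).exists_forall_le'
    ((continuousOn_height_closure hT.relCompact.2).mono (prod_mono_right (subset_univ K)))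
    (a := 0) fun p hp => hT.height_pos hp.1 (hKT hp.2)
  exact ⟨m, hm, fun x hx z hz => h (x, z) ⟨hx, hz⟩⟩

/-- A point outside the closure of the domain is below the tangent plane at the nearest point. -/
theorem height_neg_of_nearest {Ω : Set E} (hΩ : IsOpen Ω) {w x : E} (hx : x ∈ closure Ω)
    (hw : w ∉ closure Ω) (hnear : ∀ y ∈ closure Ω, dist w x ≤ dist w y) :
    x ∈ frontier Ω ∧ (x ∈ spc Ω → height Ω x w < 0) := by
  have hne : w - x ≠ 0 := fun h => hw (sub_eq_zero.1 h ▸ hx)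
  have hpos : 0 < ‖w - x‖ := norm_pos_iff.2 hne
  -- First variation at the nearest point: no direction entering `Ω` makes an acute angle with `w -
  -- x`.
  have key : ∀ v : E, (∀ᶠ s in 𝓝[>] (0 : ℝ), x + s • v ∈ Ω) → (inner ℂ (w - x) v).re ≤ 0 := by
    intro v hv
    have h1 : Tendsto (fun s : ℝ => s * ‖v‖ ^ 2) (𝓝[>] 0) (𝓝 0) := by
      have hc : Continuous fun s : ℝ => s * ‖v‖ ^ 2 := by fun_prop
      have := hc.tendsto 0
      rw [zero_mul] at this
      exact this.mono_left nhdsWithin_le_nhds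
    have h2 : 2 * (inner ℂ (w - x) v).re ≤ 0 := by
      refine ge_of_tendsto h1 ?_
      filter_upwards [hv, self_mem_nhdsWithin] with s hs hs0
      have hs0' : 0 < s := hs0
      have h3 := hnear _ (subset_closure hs)
      rw [dist_eq_norm, dist_eq_norm] at h3
      have h4 := pow_le_pow_left₀ (norm_nonneg _) h3 2
      have h5 := @norm_sub_sq ℂ E _ _ _ (w - x) (s • v)
      rw [RCLike.re_eq_complex_re, re_inner_smul_real_right, norm_smul, mul_pow,
        Real.norm_eq_abs, sq_abs] at h5
      rw [← sub_sub, h5] at h4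
      have h6 : s * (2 * (inner ℂ (w - x) v).re) ≤ s * (s * ‖v‖ ^ 2) := by nlinarith
      exact le_of_mul_le_mul_left h6 hs0'
    linarith
  have hsq : (inner ℂ (w - x) (w - x)).re = ‖w - x‖ ^ 2 := by
    have := inner_self_eq_norm_sq (𝕜 := ℂ) (w - x)
    simpa using this
  have hxΩ : x ∉ Ω := by
    intro hxΩ
    have hc : Continuous fun s : ℝ => x + s • (w - x) := by fun_prop
    have h1 : ∀ᶠ s in 𝓝 (0 : ℝ), x + s • (w - x) ∈ Ω :=
      hc.continuousAt.eventually (by simpa using hΩ.mem_nhds hxΩ)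
    have h2 := key (w - x) (nhdsWithin_le_nhds h1)
    rw [hsq] at h2
    nlinarith
  refine ⟨⟨hx, by rwa [hΩ.interior_eq]⟩, fun hspc => ?_⟩
  obtain ⟨ρ, hρ, -⟩ := hspc
  have hn := hρ.norm_inwardNormal
  set n := inwardNormal Ω x with hndef
  by_contra! hge
  have hge' : 0 ≤ (inner ℂ n (w - x)).re := hge
  -- If `w` had nonnegative height, the direction `w - x + n` would enter `Ω` at an acute angle with
  -- `w - x`.
  have hin : ∀ᶠ s in 𝓝[>] (0 : ℝ), x + s • (w - x + n) ∈ Ω := by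
    have hlt : fderiv ℝ ρ x (w - x + n) < 0 := by
      rw [hρ.fderiv_apply, ← hndef, inner_add_right, Complex.add_re, reInner_self hn]
      have := norm_pos_iff.2 hρ.fderiv_ne_zero
      nlinarith
    filter_upwards [(hρ.tendsto_slope _).eventually (gt_mem_nhds hlt),
      hρ.eventually_mem_nhds (w - x + n), self_mem_nhdsWithin] with t ht1 ht2 ht3
    refine ht2.2 ?_
    by_contra hc
    exact absurd ht1 (not_lt.2 (mul_nonneg (inv_pos.2 ht3).le (not_lt.1 hc)))
  have h1 := key _ hin
  rw [inner_add_right, Complex.add_re, hsq] at h1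
  have h2 : (inner ℂ (w - x) n).re = (inner ℂ n (w - x)).re := inner_re_symm (𝕜 := ℂ) _ _
  rw [h2] at h1
  nlinarith

/-- Linear growth of the heights is stable under perturbations. -/
theorem TendstoMarked.eventually_height_ge {Tn : ℕ → MarkedDomain E} (h : TendstoMarked Tn T)
    (hT : T.IsSource) (hTn : ∀ n, (Tn n).IsSource) {c D : ℝ} (hc : 0 < c) (hD : 0 < D)
    {Z : Set E} {Zn : ℕ → Set E}
    (hZ : ∀ e > 0, ∀ᶠ n in atTop, ∀ z ∈ Zn n, ∃ z' ∈ Z, dist z z' < e)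
    (hgrow : ∀ x ∈ closure T.part, ∀ z ∈ Z, D ≤ dist z x → c * dist z x ≤ height T.dom x z) :
    ∀ᶠ n in atTop, ∀ x ∈ (Tn n).part, ∀ z ∈ Zn n, 2 * D ≤ dist z x →
      c * D ≤ height (Tn n).dom x z := by
  -- The bound `D / 2` keeps the displaced pair of points at distance at least `D`. By the other
  -- two, the tilt `2 * e * D` of the normal and the displacement `2 * e * (c + 1)` cost at most `c
  -- * D / 2` each, out of `2 * c * D`.
  set e : ℝ := min (D / 2) (min (c / 4) (c * D / (4 * (c + 1)))) with he
  have he0 : 0 < e := by positivity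
  have he1 : e ≤ D / 2 := min_le_left _ _
  have he2 : e ≤ c / 4 := (min_le_right _ _).trans (min_le_left _ _)
  have he3 : e * (4 * (c + 1)) ≤ c * D := by
    have : e ≤ c * D / (4 * (c + 1)) := (min_le_right _ _).trans (min_le_right _ _)
    rwa [le_div_iff₀ (by positivity)] at this
  filter_upwards [h.eventually_exists_normal hT hTn he0, hZ e he0] with n hn1 hn2 x hx z hz hzx
  obtain ⟨x₀, hx₀, hxx, hN⟩ := hn1 x hx
  obtain ⟨z', hz', hzz⟩ := hn2 z hz
  set N := inwardNormal T.dom x₀ with hNdef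
  have hN1 : ‖N‖ = 1 := norm_inwardNormal_of_mem_spc (hT.relCompact.2 hx₀)
  have hd : dist z x - 2 * e ≤ dist z' x₀ := by
    have h1 := dist_triangle4 z z' x₀ x
    rw [dist_comm x₀ x] at h1
    linarith
  have h1 := hgrow x₀ hx₀ z' hz' (by linarith)
  -- The change of height splits into the tilt of the normal and the displacement of the two points.
  have h2 : height (Tn n).dom x z - height T.dom x₀ z'
      = (inner ℂ (inwardNormal (Tn n).dom x - N) (z - x)).re
        + (inner ℂ N ((z - z') - (x - x₀))).re := by
    have e1 : inner ℂ N ((z - z') - (x - x₀)) = inner ℂ N (z - x) - inner ℂ N (z' - x₀) := by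
      rw [← inner_sub_right]
      congr 1
      abel
    simp only [height, ← hNdef, e1, inner_sub_left, Complex.sub_re]
    ring
  have h3 := neg_le_of_abs_le (abs_re_inner_le (inwardNormal (Tn n).dom x - N) (z - x))
  have h4 := neg_le_of_abs_le (abs_re_inner_le N ((z - z') - (x - x₀)))
  rw [hN1, one_mul] at h4
  have h5 : ‖(z - z') - (x - x₀)‖ ≤ 2 * e := by
    refine (norm_sub_le _ _).trans ?_
    rw [← dist_eq_norm, ← dist_eq_norm]
    linarith
  rw [← dist_eq_norm, ← dist_eq_norm] at h3
  have h6 : dist (inwardNormal (Tn n).dom x) N * dist z x ≤ e * dist z x :=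
    mul_le_mul_of_nonneg_right hN.le dist_nonneg
  have h7 := mul_le_mul_of_nonneg_left hd hc.le
  have h8 : (c - e) * (2 * D) ≤ (c - e) * dist z x :=
    mul_le_mul_of_nonneg_left hzx (by linarith)
  have h9 : e * D ≤ c / 4 * D := mul_le_mul_of_nonneg_right he2 hD.le
  nlinarith

variable [FiniteDimensional ℂ E]

/-- Under strict support, the heights grow linearly. -/
theorem MarkedDomain.IsTarget.exists_linear_growth (hT : T.IsTarget)
    (hTs : T.IsStrictlySupported) {D : ℝ} (hD : 0 < D) : ∃ c > 0, ∀ x ∈ closure T.part,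
      ∀ z ∈ T.dom, D ≤ dist z x → c * dist z x ≤ height T.dom x z := by
  have : ProperSpace E := FiniteDimensional.proper ℂ E
  obtain ⟨W, hW, hTW, hstrict⟩ := hTs
  obtain ⟨O, hO, hWO⟩ := hW.open_part
  have hWO' : W = frontier T.dom ∩ O := hWO
  have hclO : closure T.part ⊆ O := fun x hx => by
    have := hTW.2 hx
    rw [hWO'] at this
    exact this.2
  obtain ⟨r, hr, hsub⟩ := hTW.1.exists_thickening_subset_open hO hclO
  set δ := min D (r / 3) with hδdef
  have hδ : 0 < δ := lt_min hD (by positivity)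
  have hδr : δ ≤ r / 3 := min_le_right _ _
  have hnonneg : ∀ x ∈ W, ∀ z ∈ closure T.dom, 0 ≤ height T.dom x z := by
    intro x hx z hz
    rcases eq_or_ne z x with rfl | hne
    · rw [height_self]
    · exact (hstrict x hx z hz hne).le
  have hcldom : ∀ x ∈ closure T.part, x ∈ closure T.dom := fun x hx =>
    (mem_frontier_of_mem_spc (hT.relCompact.2 hx)).1
  -- Near the part, the closure of the domain is cut out by the half-spaces at points of `W`: the
  -- nearest point to an outside `w` is within `2 * δ < r` of `x`, hence in `W`, and `w` is strictly
  -- below the tangent plane there.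
  have hinside : ∀ x ∈ closure T.part, ∀ w, dist w x ≤ δ →
      (∀ y ∈ W, 0 ≤ height T.dom y w) → w ∈ closure T.dom := by
    intro x hx w hwx hw
    by_contra hwc
    obtain ⟨y, hy, hyd⟩ := isClosed_closure.exists_infDist_eq_dist ⟨x, hcldom x hx⟩ w
    have hnear : ∀ y' ∈ closure T.dom, dist w y ≤ dist w y' :=
      fun y' hy' => hyd ▸ Metric.infDist_le_dist_of_mem hy'
    obtain ⟨hyf, hneg⟩ := height_neg_of_nearest hT.isOpen hy hwc hnear
    have hyO : y ∈ O := by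
      refine hsub ((Metric.mem_thickening_iff).2 ⟨x, hx, ?_⟩)
      have h1 := hnear x (hcldom x hx)
      have h2 := dist_triangle_left y x w
      linarith
    have hyW : y ∈ W := by rw [hWO']; exact ⟨hyf, hyO⟩
    exact absurd (hw y hyW) (not_le.2 (hneg (hW.part_subset hyW)))
  -- Pairs at distance exactly `δ` form a compact set even if the domain is unbounded, so heights
  -- have a positive lower bound on them.
  let A : Set (E × E) := (closure T.part ×ˢ closure T.dom) ∩ {p | dist p.2 p.1 = δ}
  have hA : IsCompact A := by
    have h1 : IsCompact (closure T.part ×ˢ Metric.cthickening δ (closure T.part)) :=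
      hTW.1.prod hTW.1.cthickening
    refine h1.of_isClosed_subset ?_ ?_
    · exact (isClosed_closure.prod isClosed_closure).inter
        (isClosed_eq (continuous_snd.dist continuous_fst) continuous_const)
    · rintro ⟨x, w⟩ ⟨⟨hx, -⟩, hd⟩
      exact ⟨hx, Metric.mem_cthickening_of_dist_le w x δ _ hx (le_of_eq hd)⟩
  obtain ⟨m, hm, hmA⟩ := hA.exists_forall_le'
    ((continuousOn_height_closure hT.relCompact.2).mono
      fun p hp => ⟨hp.1.1, mem_univ _⟩) (a := 0) (by
    rintro ⟨x, w⟩ ⟨⟨hx, hw⟩, hd⟩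
    refine hstrict x (hTW.2 hx) w hw ?_
    rintro rfl
    have hd' : dist w w = δ := hd
    rw [dist_self] at hd'
    exact hδ.ne hd')
  refine ⟨m / δ, by positivity, fun x hx z hz hDz => ?_⟩
  have hd0 : 0 < dist z x := hD.trans_le hDz
  have hle : δ ≤ dist z x := (min_le_left _ _).trans hDz
  -- Shorten the segment from `x` to `z` to length `δ`. Heights are affine along it, so its new end
  -- point has nonnegative heights over `W` and lies in the closure of the domain; scaling back
  -- gives linear growth.
  set s := δ / dist z x with hs
  have hs0 : 0 < s := by positivity
  have hs1 : s ≤ 1 := div_le_one_of_le₀ hle hd0.le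
  have hdist : dist (x + s • (z - x)) x = δ := by
    rw [dist_eq_norm, add_sub_cancel_left, norm_smul, Real.norm_eq_abs, abs_of_pos hs0,
      ← dist_eq_norm, hs, div_mul_cancel₀ _ hd0.ne']
  have hmem : x + s • (z - x) ∈ closure T.dom := by
    refine hinside x hx _ hdist.le fun y hy => ?_
    rw [height_add_smul_sub]
    exact add_nonneg (mul_nonneg (by linarith) (hnonneg y hy x (hcldom x hx)))
      (mul_nonneg hs0.le (hnonneg y hy z (subset_closure hz)))
  have h1 : m ≤ height T.dom x (x + s • (z - x)) :=
    hmA (x, x + s • (z - x)) ⟨⟨hx, hmem⟩, hdist⟩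
  rw [height_add_smul_sub, height_self, mul_zero, zero_add, hs, div_mul_eq_mul_div,
    le_div_iff₀ hd0] at h1
  rw [div_mul_eq_mul_div, div_le_iff₀ hδ]
  linarith

end Heights

/-! ### Existence and stability -/

section Stability

variable [CompleteSpace E] [FiniteDimensional ℂ E] {T : MarkedDomain E}

/-- A covering property holds stably if it follows from bounds for the Levi forms and from a
condition on the target which is stable. -/
theorem exists_holdsStably {κ₁ m : ℝ} (hT : T.IsTarget) (hκ₁ : 0 < κ₁) (hm : 0 < m)
    {P : MarkedDomain E → E → ℝ → ℝ → MarkedDomain E → E → ℝ → Prop} {H : MarkedDomain E → Prop}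
    (hanti : ∀ S p τ ε T' a c c', 0 < τ → c' ≤ c → P S p τ ε T' a c → P S p τ ε T' a c')
    (hP : ∀ (κ κ₂ : ℝ) (S T' : MarkedDomain E) (p a : E) (τ ε : ℝ), S.IsSource → T'.IsTarget →
      S.IsAdmissible p τ ε → a ∈ T'.part → 0 < κ → 0 < κ₂ →
      κ ∈ lowerBounds (leviValues S.dom S.part) → κ₂ ∈ upperBounds (leviValues T'.dom T'.part) →
      H T' → P S p τ ε T' a (coverConst κ κ₂ m))
    (hH : H T) (hstab : ∀ Tn : ℕ → MarkedDomain E, (∀ n, (Tn n).IsTarget) →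
      TendstoMarked Tn T → ∀ᶠ n in atTop, H (Tn n)) :
    ∃ c : ℝ, 0 < c ∧ HoldsStably P T κ₁ c := by
  obtain ⟨κ₂, hκ₂, hub, hubn⟩ := exists_upperBound_leviValues hT.toIsSource
  -- The value `κ₁ / 2` still bounds the Levi forms of late perturbations from below, so the
  -- constant built from it serves them too, and its half all the more.
  have hc := coverConst_pos (half_pos hκ₁) hκ₂ hm
  refine ⟨_, hc, fun S hS hlb => ⟨fun p τ ε hadm a ha => ?_, fun Sn Tn hSn hTn hS' hT' => ?_⟩⟩
  · exact hP _ _ S T p a τ ε hS hT hadm ha (half_pos hκ₁) hκ₂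
      (fun t ht => (half_le_self hκ₁.le).trans (hlb ht)) hub hH
  · filter_upwards [hS'.eventually_lowerBounds hS hκ₁ hlb, hubn Tn hT', hstab Tn hTn hT']
      with n h1 h2 h3 p τ ε hadm a ha
    exact hanti _ _ _ _ _ _ _ _ hadm.radius_pos (half_le_self hc.le)
      (hP _ _ (Sn n) (Tn n) p a τ ε (hSn n) (hTn n) hadm ha (half_pos hκ₁) hκ₂ h1 h2 h3)

/-- Distances from `K` to the part are at most some `R`, so heights at least `m` amount to growth
with slope `m / R`, and the stability of linear growth applies with `K` fixed. -/
theorem exists_holdsStably_coversFromCompact (hE : 1 < Module.finrank ℂ E) {κ₁ : ℝ}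
    (hT : T.IsTarget) (hκ₁ : 0 < κ₁) {K : Set E} (hK : IsCompact K) (hKT : K ⊆ T.dom) :
    ∃ c : ℝ, 0 < c ∧ HoldsStably (CoversFromCompact K) T κ₁ c := by
  obtain ⟨m, hm, hmK⟩ := hT.exists_height_ge hK hKT
  obtain ⟨R, hR, hRK⟩ : ∃ R > 0, ∀ x ∈ closure T.part, ∀ z ∈ K, dist z x ≤ R := by
    obtain ⟨R, hR⟩ := Metric.isBounded_iff.1 (hK.isBounded.union hT.relCompact.1.isBounded)
    exact ⟨max R 1, by positivity, fun x hx z hz =>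
      (hR (Or.inl hz) (Or.inr hx)).trans (le_max_left _ _)⟩
  have hdist : ∀ x ∈ closure T.part, ∀ z ∈ K, m ≤ dist z x := fun x hx z hz =>
    (hmK x hx z hz).trans (height_le_dist (norm_inwardNormal_of_mem_spc (hT.relCompact.2 hx)) z)
  -- Heights are at most distances, so `K` is at distance at least `m` from the limit part and at
  -- least `m / 2` from late perturbed parts. With `D = m / 4`, the stable bound is `m / R * D`.
  set m' : ℝ := min m (m / R * (m / 4)) with hm'
  refine exists_holdsStably (m := m') hT hκ₁ (by positivity)
    (H := fun T' => ∀ x ∈ T'.part, ∀ z ∈ K, m' ≤ height T'.dom x z) ?_ ?_ ?_ ?_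
  · intro S p τ ε T' a c c' hτ hcc h F hF hFp hFK
    exact (crBall_mono (mul_le_mul_of_nonneg_right hcc hτ.le)).trans (h F hF hFp hFK)
  · intro κ κ₂ S T' p a τ ε hS hT' hadm ha h1 h2 hlb hub hH
    exact coversFromCompact hE hS.toIsPseudoconvexPiece hT'.toIsPseudoconvexPiece
      hT'.isSupported hadm ha h1 h2 (by positivity) hlb hub hH
  · exact fun x hx z hz => (min_le_left _ _).trans (hmK x (subset_closure hx) z hz)
  · intro Tn hTn h
    have hgrow : ∀ x ∈ closure T.part, ∀ z ∈ K, m / 4 ≤ dist z x →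
        m / R * dist z x ≤ height T.dom x z := by
      intro x hx z hz _
      refine le_trans ?_ (hmK x hx z hz)
      rw [div_mul_eq_mul_div, div_le_iff₀ hR]
      exact mul_le_mul_of_nonneg_left (hRK x hx z hz) hm.le
    filter_upwards [h.eventually_height_ge hT.toIsSource (fun n => (hTn n).toIsSource)
      (div_pos hm hR) (by positivity : 0 < m / 4) (Z := K) (Zn := fun _ => K)
      (fun e he => Eventually.of_forall fun _ z hz => ⟨z, hz, by rwa [dist_self]⟩) hgrow,
      h.eventually_exists_normal hT.toIsSource (fun n => (hTn n).toIsSource) (half_pos hm)]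
      with n hn1 hn2 x hx z hz
    obtain ⟨x₀, hx₀, hxx, -⟩ := hn2 x hx
    refine (min_le_right _ _).trans (hn1 x hx z hz ?_)
    have h1 := hdist x₀ hx₀ z hz
    linarith [dist_triangle z x x₀]

/-- Under strict support, a positive lower bound for the heights far from the base point exists
and is stable. -/
theorem exists_height_ge_far (hT : T.IsTarget) (hTs : T.IsStrictlySupported) {d : ℝ}
    (hd : 0 < d) : ∃ m > 0, (∀ x ∈ T.part, ∀ z ∈ T.dom, d ≤ dist z x → m ≤ height T.dom x z) ∧
      ∀ Tn : ℕ → MarkedDomain E, (∀ n, (Tn n).IsTarget) → TendstoMarked Tn T → ∀ᶠ n in atTop,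
        ∀ x ∈ (Tn n).part, ∀ z ∈ (Tn n).dom, d ≤ dist z x → m ≤ height (Tn n).dom x z := by
  -- Growth is taken from distance `d / 2` on, because the stable bound holds only from twice the
  -- initial distance.
  obtain ⟨c, hc, hgrow⟩ := hT.exists_linear_growth hTs (half_pos hd)
  refine ⟨c * (d / 2), by positivity, fun x hx z hz hdz => ?_, fun Tn hTn h => ?_⟩
  · refine le_trans ?_ (hgrow x (subset_closure hx) z hz (by linarith))
    exact mul_le_mul_of_nonneg_left (by linarith) hc.le
  · filter_upwards [h.eventually_height_ge hT.toIsSource (fun n => (hTn n).toIsSource)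
      hc (half_pos hd) (Z := T.dom) (Zn := fun n => (Tn n).dom) (fun e he => by
        filter_upwards [h.hausdorff_dom.eventually (gt_mem_nhds (ENNReal.ofReal_pos.2 he))]
          with n hn z hz
        obtain ⟨z', hz', hlt⟩ := Metric.exists_edist_lt_of_hausdorffEDist_lt hz hn
        rw [edist_dist, ENNReal.ofReal_lt_ofReal_iff he] at hlt
        exact ⟨z', hz', hlt⟩) hgrow] with n hn x hx z hz hdz
    exact hn x hx z hz (by linarith)

theorem exists_holdsStably_coversBelowLevel {κ₁ η : ℝ} (hT : T.IsTarget)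
    (hTs : T.IsStrictlySupported) (hκ₁ : 0 < κ₁) (hη : 0 < η) :
    ∃ c : ℝ, 0 < c ∧ HoldsStably (CoversBelowLevel η) T κ₁ c := by
  obtain ⟨m, hm, h0, hstab⟩ := exists_height_ge_far hT hTs hη
  refine exists_holdsStably hT hκ₁ hm (H := fun T' => ∀ x ∈ T'.part, ∀ z ∈ T'.dom,
    η ≤ dist z x → m ≤ height T'.dom x z) ?_ ?_ h0 hstab
  · intro S p τ ε T' a c c' hτ hcc h lam hlam ε' hε' hεε F hF hFp hFA
    refine (crBall_mono ?_).trans (h lam hlam ε' hε' hεε F hF hFp hFA)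
    gcongr
  · intro κ κ₂ S T' p a τ ε hS hT' hadm ha h1 h2 hlb hub hH
    exact coversBelowLevel hS.toIsPseudoconvexPiece hT'.toIsPseudoconvexPiece
      hT'.isSupported hadm ha h1 h2 hm hlb hub hH

theorem exists_holdsStably_coversAwayFromBall {κ₁ η η' : ℝ} (hT : T.IsTarget)
    (hTs : T.IsStrictlySupported) (hκ₁ : 0 < κ₁) (hη : η < η') :
    ∃ c : ℝ, 0 < c ∧ HoldsStably (CoversAwayFromBall η η') T κ₁ c := by
  obtain ⟨m, hm, h0, hstab⟩ := exists_height_ge_far hT hTs (sub_pos.2 hη)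
  refine exists_holdsStably hT hκ₁ hm (H := fun T' => ∀ x ∈ T'.part, ∀ z ∈ T'.dom,
    η' - η ≤ dist z x → m ≤ height T'.dom x z) ?_ ?_ h0 hstab
  · intro S p τ ε T' a c c' hτ hcc h y hy ε' hε' hεε F hF hFp hFA
    refine (crBall_mono ?_).trans (h y hy ε' hε' hεε F hF hFp hFA)
    gcongr
  · intro κ κ₂ S T' p a τ ε hS hT' hadm _ h1 h2 hlb hub hH
    exact coversAwayFromBall hS.toIsPseudoconvexPiece hT'.toIsPseudoconvexPiece
      hT'.isSupported hadm h1 h2 hm hlb hub hH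

end Stability

end CRMaps

/-! ### Assembly of the three parts of the theorem in `ℂ^k`. -/

theorem mainTheorem5 (k : ℕ) (hk : 2 ≤ k) :
    -- the covering lemma
    (∀ (S T : CRMaps.MarkedDomain (EuclideanSpace ℂ (Fin k))) (p : EuclideanSpace ℂ (Fin k))
        (τ ε κ₁ κ₂ : ℝ) (F : EuclideanSpace ℂ (Fin k) → EuclideanSpace ℂ (Fin k)),
      S.IsSource → T.IsPseudoconvexPiece → T.IsSupported →
      κ₁ ∈ lowerBounds (CRMaps.leviValues S.dom S.part) →
      κ₂ ∈ upperBounds (CRMaps.leviValues T.dom T.part) →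
      S.IsAdmissible p τ ε →
      CRMaps.IsProperRelative S T.dom F → F p ∈ T.part →
        CRMaps.crBall T.dom T.part (F p)
            (√(κ₁ / (8 * κ₂) *
              (sInf {t : ℝ | ∃ x ∈ T.part, ∃ z ∈ F '' S.halfBalls p τ ε,
                t = |CRMaps.height T.dom x z|} / ε)) * τ)
          ⊆ F '' CRMaps.crBall S.dom S.part p τ) ∧
    -- the three situations, with constants which depend only on the bounds for the Levi form
    -- on the two parts and on a lower bound `m` for the heights `Λ_x(z)` in question
    (∃ C : ℝ → ℝ → ℝ → ℝ,
      (∀ κ₁ κ₂ m : ℝ, 0 < κ₁ → 0 < κ₂ → 0 < m → 0 < C κ₁ κ₂ m) ∧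
      ∀ (S T : CRMaps.MarkedDomain (EuclideanSpace ℂ (Fin k)))
        (p a : EuclideanSpace ℂ (Fin k)) (τ ε₀ κ₁ κ₂ m : ℝ),
        S.IsSource → T.IsTarget → S.IsAdmissible p τ ε₀ → a ∈ T.part →
        0 < κ₁ → 0 < κ₂ → 0 < m →
        κ₁ ∈ lowerBounds (CRMaps.leviValues S.dom S.part) →
        κ₂ ∈ upperBounds (CRMaps.leviValues T.dom T.part) →
          (∀ K : Set (EuclideanSpace ℂ (Fin k)), IsCompact K → K ⊆ T.dom →
            (∀ x ∈ T.part, ∀ z ∈ K, m ≤ CRMaps.height T.dom x z) →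
              CRMaps.CoversFromCompact K S p τ ε₀ T a (C κ₁ κ₂ m)) ∧
          (∀ η : ℝ, 0 < η →
            (∀ x ∈ T.part, ∀ z ∈ T.dom, η ≤ dist z x → m ≤ CRMaps.height T.dom x z) →
              CRMaps.CoversBelowLevel η S p τ ε₀ T a (C κ₁ κ₂ m)) ∧
          (∀ η η' : ℝ, 0 < η → η < η' →
            (∀ x ∈ T.part, ∀ z ∈ T.dom, η' - η ≤ dist z x → m ≤ CRMaps.height T.dom x z) →
              CRMaps.CoversAwayFromBall η η' S p τ ε₀ T a (C κ₁ κ₂ m))) ∧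
    -- existence of the constants for a given target, and stability with half the constants
    (∀ (T : CRMaps.MarkedDomain (EuclideanSpace ℂ (Fin k))) (κ₁ : ℝ), T.IsTarget → 0 < κ₁ →
      (∀ K : Set (EuclideanSpace ℂ (Fin k)), IsCompact K → K ⊆ T.dom →
        ∃ c : ℝ, 0 < c ∧ CRMaps.HoldsStably (CRMaps.CoversFromCompact K) T κ₁ c) ∧
      (T.IsStrictlySupported → ∀ η : ℝ, 0 < η →
        ∃ c : ℝ, 0 < c ∧ CRMaps.HoldsStably (CRMaps.CoversBelowLevel η) T κ₁ c) ∧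
      (T.IsStrictlySupported → ∀ η η' : ℝ, 0 < η → η < η' →
        ∃ c : ℝ, 0 < c ∧ CRMaps.HoldsStably (CRMaps.CoversAwayFromBall η η') T κ₁ c)) := by
  have hE : 1 < Module.finrank ℂ (EuclideanSpace ℂ (Fin k)) := by
    rw [finrank_euclideanSpace_fin]; omega
  refine ⟨?_, ⟨CRMaps.coverConst, fun κ₁ κ₂ m h1 h2 hm => CRMaps.coverConst_pos h1 h2 hm, ?_⟩, ?_⟩
  · intro S T p τ ε κ₁ κ₂ F hS hT hTs h1 h2 hadm hF hFp
    exact CRMaps.covering_lemma hE hS hT hTs h1 h2 hadm hF hFp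
  · intro S T p a τ ε₀ κ₁ κ₂ m hS hT hadm ha h1 h2 hm hlb hub
    have hS' := hS.toIsPseudoconvexPiece
    have hT' := hT.toIsPseudoconvexPiece
    exact ⟨fun K _ _ hK => CRMaps.coversFromCompact hE hS' hT' hT.isSupported hadm ha h1 h2 hm
        hlb hub hK,
      fun η _ hd => CRMaps.coversBelowLevel hS' hT' hT.isSupported hadm ha h1 h2 hm hlb hub hd,
      fun η η' _ _ hd => CRMaps.coversAwayFromBall hS' hT' hT.isSupported hadm h1 h2 hm hlb hub hd⟩
  · intro T κ₁ hT hκ₁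
    exact ⟨fun K hK hKT => CRMaps.exists_holdsStably_coversFromCompact hE hT hκ₁ hK hKT,
      fun hTs η hη => CRMaps.exists_holdsStably_coversBelowLevel hT hTs hκ₁ hη,
      fun hTs η η' _ hη => CRMaps.exists_holdsStably_coversAwayFromBall hT hTs hκ₁ hη⟩
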